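/- Let $S=\{x\in\mathbb{R}^3:|x|=1\}$ be the Euclidean unit sphere. For $f\in C^2(S)$ put $\|f\|_{C^1(S)}=\sup_S|f|+\sup_S|\nabla f|$ and let $\Sigma_f=\{(1+f(\theta))\,\theta:\theta\in S\}$ be the radial graph of $f$; when $\|f\|_{C^1(S)}$ is small this is an embedded $C^2$ surface. Let $H$ be its mean curvature (the sum of the principal curvatures, equal to $2$ on $S$) and $\mathring h=h-\tfrac{H}{2}g$ the trace-free part of its second fundamental form $h$, where $g$ is the induced metric. Then $$\sqrt{16\pi\,\mathrm{area}(\Sigma_f)}\;\le\;\int_{\Sigma_f}H\,d\mu\;+\;o(1)\int_{\Sigma_f}|\mathring h|^2\,d\mu\qquad\text{as } f\to 0 \text{ in } C^1(S).$$ That is, for every $\varepsilon>0$ there is $\delta>0$ such that for every $f\in C^2(S)$ with $\|f\|_{C^1(S)}<\delta$, $$\sqrt{16\pi\,\mathrm{area}(\Sigma_f)}\;\le\;\int_{\Sigma_f}H\,d\mu\;+\;\varepsilon\int_{\Sigma_f}|\mathring h|^2\,d\mu .$$ -/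

import Mathlib

open MeasureTheory Metric
open scoped Manifold Matrix ContDiff

noncomputable section

namespace RadialMinkowski

/-- Euclidean three-space. -/
abbrev E3 : Type := EuclideanSpace ℝ (Fin 3)

/-- The unit sphere `S = {x ∈ ℝ³ : |x| = 1}`. -/
abbrev S2 : Type := sphere (0 : E3) 1

/-- Surface measure on the unit sphere (total mass `4π`). -/
def sphereMeasure : Measure S2 := (volume : Measure E3).toSphere

/-- The extension of a map `u` on the unit sphere to `ℝ³ ∖ {0}` that is constant along rays,
`x ↦ u (x / |x|)` (with the irrelevant value `0` at the origin). -/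
def rayExt {V : Type*} [Zero V] (u : S2 → V) (x : E3) : V :=
  open Classical in
  if hx : x = 0 then 0
  else u ⟨‖x‖⁻¹ • x, by
    rw [mem_sphere_zero_iff_norm, norm_smul, norm_inv, norm_norm,
      inv_mul_cancel₀ (norm_ne_zero_iff.mpr hx)]⟩

/-- The gradient `∇f(θ)` of a function on the unit sphere, as a vector of `ℝ³` tangent to the
sphere. As the extension is constant along rays, its Euclidean gradient at a point of the sphere
has no radial part. -/
def sphereGradient (f : S2 → ℝ) (θ : S2) : E3 := gradient (rayExt f) (θ : E3)

/-- The norm `‖f‖_{C¹(S)} = sup |f| + sup |∇f|`. -/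
def c1Norm (f : S2 → ℝ) : ℝ := (⨆ θ : S2, |f θ|) + ⨆ θ : S2, ‖sphereGradient f θ‖

/-- The natural parametrization `θ ↦ (1 + f(θ)) θ` of the radial graph
`Σ = {(1 + f(θ)) θ : θ ∈ S}`. -/
def radialGraph (f : S2 → ℝ) (θ : S2) : E3 := (1 + f θ) • (θ : E3)

/-! ### Geometry of a surface parametrized by the unit sphere -/

/-- An orthonormal basis of the tangent plane `T_θ S = θ^⊥`. The quantities `areaDensity`,
`meanCurvature` and `normSqTraceFree` below do not depend on the choice. -/
def frame (θ : S2) (i : Fin 2) : E3 :=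
  haveI : Fact (Module.finrank ℝ E3 = 2 + 1) := ⟨finrank_euclideanSpace_fin⟩
  (OrthonormalBasis.fromOrthogonalSpanSingleton (𝕜 := ℝ) 2
    (v := (θ : E3)) (ne_zero_of_mem_unit_sphere θ) i : E3)

/-- First derivatives `∂ᵢ X` of the parametrization `X` with respect to the frame. -/
def tangentVec (X : S2 → E3) (θ : S2) (i : Fin 2) : E3 :=
  fderiv ℝ (rayExt X) (θ : E3) (frame θ i)

/-- Second derivatives `∂ᵢ ∂ⱼ X` of the parametrization. Since `X` is extended constantly along
rays, this differs from the second derivative of `X` along a curve in the sphere only by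
a vector tangent to the surface, so its normal component is the second fundamental form. -/
def secondDeriv (X : S2 → E3) (θ : S2) (i j : Fin 2) : E3 :=
  fderiv ℝ (fun y : E3 => fderiv ℝ (rayExt X) y (frame θ j)) (θ : E3) (frame θ i)

/-- The first fundamental form `gᵢⱼ = ∂ᵢ X · ∂ⱼ X`. -/
def firstForm (X : S2 → E3) (θ : S2) : Matrix (Fin 2) (Fin 2) ℝ :=
  Matrix.of fun i j => inner ℝ (tangentVec X θ i) (tangentVec X θ j)

/-- The vector `∂₁ X × ∂₂ X`. -/
def crossNormal (X : S2 → E3) (θ : S2) : E3 :=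
  WithLp.toLp 2 (WithLp.ofLp (tangentVec X θ 0) ⨯₃ WithLp.ofLp (tangentVec X θ 1))

/-- The unit normal pointing away from the origin; for a radial graph this is the outward
unit normal. -/
def unitNormal (X : S2 → E3) (θ : S2) : E3 :=
  (Real.sign (inner ℝ (crossNormal X θ) (X θ)) * ‖crossNormal X θ‖⁻¹) • crossNormal X θ

/-- The second fundamental form `hᵢⱼ = - ν · ∂ᵢ ∂ⱼ X`, positive definite for round spheres. -/
def secondForm (X : S2 → E3) (θ : S2) : Matrix (Fin 2) (Fin 2) ℝ :=
  Matrix.of fun i j => -inner ℝ (unitNormal X θ) (secondDeriv X θ i j)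

/-- The mean curvature `H = gⁱʲ hᵢⱼ` (equal to `2` on the unit sphere). -/
def meanCurvature (X : S2 → E3) (θ : S2) : ℝ :=
  ((firstForm X θ)⁻¹ * secondForm X θ).trace

/-- The trace-free second fundamental form `h - (H / 2) g`. -/
def traceFreeForm (X : S2 → E3) (θ : S2) : Matrix (Fin 2) (Fin 2) ℝ :=
  secondForm X θ - (meanCurvature X θ / 2) • firstForm X θ

/-- The squared norm `gⁱᵏ gʲˡ h̊ᵢⱼ h̊ₖₗ` of the trace-free second fundamental form. -/
def normSqTraceFree (X : S2 → E3) (θ : S2) : ℝ :=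
  ((firstForm X θ)⁻¹ * traceFreeForm X θ * (firstForm X θ)⁻¹ * traceFreeForm X θ).trace

/-- The area element `√(det g)` of the surface relative to the unit sphere. -/
def areaDensity (X : S2 → E3) (θ : S2) : ℝ := √(firstForm X θ).det

/-- The integral over the surface, with respect to its area measure, of the function which
takes the value `φ θ` at the point `X θ`. -/
def surfaceIntegral (X : S2 → E3) (φ : S2 → ℝ) : ℝ :=
  ∫ θ, φ θ * areaDensity X θ ∂sphereMeasure

/-- The area of the surface. -/
def area (X : S2 → E3) : ℝ := surfaceIntegral X fun _ => 1

end RadialMinkowski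

end

noncomputable section

namespace RadialMinkowski

/-! ### Integration on the sphere -/

/-! Fix a point p near the origin and put ρ = |X − p|, n = (X − p)/ρ, σ = ⟨n, ν⟩ and τ = 1 − σ ≥ 0.
The divergence theorem for n gives ∫ Hσ = ∫ (1 + σ²)/ρ, and the solid angle of the surface seen from
p gives ∫ σ/ρ² = 4π. Hence for R > 0, with x = R/ρ and h = H − 2/R, R ∫ H − A − 4πR² = ∫ (R h τ + τ
+ τ((1 − x)² + τx) − (1 − x)²). Since √(16πA) ≤ A/R + 4πR for every R, a lower bound for the
right-hand side suffices. Two of its terms can be negative.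

The term (1 − x)² is absorbed by τ. The point p (`exists_center`) and the number R (`exists_radius`)
are chosen so that m = 1 − R/ρ is orthogonal on the unit sphere to the linear functions and to the
constants. The next eigenvalue of the Laplacian is 6, so 6 ∫ m² ≤ ∫ |∇m|² (`six_mul_sphereForm_le`).
Moreover |∇m|² ≤ 21/5 τ, because ∇m sees only the tangential part of n. The resulting loss is about
0.7 τ, less than the available τ.

The term R h τ is absorbed by η h² and a small multiple of τ, since τ = O(δ²) when the C¹ norm is at
most δ. By Gauss–Bonnet (`exists_gaussCurvature`), ∫ h² is twice ∫ |h̊|² minus 4/R times the deficit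
∫ H − A/R − 4πR, so η h² costs only a small multiple of ∫ |h̊|².

The exact integral identities all rest on `integral_bracket`: the form db ∧ dc integrates to zero
over the sphere, which follows from rotation invariance of the measure. The Poincaré inequality is
obtained by decomposing powers of linear forms into eigenfunctions and by density of their sums. -/

instance : IsFiniteMeasure sphereMeasure := by unfold sphereMeasure; infer_instance

instance : sphereMeasure.IsOpenPosMeasure := by unfold sphereMeasure; infer_instance

theorem sphereMeasure_univ : sphereMeasure.real Set.univ = 4 * Real.pi := by
  unfold sphereMeasure
  rw [Measure.toSphere_real_apply_univ, finrank_euclideanSpace_fin, measureReal_def,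
    EuclideanSpace.volume_ball_fin_three]
  rw [ENNReal.toReal_mul, ENNReal.toReal_pow, ENNReal.toReal_ofReal zero_le_one,
    ENNReal.toReal_ofReal (by positivity)]
  push_cast
  ring

theorem continuous_restrict_sphere {V : Type*} [TopologicalSpace V] {g : E3 → V}
    (hg : ContinuousOn g {0}ᶜ) : Continuous fun θ : S2 => g θ :=
  hg.comp_continuous continuous_subtype_val fun θ => ne_zero_of_mem_unit_sphere θ

theorem integrable_sphere {g : S2 → ℝ} (hg : Continuous g) : Integrable g sphereMeasure :=
  hg.integrable_of_hasCompactSupport (HasCompactSupport.of_compactSpace g)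

open scoped Pointwise in
/-- The linear isometry of `ℝ³` that restricts to `U` on the sphere preserves its measure. -/
theorem measurePreserving_sphereMap (U : E3 ≃ₗᵢ[ℝ] E3) :
    MeasurePreserving (fun θ : S2 => (⟨U θ, by simp⟩ : S2)) sphereMeasure sphereMeasure := by
  have hm : Measurable (fun θ : S2 => (⟨U θ, by simp⟩ : S2)) :=
    (U.continuous.measurable.comp measurable_subtype_coe).subtype_mk
  refine ⟨hm, Measure.ext fun s hs => ?_⟩
  unfold sphereMeasure
  rw [Measure.map_apply hm hs, Measure.toSphere_apply' _ hs, Measure.toSphere_apply' _ (hm hs)]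
  congr 1
  rw [← U.measurePreserving.measure_preimage_emb U.toHomeomorph.measurableEmbedding
    (Set.Ioo (0 : ℝ) 1 • (Subtype.val '' s))]
  congr 1
  ext x
  simp only [Set.mem_smul, Set.mem_image, Set.mem_preimage]
  constructor
  · rintro ⟨r, hr, _, ⟨θ, hθ, rfl⟩, rfl⟩
    exact ⟨r, hr, _, ⟨_, hθ, rfl⟩, by simp⟩
  · rintro ⟨r, hr, _, ⟨θ, hθ, rfl⟩, h⟩
    refine ⟨r, hr, U.symm θ, ⟨⟨U.symm θ, by simp⟩, by simpa using hθ, rfl⟩, ?_⟩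
    apply U.injective
    simp [h]

theorem integral_sphereMap (U : E3 ≃ₗᵢ[ℝ] E3) (g : E3 → ℝ) :
    ∫ θ : S2, g (U θ) ∂sphereMeasure = ∫ θ : S2, g θ ∂sphereMeasure := by
  have hemb : MeasurableEmbedding (fun θ : S2 => (⟨U θ, by simp⟩ : S2)) := by
    refine Topology.IsClosedEmbedding.measurableEmbedding ?_
    refine Continuous.isClosedEmbedding (by fun_prop) fun a b h => ?_
    exact Subtype.ext (U.injective (congrArg Subtype.val h))
  exact (measurePreserving_sphereMap U).integral_comp hemb (fun θ : S2 => g θ)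

/-- The infinitesimal rotation in the plane of the `j`-th and `k`-th coordinates. -/
def rotField (j k : Fin 3) (x : E3) : E3 :=
  x j • EuclideanSpace.single k 1 - x k • EuclideanSpace.single j 1

/-- The rotation by the angle `t` in the plane of the `j`-th and `k`-th coordinates. -/
def rotMap (j k : Fin 3) (t : ℝ) (x : E3) : E3 :=
  x + ((Real.cos t - 1) * x j - Real.sin t * x k) • EuclideanSpace.single j (1 : ℝ)
    + (Real.sin t * x j + (Real.cos t - 1) * x k) • EuclideanSpace.single k (1 : ℝ)

theorem rotMap_zero (j k : Fin 3) (x : E3) : rotMap j k 0 x = x := by simp [rotMap]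

theorem norm_rotMap {j k : Fin 3} (hjk : j ≠ k) (t : ℝ) (x : E3) : ‖rotMap j k t x‖ = ‖x‖ := by
  rw [EuclideanSpace.norm_eq, EuclideanSpace.norm_eq]
  congr 1
  have h := Real.sin_sq_add_cos_sq t
  fin_cases j <;> fin_cases k <;> simp [rotMap, Fin.sum_univ_three] at hjk ⊢ <;> grind

/-- The rotation as a linear isometric equivalence. -/
def rotEquiv {j k : Fin 3} (hjk : j ≠ k) (t : ℝ) : E3 ≃ₗᵢ[ℝ] E3 :=
  LinearIsometry.toLinearIsometryEquiv
    { toFun := rotMap j k t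
      map_add' := fun x y => by
        ext i; simp [rotMap]; split_ifs <;> ring
      map_smul' := fun c x => by
        ext i; simp [rotMap]; split_ifs <;> ring
      norm_map' := norm_rotMap hjk t } rfl

@[simp] theorem rotEquiv_apply {j k : Fin 3} (hjk : j ≠ k) (t : ℝ) (x : E3) :
    rotEquiv hjk t x = rotMap j k t x := rfl

theorem hasDerivAt_rotMap {j k : Fin 3} (hjk : j ≠ k) (t : ℝ) (x : E3) :
    HasDerivAt (fun s => rotMap j k s x) (rotField j k (rotMap j k t x)) t := by
  have h1 : HasDerivAt (fun s => (Real.cos s - 1) * x j - Real.sin s * x k)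
      (-Real.sin t * x j - Real.cos t * x k) t :=
    (((Real.hasDerivAt_cos t).sub_const 1).mul_const _).sub
      ((Real.hasDerivAt_sin t).mul_const _)
  have h2 : HasDerivAt (fun s => Real.sin s * x j + (Real.cos s - 1) * x k)
      (Real.cos t * x j + -Real.sin t * x k) t :=
    ((Real.hasDerivAt_sin t).mul_const _).add
      (((Real.hasDerivAt_cos t).sub_const 1).mul_const _)
  have h := ((h1.smul_const (EuclideanSpace.single j (1 : ℝ) : E3)).const_add x).add
    (h2.smul_const (EuclideanSpace.single k (1 : ℝ) : E3))
  convert! h using 1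
  simp only [rotField, rotMap]
  ext i
  simp [hjk, hjk.symm]
  split_ifs <;> ring

/-- The derivative of a function along an infinitesimal rotation. -/
def rotDeriv (j k : Fin 3) (φ : E3 → ℝ) (x : E3) : ℝ := fderiv ℝ φ x (rotField j k x)

theorem isOpen_punctured : IsOpen ({0}ᶜ : Set E3) := isOpen_compl_singleton

theorem continuous_rotField (j k : Fin 3) : Continuous (rotField j k) := by
  unfold rotField; fun_prop

theorem continuousOn_rotDeriv {φ : E3 → ℝ} (hφ : ContDiffOn ℝ 1 φ {0}ᶜ) (j k : Fin 3) :
    ContinuousOn (rotDeriv j k φ) {0}ᶜ :=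
  (hφ.continuousOn_fderiv_of_isOpen isOpen_punctured le_rfl).clm_apply
    (continuous_rotField j k).continuousOn

theorem differentiableAt_of_contDiffOn {V : Type*} [NormedAddCommGroup V] [NormedSpace ℝ V]
    {φ : E3 → V} (hφ : ContDiffOn ℝ 1 φ {0}ᶜ) {x : E3} (hx : x ≠ 0) : DifferentiableAt ℝ φ x :=
  (hφ.contDiffAt (isOpen_punctured.mem_nhds hx)).differentiableAt (by simp)

/-- The integral over the sphere of the derivative along an infinitesimal rotation vanishes. -/
theorem integral_rotDeriv {φ : E3 → ℝ} (hφ : ContDiffOn ℝ 1 φ {0}ᶜ) (j k : Fin 3) :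
    ∫ θ : S2, rotDeriv j k φ θ ∂sphereMeasure = 0 := by
  rcases eq_or_ne j k with rfl | hjk
  · simp [rotDeriv, rotField]
  have hcont := continuous_restrict_sphere (continuousOn_rotDeriv hφ j k)
  obtain ⟨C, hC⟩ := (isCompact_range hcont).isBounded.exists_norm_le
  have hne : ∀ (t : ℝ) (θ : S2), rotMap j k t θ ≠ 0 := fun t θ => by
    rw [← norm_ne_zero_iff, norm_rotMap hjk]; simp
  have hcomp : ∀ t : ℝ, Continuous fun θ : S2 => φ (rotMap j k t θ) := fun t =>
    hφ.continuousOn.comp_continuous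
      ((rotEquiv hjk t).continuous.comp continuous_subtype_val) (hne t)
  -- By rotation invariance the integral of φ over the rotated sphere does not depend on t; the
  -- claim is its derivative at t = 0, taken under the integral sign.
  have key := hasDerivAt_integral_of_dominated_loc_of_deriv_le (μ := sphereMeasure)
    (F := fun t (θ : S2) => φ (rotMap j k t θ))
    (F' := fun t (θ : S2) => rotDeriv j k φ (rotMap j k t θ)) (x₀ := 0) (s := Set.univ)
    (bound := fun _ => C) Filter.univ_mem
    (Filter.Eventually.of_forall fun t => (hcomp t).aestronglyMeasurable)
    (integrable_sphere (hcomp 0))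
    (by simpa only [rotMap_zero] using hcont.aestronglyMeasurable)
    (Filter.Eventually.of_forall fun θ t _ => by
      have := hC (rotDeriv j k φ (rotMap j k t θ))
        ⟨⟨rotMap j k t θ, by simp [norm_rotMap hjk]⟩, rfl⟩
      exact this)
    (integrable_const C)
    (Filter.Eventually.of_forall fun θ t _ =>
      (differentiableAt_of_contDiffOn hφ (hne t θ)).hasFDerivAt.comp_hasDerivAt t
        (hasDerivAt_rotMap hjk t θ))
  have hconst : (fun t => ∫ θ : S2, φ (rotMap j k t θ) ∂sphereMeasure) =
      fun _ => ∫ θ : S2, φ θ ∂sphereMeasure := by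
    funext t
    exact integral_sphereMap (rotEquiv hjk t) φ
  have h2 := key.2
  rw [hconst] at h2
  simpa only [rotMap_zero] using h2.unique (hasDerivAt_const _ _)

theorem rotDeriv_mul {φ ψ : E3 → ℝ} {x : E3} (hφ : DifferentiableAt ℝ φ x)
    (hψ : DifferentiableAt ℝ ψ x) (j k : Fin 3) :
    rotDeriv j k (fun y => φ y * ψ y) x = φ x * rotDeriv j k ψ x + ψ x * rotDeriv j k φ x := by
  simp [rotDeriv, fderiv_fun_mul hφ hψ]

/-! ### The bracket of two functions on the sphere -/

/-- The standard basis of `ℝ³`. -/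
abbrev stdVec (i : Fin 3) : E3 := EuclideanSpace.single i 1

/-- The triple product of `x` with the gradients of two linear functionals. -/
def covectorBracket (x : E3) (B C : E3 →L[ℝ] ℝ) : ℝ :=
  x 0 * (B (stdVec 1) * C (stdVec 2) - B (stdVec 2) * C (stdVec 1)) +
  x 1 * (B (stdVec 2) * C (stdVec 0) - B (stdVec 0) * C (stdVec 2)) +
  x 2 * (B (stdVec 0) * C (stdVec 1) - B (stdVec 1) * C (stdVec 0))

/-- The triple product `det (x, ∇b, ∇c)`. -/
def bracket (b c : E3 → ℝ) (x : E3) : ℝ := covectorBracket x (fderiv ℝ b x) (fderiv ℝ c x)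

theorem covectorBracket_sub_right (x : E3) (B C D : E3 →L[ℝ] ℝ) :
    covectorBracket x B (C - D) = covectorBracket x B C - covectorBracket x B D := by
  simp [covectorBracket]; ring

theorem abs_covectorBracket_le {x : E3} (hx : ‖x‖ = 1) (B C : E3 →L[ℝ] ℝ) :
    |covectorBracket x B C| ≤ 6 * (‖B‖ * ‖C‖) := by
  have hB : ∀ i, |B (stdVec i)| ≤ ‖B‖ := fun i => by simpa using B.le_opNorm (stdVec i)
  have hC : ∀ i, |C (stdVec i)| ≤ ‖C‖ := fun i => by simpa using C.le_opNorm (stdVec i)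
  have hX : ∀ i, |x i| ≤ 1 := fun i => by
    have := PiLp.norm_apply_le (p := 2) x i
    rwa [hx, Real.norm_eq_abs] at this
  have h2 : ∀ i j, |B (stdVec i) * C (stdVec j)| ≤ ‖B‖ * ‖C‖ := fun i j => by
    rw [abs_mul]; exact mul_le_mul (hB i) (hC j) (abs_nonneg _) (norm_nonneg _)
  have h3 : ∀ i j k, |x k * (B (stdVec i) * C (stdVec j) - B (stdVec j) * C (stdVec i))| ≤
      2 * (‖B‖ * ‖C‖) := fun i j k => by
    rw [abs_mul]
    calc _ ≤ 1 * (‖B‖ * ‖C‖ + ‖B‖ * ‖C‖) :=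
          mul_le_mul (hX k) ((abs_sub _ _).trans (add_le_add (h2 i j) (h2 j i)))
            (abs_nonneg _) zero_le_one
      _ = _ := by ring
  unfold covectorBracket
  refine (abs_add_le _ _).trans ?_
  have := abs_add_le (x 0 * (B (stdVec 1) * C (stdVec 2) - B (stdVec 2) * C (stdVec 1)))
    (x 1 * (B (stdVec 2) * C (stdVec 0) - B (stdVec 0) * C (stdVec 2)))
  linarith [h3 1 2 0, h3 2 0 1, h3 0 1 2]

theorem continuousOn_bracket {b c : E3 → ℝ} (hb : ContDiffOn ℝ 1 b {0}ᶜ)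
    (hc : ContDiffOn ℝ 1 c {0}ᶜ) : ContinuousOn (bracket b c) {0}ᶜ := by
  have h1 := hb.continuousOn_fderiv_of_isOpen isOpen_punctured le_rfl
  have h2 := hc.continuousOn_fderiv_of_isOpen isOpen_punctured le_rfl
  have hB : ∀ i, ContinuousOn (fun x => fderiv ℝ b x (stdVec i)) {0}ᶜ :=
    fun i => h1.clm_apply continuousOn_const
  have hC : ∀ i, ContinuousOn (fun x => fderiv ℝ c x (stdVec i)) {0}ᶜ :=
    fun i => h2.clm_apply continuousOn_const
  have hX : ∀ i, ContinuousOn (fun x : E3 => x i) {0}ᶜ := fun i => by fun_prop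
  unfold bracket covectorBracket
  exact (((hX 0).mul (((hB 1).mul (hC 2)).sub ((hB 2).mul (hC 1)))).add
    ((hX 1).mul (((hB 2).mul (hC 0)).sub ((hB 0).mul (hC 2))))).add
    ((hX 2).mul (((hB 0).mul (hC 1)).sub ((hB 1).mul (hC 0))))

/-- The bracket equals (x × ∇) · (b ∇c), a sum of rotational derivatives: the terms with second
derivatives of c form b (x × ∇) · ∇c, which vanishes by symmetry of the Hessian. -/
theorem integral_bracket_of_contDiff {b c : E3 → ℝ} (hb : ContDiffOn ℝ 1 b {0}ᶜ)
    (hc : ContDiff ℝ 2 c) : ∫ θ : S2, bracket b c θ ∂sphereMeasure = 0 := by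
  have hd : ∀ i, ContDiff ℝ 1 fun x => fderiv ℝ c x (stdVec i) := fun i =>
    (hc.fderiv_right (m := 1) (by norm_num)).clm_apply contDiff_const
  have hbd : ∀ i, ContDiffOn ℝ 1 (fun x => b x * fderiv ℝ c x (stdVec i)) {0}ᶜ := fun i =>
    hb.mul (hd i).contDiffOn
  have key : ∀ θ : S2, bracket b c θ =
      rotDeriv 1 2 (fun x => b x * fderiv ℝ c x (stdVec 0)) θ +
      rotDeriv 2 0 (fun x => b x * fderiv ℝ c x (stdVec 1)) θ +
      rotDeriv 0 1 (fun x => b x * fderiv ℝ c x (stdVec 2)) θ := by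
    intro θ
    have hbθ := differentiableAt_of_contDiffOn hb (ne_zero_of_mem_unit_sphere θ)
    have hdθ : ∀ i, DifferentiableAt ℝ (fun x => fderiv ℝ c x (stdVec i)) (θ : E3) :=
      fun i => (hd i).differentiable (by simp) _
    rw [rotDeriv_mul hbθ (hdθ 0), rotDeriv_mul hbθ (hdθ 1), rotDeriv_mul hbθ (hdθ 2)]
    have hc2 : DifferentiableAt ℝ (fderiv ℝ c) (θ : E3) :=
      (hc.fderiv_right (m := 1) (by norm_num)).differentiable (by simp) _
    have hsymm : IsSymmSndFDerivAt ℝ c (θ : E3) := hc.contDiffAt.isSymmSndFDerivAt (by simp)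
    have hpart : ∀ (i : Fin 3) (v : E3), fderiv ℝ (fun x => fderiv ℝ c x (stdVec i)) (θ : E3) v =
        fderiv ℝ (fderiv ℝ c) (θ : E3) v (stdVec i) := fun i v => by
      rw [fderiv_clm_apply hc2 (differentiableAt_const _)]; simp
    have s01 := hsymm.eq (stdVec 0) (stdVec 1)
    have s02 := hsymm.eq (stdVec 0) (stdVec 2)
    have s12 := hsymm.eq (stdVec 1) (stdVec 2)
    simp only [rotDeriv, rotField, hpart, bracket, covectorBracket, map_sub, map_smul, smul_eq_mul,
      sub_apply, smul_apply]
    simp only [stdVec] at *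
    rw [s01, s02, s12]
    ring
  have hint : ∀ j k i, Integrable
      (fun θ : S2 => rotDeriv j k (fun x => b x * fderiv ℝ c x (stdVec i)) θ) sphereMeasure :=
    fun j k i => integrable_sphere (continuous_restrict_sphere (continuousOn_rotDeriv (hbd i) j k))
  have hint2 : Integrable (fun θ : S2 => rotDeriv 1 2 (fun x => b x * fderiv ℝ c x (stdVec 0)) θ +
      rotDeriv 2 0 (fun x => b x * fderiv ℝ c x (stdVec 1)) θ) sphereMeasure :=
    (hint _ _ _).add (hint _ _ _)
  simp_rw [key]
  rw [integral_add hint2 (hint _ _ _), integral_add (hint _ _ _) (hint _ _ _), integral_rotDeriv (hbd _), integral_rotDeriv (hbd _),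
    integral_rotDeriv (hbd _)]
  simp

/-- A compactly supported `C¹` function has smooth uniform approximations in `C¹`. -/
theorem exists_contDiff_fderiv_close {g : E3 → ℝ} (hg : ContDiff ℝ 1 g)
    (hgs : HasCompactSupport g) {ε : ℝ} (hε : 0 < ε) :
    ∃ c : E3 → ℝ, ContDiff ℝ 2 c ∧ ∀ x, ‖fderiv ℝ c x - fderiv ℝ g x‖ ≤ ε := by
  have hcont : Continuous (fderiv ℝ g) := hg.continuous_fderiv one_ne_zero
  have huc : UniformContinuous (fderiv ℝ g) := (hgs.fderiv ℝ).uniformContinuous_of_continuous hcont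
  obtain ⟨d, hd, hclose⟩ := Metric.uniformContinuous_iff.1 huc ε hε
  let φ : ContDiffBump (0 : E3) := ⟨d / 2, d, by positivity, by linarith⟩
  have hli : LocallyIntegrable (φ.normed volume) (volume : Measure E3) :=
    φ.continuous_normed.locallyIntegrable
  -- Mollification at scale d: the derivative falls on g, so it is an average of values of `fderiv ℝ
  -- g` within distance d, where they vary by less than ε.
  refine ⟨convolution (φ.normed volume) g (ContinuousLinearMap.lsmul ℝ ℝ) volume, ?_, fun x => ?_⟩
  · exact (φ.hasCompactSupport_normed).contDiff_convolution_left _ φ.contDiff_normed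
      hg.continuous.locallyIntegrable
  · rw [(hgs.hasFDerivAt_convolution_right (ContinuousLinearMap.lsmul ℝ ℝ) hli hg x).fderiv]
    have : convolution (φ.normed volume) (fderiv ℝ g)
        (ContinuousLinearMap.precompR E3 (ContinuousLinearMap.lsmul ℝ ℝ)) volume x =
        convolution (φ.normed volume) (fderiv ℝ g) (ContinuousLinearMap.lsmul ℝ ℝ) volume x := by
      unfold convolution
      congr 1
    rw [this, ← dist_eq_norm]
    exact φ.dist_normed_convolution_le hcont.aestronglyMeasurable fun y hy => (hclose hy).le

/-- A function that is `C¹` away from the origin agrees near the sphere with a compactly supported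
`C¹` function. -/
theorem exists_contDiff_eq_near_sphere {c : E3 → ℝ} (hc : ContDiffOn ℝ 1 c {0}ᶜ) :
    ∃ g : E3 → ℝ, ContDiff ℝ 1 g ∧ HasCompactSupport g ∧
      ∀ θ : S2, fderiv ℝ g (θ : E3) = fderiv ℝ c (θ : E3) := by
  let φ : ContDiffBump (0 : E3) := ⟨2, 3, by norm_num, by norm_num⟩
  let ψ : ContDiffBump (0 : E3) := ⟨1 / 4, 1 / 2, by norm_num, by norm_num⟩
  -- The cutoff φ − ψ is 1 for 1/2 ≤ |x| ≤ 2 and vanishes near the origin, where both bumps equal 1,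
  -- and outside the ball of radius 3.
  refine ⟨fun x => (φ x - ψ x) * c x, ?_, ?_, fun θ => ?_⟩
  · rw [contDiff_iff_contDiffAt]
    intro x
    by_cases hx : x = 0
    · subst hx
      refine (contDiffAt_const (c := (0 : ℝ))).congr_of_eventuallyEq ?_
      filter_upwards [ball_mem_nhds (0 : E3) (by norm_num : (0 : ℝ) < 1 / 4)] with y hy
      have hy1 : y ∈ closedBall (0 : E3) ψ.rIn := ball_subset_closedBall hy
      have hy2 : y ∈ closedBall (0 : E3) φ.rIn :=
        closedBall_subset_closedBall (by norm_num [φ, ψ]) hy1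
      simp [φ.one_of_mem_closedBall hy2, ψ.one_of_mem_closedBall hy1]
    · exact (φ.contDiffAt.sub ψ.contDiffAt).mul (hc.contDiffAt (isOpen_punctured.mem_nhds hx))
  · exact (φ.hasCompactSupport.sub ψ.hasCompactSupport).mul_right
  · refine Filter.EventuallyEq.fderiv_eq ?_
    have h1 : ∀ᶠ y in nhds (θ : E3), y ∈ ball (0 : E3) 2 := isOpen_ball.mem_nhds (by simp)
    have h2 : ∀ᶠ y in nhds (θ : E3), y ∈ (closedBall (0 : E3) (1 / 2))ᶜ :=
      isClosed_closedBall.isOpen_compl.mem_nhds (by simp; norm_num)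
    filter_upwards [h1, h2] with y hy1 hy2
    have e1 : φ y = 1 := φ.one_of_mem_closedBall (ball_subset_closedBall hy1)
    have e2 : ψ y = 0 := ψ.zero_of_le_dist (by simpa [ψ] using (not_le.1 (by simpa using hy2)).le)
    simp [e1, e2]

/-- The integral over the sphere of the bracket of two `C¹` functions vanishes. -/
theorem integral_bracket {b c : E3 → ℝ} (hb : ContDiffOn ℝ 1 b {0}ᶜ)
    (hc : ContDiffOn ℝ 1 c {0}ᶜ) : ∫ θ : S2, bracket b c θ ∂sphereMeasure = 0 := by
  obtain ⟨g, hg, hgs, hgc⟩ := exists_contDiff_eq_near_sphere hc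
  have hbc := continuous_restrict_sphere
    (hb.continuousOn_fderiv_of_isOpen isOpen_punctured le_rfl)
  obtain ⟨M, hM⟩ := (isCompact_range hbc).isBounded.exists_norm_le
  have hM' : ∀ θ : S2, ‖fderiv ℝ b (θ : E3)‖ ≤ |M| := fun θ => (hM _ ⟨θ, rfl⟩).trans (le_abs_self M)
  have hbound : ∀ ε : ℝ, 0 < ε →
      |∫ θ : S2, bracket b c θ ∂sphereMeasure| ≤ ε * (6 * |M| * (4 * Real.pi)) := by
    intro ε hε
    obtain ⟨c', hc', hclose⟩ := exists_contDiff_fderiv_close hg hgs hε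
    have hint := integrable_sphere (continuous_restrict_sphere (continuousOn_bracket hb hc))
    have hint' := integrable_sphere (continuous_restrict_sphere
      (continuousOn_bracket hb (hc'.of_le (by norm_num)).contDiffOn))
    have h0 := integral_bracket_of_contDiff hb hc'
    -- No second derivative of c is available, so c is replaced by a C² function. The bracket
    -- involves only first derivatives, which are uniformly close.
    have : ∫ θ : S2, bracket b c θ ∂sphereMeasure =
        ∫ θ : S2, (bracket b c θ - bracket b c' θ) ∂sphereMeasure := by
      rw [integral_sub hint hint', h0, sub_zero]
    rw [this, ← Real.norm_eq_abs]
    refine (norm_integral_le_of_norm_le_const (C := 6 * (|M| * ε))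
      (Filter.Eventually.of_forall fun θ => ?_)).trans ?_
    · rw [bracket, bracket, ← covectorBracket_sub_right, Real.norm_eq_abs]
      refine (abs_covectorBracket_le (by simp) _ _).trans ?_
      gcongr
      · exact hM' θ
      · rw [norm_sub_rev, ← hgc]; exact hclose _
    · rw [sphereMeasure_univ]; apply le_of_eq; ring
  have hK : 0 ≤ 6 * |M| * (4 * Real.pi) := by positivity
  rw [← abs_eq_zero]
  refine le_antisymm (le_of_forall_pos_le_add fun ε hε => ?_) (abs_nonneg _)
  -- The summand 1 keeps the divisor positive when M = 0.
  have hK1 : 0 < 6 * |M| * (4 * Real.pi) + 1 := by linarith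
  refine (hbound (ε / (6 * |M| * (4 * Real.pi) + 1)) (by positivity)).trans ?_
  rw [zero_add, div_mul_eq_mul_div, div_le_iff₀ hK1]
  nlinarith

/-! ### A Poincaré inequality on the sphere -/

/-- Functions that are `C¹` away from the origin. -/
def puncturedC1 : Submodule ℝ (E3 → ℝ) where
  carrier := {φ | ContDiffOn ℝ 1 φ {0}ᶜ}
  add_mem' := fun ha hb => ContDiffOn.add ha hb
  zero_mem' := contDiffOn_const
  smul_mem' := fun _ _ h => contDiffOn_const.smul h

theorem differentiableAt_puncturedC1 (φ : puncturedC1) (θ : S2) :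
    DifferentiableAt ℝ (φ : E3 → ℝ) (θ : E3) :=
  differentiableAt_of_contDiffOn φ.2 (ne_zero_of_mem_unit_sphere θ)

theorem integrable_mul_puncturedC1 (φ ψ : puncturedC1) :
    Integrable (fun θ : S2 => (φ : E3 → ℝ) θ * (ψ : E3 → ℝ) θ) sphereMeasure :=
  integrable_sphere ((continuous_restrict_sphere φ.2.continuousOn).mul
    (continuous_restrict_sphere ψ.2.continuousOn))

theorem integrable_rotDeriv_mul (φ ψ : puncturedC1) (j k : Fin 3) :
    Integrable (fun θ : S2 => rotDeriv j k φ θ * rotDeriv j k ψ θ) sphereMeasure :=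
  integrable_sphere ((continuous_restrict_sphere (continuousOn_rotDeriv φ.2 j k)).mul
    (continuous_restrict_sphere (continuousOn_rotDeriv ψ.2 j k)))

/-- The `L²` inner product on the sphere. -/
def sphereForm : puncturedC1 →ₗ[ℝ] puncturedC1 →ₗ[ℝ] ℝ :=
  LinearMap.mk₂ ℝ (fun φ ψ => ∫ θ : S2, (φ : E3 → ℝ) θ * (ψ : E3 → ℝ) θ ∂sphereMeasure)
    (fun φ φ' ψ => by
      simp only [Submodule.coe_add, Pi.add_apply, add_mul]
      exact integral_add (integrable_mul_puncturedC1 φ ψ) (integrable_mul_puncturedC1 φ' ψ))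
    (fun c φ ψ => by
      simp only [Submodule.coe_smul, Pi.smul_apply, smul_eq_mul, mul_assoc]
      exact integral_const_mul _ _)
    (fun φ ψ ψ' => by
      simp only [Submodule.coe_add, Pi.add_apply, mul_add]
      exact integral_add (integrable_mul_puncturedC1 φ ψ) (integrable_mul_puncturedC1 φ ψ'))
    (fun c φ ψ => by
      simp only [Submodule.coe_smul, Pi.smul_apply, smul_eq_mul, mul_left_comm _ c]
      exact integral_const_mul _ _)

/-- The `L²` inner product of the derivatives along an infinitesimal rotation. -/
def rotForm (j k : Fin 3) : puncturedC1 →ₗ[ℝ] puncturedC1 →ₗ[ℝ] ℝ :=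
  have hadd : ∀ (φ ψ : puncturedC1) (θ : S2),
      rotDeriv j k ((φ + ψ : puncturedC1) : E3 → ℝ) θ = rotDeriv j k φ θ + rotDeriv j k ψ θ :=
    fun φ ψ θ => by
      simp [rotDeriv, fderiv_add (differentiableAt_puncturedC1 φ θ) (differentiableAt_puncturedC1 ψ θ)]
  have hsmul : ∀ (c : ℝ) (φ : puncturedC1) (θ : S2),
      rotDeriv j k ((c • φ : puncturedC1) : E3 → ℝ) θ = c * rotDeriv j k φ θ :=
    fun c φ θ => by
      simp [rotDeriv, fderiv_const_smul (differentiableAt_puncturedC1 φ θ)]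
  LinearMap.mk₂ ℝ (fun φ ψ => ∫ θ : S2, rotDeriv j k φ θ * rotDeriv j k ψ θ ∂sphereMeasure)
    (fun φ φ' ψ => by
      simp only [hadd, add_mul]
      exact integral_add (integrable_rotDeriv_mul φ ψ j k) (integrable_rotDeriv_mul φ' ψ j k))
    (fun c φ ψ => by
      simp only [hsmul, smul_eq_mul, mul_assoc]
      exact integral_const_mul _ _)
    (fun φ ψ ψ' => by
      simp only [hadd, mul_add]
      exact integral_add (integrable_rotDeriv_mul φ ψ j k) (integrable_rotDeriv_mul φ ψ' j k))
    (fun c φ ψ => by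
      simp only [hsmul, smul_eq_mul, mul_left_comm _ c]
      exact integral_const_mul _ _)

/-- The Dirichlet form on the sphere. -/
def dirichletForm : puncturedC1 →ₗ[ℝ] puncturedC1 →ₗ[ℝ] ℝ :=
  rotForm 1 2 + rotForm 2 0 + rotForm 0 1

theorem sphereForm_apply (φ ψ : puncturedC1) : sphereForm φ ψ =
    ∫ θ : S2, (φ : E3 → ℝ) θ * (ψ : E3 → ℝ) θ ∂sphereMeasure := rfl

theorem rotForm_apply (j k : Fin 3) (φ ψ : puncturedC1) : rotForm j k φ ψ =
    ∫ θ : S2, rotDeriv j k φ θ * rotDeriv j k ψ θ ∂sphereMeasure := rfl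

theorem dirichletForm_apply (φ ψ : puncturedC1) : dirichletForm φ ψ =
    rotForm 1 2 φ ψ + rotForm 2 0 φ ψ + rotForm 0 1 φ ψ := rfl

theorem sphereForm_comm (φ ψ : puncturedC1) : sphereForm φ ψ = sphereForm ψ φ := by
  simp only [sphereForm_apply, mul_comm]

theorem dirichletForm_comm (φ ψ : puncturedC1) : dirichletForm φ ψ = dirichletForm ψ φ := by
  simp only [dirichletForm_apply, rotForm_apply, mul_comm]

theorem sphereForm_self_nonneg (φ : puncturedC1) : 0 ≤ sphereForm φ φ :=
  integral_nonneg fun _ => mul_self_nonneg _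

theorem dirichletForm_self_nonneg (φ : puncturedC1) : 0 ≤ dirichletForm φ φ := by
  have : ∀ j k, 0 ≤ rotForm j k φ φ := fun j k => integral_nonneg fun _ => mul_self_nonneg _
  rw [dirichletForm_apply]
  linarith [this 1 2, this 2 0, this 0 1]

/-! ### Powers of linear forms under the spherical Laplacian -/

theorem contDiff_inner_pow (a : E3) (m : ℕ) :
    ContDiff ℝ 1 fun x : E3 => (inner ℝ a x : ℝ) ^ m :=
  (innerSL ℝ a).contDiff.pow m

/-- A power of a linear form. -/
def linPow (a : E3) (m : ℕ) : puncturedC1 :=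
  ⟨fun x => (inner ℝ a x) ^ m, (contDiff_inner_pow a m).contDiffOn⟩

theorem linPow_apply (a : E3) (m : ℕ) (x : E3) : (linPow a m : E3 → ℝ) x = (inner ℝ a x) ^ m := rfl

/-- Integration by parts along an infinitesimal rotation. -/
theorem rotForm_eq_neg (j k : Fin 3) (φ ψ : puncturedC1)
    (hψ : ContDiffOn ℝ 1 (rotDeriv j k ψ) {0}ᶜ) : rotForm j k φ ψ =
      -∫ θ : S2, (φ : E3 → ℝ) θ * rotDeriv j k (rotDeriv j k ψ) θ ∂sphereMeasure := by
  have hc := continuous_restrict_sphere (continuousOn_rotDeriv hψ j k)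
  have h := integral_rotDeriv (ContDiffOn.mul φ.2 hψ) j k
  have hpt : ∀ θ : S2, rotDeriv j k (fun y => (φ : E3 → ℝ) y * rotDeriv j k ψ y) θ =
      (φ : E3 → ℝ) θ * rotDeriv j k (rotDeriv j k ψ) θ + rotDeriv j k φ θ * rotDeriv j k ψ θ :=
    fun θ => by
      rw [rotDeriv_mul (differentiableAt_puncturedC1 φ θ)
        (differentiableAt_of_contDiffOn hψ (ne_zero_of_mem_unit_sphere θ))]
      ring
  simp_rw [hpt] at h
  have hint : Integrable (fun θ : S2 => (φ : E3 → ℝ) θ * rotDeriv j k (rotDeriv j k ψ) θ)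
      sphereMeasure := integrable_sphere ((continuous_restrict_sphere φ.2.continuousOn).mul hc)
  rw [integral_add hint (integrable_rotDeriv_mul φ ψ j k)] at h
  rw [rotForm_apply]
  linarith

theorem inner_rotField (a x : E3) (j k : Fin 3) :
    inner ℝ a (rotField j k x) = x j * a k - x k * a j := by
  simp [rotField, inner_sub_right, inner_smul_right, EuclideanSpace.inner_single_right]

theorem rotDeriv_linPow (a : E3) (m : ℕ) (j k : Fin 3) : rotDeriv j k (linPow a m) =
    fun x => m * (inner ℝ a x) ^ (m - 1) * (x j * a k - x k * a j) := by
  funext x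
  have h : HasFDerivAt (linPow a m : E3 → ℝ)
      ((m * (inner ℝ a x) ^ (m - 1) : ℝ) • innerSL ℝ a) x := by
    have h1 : HasFDerivAt (fun y : E3 => (inner ℝ a y : ℝ)) (innerSL ℝ a) x :=
      (innerSL ℝ a).hasFDerivAt
    convert! h1.pow m using 1
    simp [nsmul_eq_mul]
  rw [rotDeriv, h.fderiv]
  simp [inner_rotField]

theorem rotDeriv_rotDeriv_linPow (a : E3) (m : ℕ) {j k : Fin 3} (hjk : j ≠ k) (x : E3) :
    rotDeriv j k (rotDeriv j k (linPow a m)) x =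
      m * ((m - 1 : ℕ) * (inner ℝ a x) ^ (m - 2) * (x j * a k - x k * a j) ^ 2
        - (inner ℝ a x) ^ (m - 1) * (x j * a j + x k * a k)) := by
  have hl : ContDiff ℝ 1 (linPow a (m - 1) : E3 → ℝ) :=
    contDiff_inner_pow a (m - 1)
  have h2 : HasFDerivAt (fun y : E3 => y j * a k - y k * a j)
      ((a k) • (EuclideanSpace.proj j : E3 →L[ℝ] ℝ) - (a j) • EuclideanSpace.proj k) x :=
    ((EuclideanSpace.proj j : E3 →L[ℝ] ℝ).hasFDerivAt.mul_const (a k)).sub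
      ((EuclideanSpace.proj k : E3 →L[ℝ] ℝ).hasFDerivAt.mul_const (a j))
  have h2' : rotDeriv j k (fun y : E3 => y j * a k - y k * a j) x = -(x j * a j + x k * a k) := by
    rw [rotDeriv, h2.fderiv]
    simp [rotField, hjk, hjk.symm]
    ring
  have hfun : rotDeriv j k (linPow a m) = fun x => (m : ℝ) *
      ((linPow a (m - 1) : E3 → ℝ) x * (x j * a k - x k * a j)) := by
    rw [rotDeriv_linPow]; funext x; rw [linPow_apply]; ring
  have hd := hl.differentiable (by simp) x
  have hconst : ∀ g : E3 → ℝ, DifferentiableAt ℝ g x →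
      rotDeriv j k (fun y => (m : ℝ) * g y) x = m * rotDeriv j k g x := fun g hg => by
    simp [rotDeriv, fderiv_const_mul hg]
  rw [hfun, hconst (fun y => (linPow a (m - 1) : E3 → ℝ) y * (y j * a k - y k * a j))
    (hd.mul h2.differentiableAt), rotDeriv_mul hd h2.differentiableAt, h2',
    congrFun (rotDeriv_linPow a (m - 1) j k) x, linPow_apply, Nat.sub_sub]
  ring

/-- The weak form of the action of the spherical Laplacian on powers of linear forms. -/
theorem dirichletForm_linPow (φ : puncturedC1) (a : E3) (m : ℕ) :
    dirichletForm φ (linPow a m) = m * (m + 1) * sphereForm φ (linPow a m)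
      - m * (m - 1 : ℕ) * ‖a‖ ^ 2 * sphereForm φ (linPow a (m - 2)) := by
  have hC : ∀ j k, ContDiffOn ℝ 1 (rotDeriv j k (linPow a m)) {0}ᶜ := fun j k => by
    rw [rotDeriv_linPow]
    have : ContDiff ℝ 1 fun x : E3 =>
      (m * (inner ℝ a x) ^ (m - 1) * (x j * a k - x k * a j) : ℝ) :=
      (contDiff_const.mul (contDiff_inner_pow a (m - 1))).mul (by fun_prop)
    exact this.contDiffOn
  have hI : ∀ j k, Integrable (fun θ : S2 => (φ : E3 → ℝ) θ *
      rotDeriv j k (rotDeriv j k (linPow a m)) θ) sphereMeasure := fun j k =>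
    integrable_sphere ((continuous_restrict_sphere φ.2.continuousOn).mul
      (continuous_restrict_sphere (continuousOn_rotDeriv (hC j k) j k)))
  have hI2 : Integrable (fun θ : S2 => (φ : E3 → ℝ) θ *
      rotDeriv 1 2 (rotDeriv 1 2 (linPow a m)) θ + (φ : E3 → ℝ) θ *
      rotDeriv 2 0 (rotDeriv 2 0 (linPow a m)) θ) sphereMeasure := (hI 1 2).add (hI 2 0)
  rw [dirichletForm_apply, rotForm_eq_neg _ _ _ _ (hC 1 2), rotForm_eq_neg _ _ _ _ (hC 2 0),
    rotForm_eq_neg _ _ _ _ (hC 0 1), ← neg_add, ← neg_add, ← integral_add (hI _ _) (hI _ _),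
    ← integral_add hI2 (hI _ _), sphereForm_apply, sphereForm_apply, ← integral_const_mul,
    ← integral_const_mul, ← integral_sub ((integrable_mul_puncturedC1 φ _).const_mul _)
    ((integrable_mul_puncturedC1 φ _).const_mul _), ← integral_neg]
  congr 1
  funext θ
  have hθ : (θ : E3) 0 ^ 2 + (θ : E3) 1 ^ 2 + (θ : E3) 2 ^ 2 = 1 := by
    have : ‖(θ : E3)‖ ^ 2 = 1 := by simp
    rwa [EuclideanSpace.norm_sq_eq, Fin.sum_univ_three, Real.norm_eq_abs, Real.norm_eq_abs,
      Real.norm_eq_abs, sq_abs, sq_abs, sq_abs] at this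
  have ha : ‖a‖ ^ 2 = a 0 ^ 2 + a 1 ^ 2 + a 2 ^ 2 := by
    rw [EuclideanSpace.norm_sq_eq, Fin.sum_univ_three, Real.norm_eq_abs, Real.norm_eq_abs,
      Real.norm_eq_abs, sq_abs, sq_abs, sq_abs]
  have hin : inner ℝ a (θ : E3) =
      (θ : E3) 0 * a 0 + (θ : E3) 1 * a 1 + (θ : E3) 2 * a 2 := by
    simp [PiLp.inner_apply, Fin.sum_univ_three]
  rw [rotDeriv_rotDeriv_linPow a m (by decide), rotDeriv_rotDeriv_linPow a m (by decide),
    rotDeriv_rotDeriv_linPow a m (by decide), linPow_apply, linPow_apply]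
  -- Lagrange's identity |θ × a|² = |a|² − ⟨a, θ⟩²; it turns the sum of the three squared rotational
  -- derivatives into powers of ⟨a, θ⟩.
  have lag : ((θ : E3) 1 * a 2 - (θ : E3) 2 * a 1) ^ 2 + ((θ : E3) 2 * a 0 - (θ : E3) 0 * a 2) ^ 2
      + ((θ : E3) 0 * a 1 - (θ : E3) 1 * a 0) ^ 2 = ‖a‖ ^ 2 - inner ℝ a (θ : E3) ^ 2 := by
    rw [hin, ha]
    linear_combination (a 0 ^ 2 + a 1 ^ 2 + a 2 ^ 2) * hθ
  -- Wherever a natural-number exponent m − 1 or m − 2 is truncated, its coefficient vanishes; the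
  -- small cases are therefore consistent with the general formula.
  match m with
  | 0 => simp
  | 1 => simp [hin]; ring
  | m + 2 =>
    simp only [Nat.add_sub_cancel, show m + 2 - 1 = m + 1 from rfl]
    push_cast
    have e1 : inner ℝ a (θ : E3) ^ (m + 1) = inner ℝ a (θ : E3) ^ m * inner ℝ a (θ : E3) :=
      pow_succ _ _
    have e2 : inner ℝ a (θ : E3) ^ (m + 2) = inner ℝ a (θ : E3) ^ m * inner ℝ a (θ : E3) ^ 2 :=
      pow_add _ _ _
    rw [e1, e2]
    linear_combination (-(φ : E3 → ℝ) θ * (m + 2) * (m + 1) * inner ℝ a (θ : E3) ^ m) * lag -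
      2 * (φ : E3 → ℝ) θ * (m + 2) * inner ℝ a (θ : E3) ^ m * inner ℝ a (θ : E3) * hin

/-- A function is balanced if it is orthogonal to the constants and to the linear functions. -/
def IsBalanced (u : puncturedC1) : Prop :=
  sphereForm u (linPow 0 0) = 0 ∧ ∀ a, sphereForm u (linPow a 1) = 0

/-- Weak eigenfunctions of the spherical Laplacian with the eigenvalue `k (k + 1)`; for `k < 2` we
only keep those that are orthogonal to balanced functions. -/
def harmonicSpace (k : ℕ) : Submodule ℝ puncturedC1 where
  carrier := {e | (∀ φ, dirichletForm φ e = k * (k + 1) * sphereForm φ e) ∧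
    (k < 2 → ∀ u, IsBalanced u → sphereForm u e = 0)}
  add_mem' := fun {e e'} h h' => ⟨fun φ => by rw [map_add, map_add, h.1, h'.1]; ring,
    fun hk u hu => by rw [map_add, h.2 hk u hu, h'.2 hk u hu, add_zero]⟩
  zero_mem' := by simp
  smul_mem' := fun c e h => ⟨fun φ => by
      rw [map_smul, map_smul, h.1, smul_eq_mul, smul_eq_mul]; ring,
    fun hk u hu => by rw [map_smul, h.2 hk u hu, smul_zero]⟩

/-- The Laplacian maps the power m + 2 to a multiple of itself plus a multiple of the power m. The
latter is by induction a sum of eigenfunctions with smaller eigenvalues, so the operator is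
triangular and the power m + 2 can be corrected to an eigenfunction. -/
theorem linPow_mem_iSup (a : E3) (m : ℕ) :
    linPow a m ∈ ⨆ k ∈ Finset.range (m + 1), harmonicSpace k := by
  induction m using Nat.strong_induction_on with
  | _ m ih =>
    have hle : ∀ k ∈ Finset.range (m + 1),
        harmonicSpace k ≤ ⨆ k ∈ Finset.range (m + 1), harmonicSpace k := fun k hk =>
      le_iSup₂_of_le k hk le_rfl
    match m with
    | 0 =>
      refine hle 0 (by simp) ⟨fun φ => by simp [dirichletForm_linPow], fun _ u hu => ?_⟩
      have : linPow a 0 = linPow 0 0 := Subtype.ext (by funext x; simp [linPow_apply])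
      rw [this]; exact hu.1
    | 1 =>
      exact hle 1 (by simp) ⟨fun φ => by simp [dirichletForm_linPow], fun _ u hu => hu.2 a⟩
    | m + 2 =>
      obtain ⟨e, he⟩ := (Submodule.mem_iSup_finset_iff_exists_sum _ _).1 (ih m (by omega))
      let c : ℝ := (m + 2) * (m + 1) * ‖a‖ ^ 2
      -- The coefficient b k solves b (k(k+1) − (m+2)(m+3)) = c, so that the correction cancels the
      -- lower-order term c ⟨a, ·⟩^m component by component. The divisor is nonzero because k ≤ m.
      let b : ℕ → ℝ := fun k => c / (k * (k + 1) - (m + 2) * (m + 3))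
      have hb : ∀ k ∈ Finset.range (m + 1), b k * (k * (k + 1)) = b k * ((m + 2) * (m + 3)) + c := by
        intro k hk
        have hk' : (k : ℝ) ≤ m := by exact_mod_cast Nat.lt_succ_iff.1 (Finset.mem_range.1 hk)
        have : (k * (k + 1) - (m + 2) * (m + 3) : ℝ) ≠ 0 := by
          have : (0 : ℝ) ≤ k := k.cast_nonneg
          nlinarith
        simp only [b]
        field_simp
        ring
      have hw : linPow a (m + 2) + ∑ k ∈ Finset.range (m + 1), b k • (e k : puncturedC1) ∈
          harmonicSpace (m + 2) := by
        refine ⟨fun φ => ?_, fun h => absurd h (by omega)⟩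
        have hsum : dirichletForm φ (∑ k ∈ Finset.range (m + 1), b k • (e k : puncturedC1)) =
            (m + 2) * (m + 3) *
              sphereForm φ (∑ k ∈ Finset.range (m + 1), b k • (e k : puncturedC1)) +
              c * sphereForm φ (linPow a m) := by
          rw [← he, map_sum, map_sum, map_sum, Finset.mul_sum, Finset.mul_sum,
            ← Finset.sum_add_distrib]
          refine Finset.sum_congr rfl fun k hk => ?_
          rw [map_smul, map_smul, (e k).2.1 φ, smul_eq_mul, smul_eq_mul]
          linear_combination (sphereForm φ (e k)) * hb k hk
        rw [map_add, map_add, hsum, dirichletForm_linPow]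
        simp only [Nat.add_sub_cancel, show m + 2 - 1 = m + 1 from rfl, c]
        push_cast
        ring
      have : linPow a (m + 2) = (linPow a (m + 2) +
          ∑ k ∈ Finset.range (m + 1), b k • (e k : puncturedC1)) -
          ∑ k ∈ Finset.range (m + 1), b k • (e k : puncturedC1) := by abel
      rw [this]
      refine Submodule.sub_mem _ (hle (m + 2) (by simp) hw) (Submodule.sum_mem _ fun k hk => ?_)
      exact Submodule.smul_mem _ _ (hle k
        (Finset.mem_range.2 ((Finset.mem_range.1 hk).trans (by omega))) (e k).2)

theorem linPow_mem_iSup_harmonicSpace (a : E3) (m : ℕ) : linPow a m ∈ ⨆ k, harmonicSpace k :=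
  (iSup₂_le fun k _ => le_iSup harmonicSpace k : _ ≤ ⨆ k, harmonicSpace k) (linPow_mem_iSup a m)

/-- Cauchy–Schwarz for a form that is only semidefinite: elements of `puncturedC1` are functions on
space, and the form sees nothing but their restriction to the sphere. -/
theorem sphereForm_eq_zero_of_self {u e : puncturedC1} (he : sphereForm e e = 0) :
    sphereForm u e = 0 := by
  by_contra h
  -- The multiple of e is chosen so that the squared norm of the difference would be −1.
  have hs := sphereForm_self_nonneg (u - ((sphereForm u u + 1) / (2 * sphereForm u e)) • e)
  rw [map_sub, LinearMap.map_sub₂, LinearMap.map_sub₂, map_smul, map_smul,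
    map_smul, LinearMap.smul_apply, LinearMap.smul_apply, he, sphereForm_comm e u] at hs
  simp only [smul_eq_mul, mul_zero] at hs
  field_simp at hs
  linarith

/-- Bessel's inequality for the Dirichlet form of a balanced function. -/
theorem six_mul_sub_le_dirichletForm {u v : puncturedC1} (hu : IsBalanced u)
    (hv : v ∈ ⨆ k, harmonicSpace k) :
    6 * (sphereForm u u - sphereForm (u - v) (u - v)) ≤ dirichletForm u u := by
  obtain ⟨e, he, rfl⟩ := (Submodule.mem_iSup_iff_exists_finsupp _ _).1 hv
  -- Eigenfunctions with different eigenvalues are orthogonal, since the Dirichlet form is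
  -- symmetric.
  have horth : ∀ k l, k ≠ l → sphereForm (e k) (e l) = 0 := by
    intro k l hkl
    have h1 := (he l).1 (e k)
    rw [dirichletForm_comm, (he k).1 (e l), sphereForm_comm] at h1
    have h2 : ((k : ℝ) * (k + 1) - l * (l + 1)) ≠ 0 := by
      have : (k : ℝ) ≠ l := by exact_mod_cast hkl
      have h3 : ((k : ℝ) - l) * (k + l + 1) ≠ 0 :=
        mul_ne_zero (sub_ne_zero.2 this) (by positivity)
      intro h; apply h3; linarith
    have h3 : ((k : ℝ) * (k + 1) - l * (l + 1)) * sphereForm (e k) (e l) = 0 := by linarith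
    exact (mul_eq_zero.1 h3).resolve_left h2
  -- The Fourier coefficient of u along e k, with the value 0 when e k has norm zero.
  have ht : ∀ k, ∃ t : ℝ, sphereForm u (e k) = t * sphereForm (e k) (e k) := by
    intro k
    by_cases h : sphereForm (e k) (e k) = 0
    · exact ⟨0, by rw [sphereForm_eq_zero_of_self h, h, mul_zero]⟩
    · exact ⟨sphereForm u (e k) / sphereForm (e k) (e k), by field_simp⟩
  choose t ht using ht
  have hsum : ∀ s : ℕ → ℝ, ∀ k ∈ e.support,
      sphereForm (e k) (∑ l ∈ e.support, s l • e l) = s k * sphereForm (e k) (e k) := by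
    intro s k hk
    rw [map_sum, Finset.sum_eq_single k]
    · rw [map_smul, smul_eq_mul]
    · intro l _ hl; rw [map_smul, horth k l hl.symm, smul_zero]
    · intro h; exact absurd hk h
  -- Bessel: the Dirichlet form is nonnegative on u minus its projection to the span of the e k.
  have hD : 0 ≤ dirichletForm u u -
      ∑ k ∈ e.support, k * (k + 1) * (t k ^ 2 * sphereForm (e k) (e k)) := by
    have h := dirichletForm_self_nonneg (u - ∑ k ∈ e.support, t k • e k)
    have h1 : dirichletForm u (∑ k ∈ e.support, t k • e k) =
        ∑ k ∈ e.support, k * (k + 1) * (t k ^ 2 * sphereForm (e k) (e k)) := by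
      rw [map_sum]
      refine Finset.sum_congr rfl fun k _ => ?_
      rw [map_smul, (he k).1, ht k, smul_eq_mul]; ring
    have h2 : dirichletForm (∑ k ∈ e.support, t k • e k) (∑ k ∈ e.support, t k • e k) =
        ∑ k ∈ e.support, k * (k + 1) * (t k ^ 2 * sphereForm (e k) (e k)) := by
      rw [map_sum]
      refine Finset.sum_congr rfl fun k hk => ?_
      rw [map_smul, (he k).1, sphereForm_comm, hsum t k hk, smul_eq_mul]; ring
    rw [map_sub, LinearMap.map_sub₂, LinearMap.map_sub₂, dirichletForm_comm (∑ k ∈ e.support, t k • e k) u, h1, h2] at h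
    linarith
  have hL : sphereForm u u - sphereForm (u - ∑ k ∈ e.support, e k) (u - ∑ k ∈ e.support, e k) =
      ∑ k ∈ e.support, (2 * t k - 1) * sphereForm (e k) (e k) := by
    have h1 : sphereForm u (∑ k ∈ e.support, e k) =
        ∑ k ∈ e.support, t k * sphereForm (e k) (e k) := by
      rw [map_sum]; exact Finset.sum_congr rfl fun k _ => ht k
    have h2 : sphereForm (∑ k ∈ e.support, e k) (∑ k ∈ e.support, e k) =
        ∑ k ∈ e.support, sphereForm (e k) (e k) := by
      rw [map_sum]
      refine Finset.sum_congr rfl fun k hk => ?_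
      have := hsum (fun _ => 1) k hk
      simp only [one_smul, one_mul] at this
      rw [sphereForm_comm, this]
    rw [map_sub, LinearMap.map_sub₂, LinearMap.map_sub₂, sphereForm_comm (∑ k ∈ e.support, e k) u, h1, h2]
    simp only [sub_mul, one_mul, Finset.sum_sub_distrib, mul_assoc, ← Finset.mul_sum]
    ring
  have hle : 6 * ∑ k ∈ e.support, (2 * t k - 1) * sphereForm (e k) (e k) ≤
      ∑ k ∈ e.support, k * (k + 1) * (t k ^ 2 * sphereForm (e k) (e k)) := by
    rw [Finset.mul_sum]
    refine Finset.sum_le_sum fun k _ => ?_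
    have hn := sphereForm_self_nonneg (e k)
    -- For k < 2 balance gives t k ‖e k‖² = 0, so the left term is −‖e k‖² up to a positive factor.
    -- For k ≥ 2 the estimate is 2t − 1 ≤ t² together with 6 ≤ k(k+1).
    by_cases hk : k < 2
    · have h0 := (he k).2 hk u hu
      rw [ht k] at h0
      have : 0 ≤ (k : ℝ) * (k + 1) * (t k ^ 2 * sphereForm (e k) (e k)) := by positivity
      linarith
    · have hk2 : (2 : ℝ) ≤ k := by exact_mod_cast not_lt.1 hk
      have h6 : (6 : ℝ) ≤ k * (k + 1) := by nlinarith
      calc _ ≤ 6 * (t k ^ 2 * sphereForm (e k) (e k)) := by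
            nlinarith [mul_nonneg (sq_nonneg (t k - 1)) hn]
        _ ≤ _ := mul_le_mul_of_nonneg_right h6 (by positivity)
  change 6 * (_ - sphereForm (u - ∑ k ∈ e.support, e k) (u - ∑ k ∈ e.support, e k)) ≤ _
  rw [hL]
  linarith

/-- Restriction to the sphere. -/
def restrictSphere : puncturedC1 →ₗ[ℝ] C(S2, ℝ) where
  toFun φ := ⟨fun θ => (φ : E3 → ℝ) θ, continuous_restrict_sphere φ.2.continuousOn⟩
  map_add' _ _ := rfl
  map_smul' _ _ := rfl

/-- The exponentials of linear forms, as continuous functions on the sphere. -/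
def expLin : Multiplicative E3 →* C(S2, ℝ) where
  toFun a := ⟨fun θ => Real.exp (inner ℝ a.toAdd (θ : E3)), by fun_prop⟩
  map_one' := by ext θ; simp
  map_mul' a b := by ext θ; simp [inner_add_left, Real.exp_add]

/-- The exponential series of a linear form converges uniformly on the sphere, and its partial sums
are combinations of powers of that form. -/
theorem expLin_mem_closure (a : Multiplicative E3) :
    expLin a ∈ ((⨆ k, harmonicSpace k).map restrictSphere).topologicalClosure := by
  set l : C(S2, ℝ) := ⟨fun θ => inner ℝ a.toAdd (θ : E3), by fun_prop⟩ with hl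
  have hsum := NormedSpace.exp_series_hasSum_exp' (𝕂 := ℝ) l
  have hexp : NormedSpace.exp l = expLin a := by
    ext θ
    have := NormedSpace.map_exp (ContinuousMap.evalAlgHom ℝ ℝ θ : C(S2, ℝ) →ₐ[ℝ] ℝ)
      (continuous_eval_const θ) l
    simp only [ContinuousMap.evalAlgHom_apply] at this
    rw [this, ← Real.exp_eq_exp_ℝ]
    rfl
  rw [← hexp]
  refine mem_closure_of_tendsto hsum (Filter.Eventually.of_forall fun s => ?_)
  refine Submodule.sum_mem _ fun n _ => Submodule.smul_mem _ _ ?_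
  exact ⟨linPow a.toAdd n, linPow_mem_iSup_harmonicSpace _ _, rfl⟩

/-- Stone–Weierstrass for the exponentials of linear forms. They are closed under multiplication, so
the algebra they generate is just their linear span; a and b are separated by the exponential of the
form a − b. -/
theorem closure_map_restrictSphere :
    ((⨆ k, harmonicSpace k).map restrictSphere).topologicalClosure = ⊤ := by
  have hsep : (Algebra.adjoin ℝ (MonoidHom.mrange expLin : Set C(S2, ℝ))).SeparatesPoints := by
    intro θ η hne
    refine ⟨_, ⟨_, Algebra.subset_adjoin ⟨Multiplicative.ofAdd ((θ : E3) - η), rfl⟩, rfl⟩, ?_⟩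
    simp only [expLin, MonoidHom.coe_mk, OneHom.coe_mk, ContinuousMap.coe_mk, toAdd_ofAdd]
    intro h
    have h2 := Real.exp_injective h
    rw [← sub_eq_zero, ← inner_sub_right, inner_self_eq_zero, sub_eq_zero] at h2
    exact hne (Subtype.ext h2)
  have hdense := ContinuousMap.subalgebra_topologicalClosure_eq_top_of_separatesPoints _ hsep
  have hsub : (Algebra.adjoin ℝ (MonoidHom.mrange expLin : Set C(S2, ℝ)) : Set C(S2, ℝ)) ⊆
      ((⨆ k, harmonicSpace k).map restrictSphere).topologicalClosure := by
    intro g hg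
    have hg' : g ∈ Subalgebra.toSubmodule
        (Algebra.adjoin ℝ (MonoidHom.mrange expLin : Set C(S2, ℝ))) := hg
    rw [Algebra.adjoin_eq_span, Submonoid.closure_eq] at hg'
    refine (Submodule.span_le.2 ?_) hg'
    rintro _ ⟨a, rfl⟩
    exact expLin_mem_closure a
  rw [eq_top_iff]
  intro g _
  have hg : g ∈ (Algebra.adjoin ℝ
      (MonoidHom.mrange expLin : Set C(S2, ℝ))).topologicalClosure := by rw [hdense]; trivial
  exact (closure_minimal hsub (Submodule.isClosed_topologicalClosure _)) hg

/-- A Poincaré inequality for functions on the sphere that are orthogonal to the constants and to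
the linear functions. -/
theorem six_mul_sphereForm_le {u : puncturedC1} (hu : IsBalanced u) :
    6 * sphereForm u u ≤ dirichletForm u u := by
  refine le_of_forall_pos_le_add fun ε hε => ?_
  have hmem : restrictSphere u ∈ closure
      ((⨆ k, harmonicSpace k).map restrictSphere : Set C(S2, ℝ)) := by
    have : restrictSphere u ∈ ((⨆ k, harmonicSpace k).map restrictSphere).topologicalClosure := by
      rw [closure_map_restrictSphere]; trivial
    exact this
  have hπ := Real.pi_pos
  -- Uniform distance √(ε/(24π)) on a sphere of mass 4π means squared L² distance at most ε/6, and
  -- the constant 6 turns this into ε.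
  have hδ : 0 < √(ε / (24 * Real.pi)) := by positivity
  obtain ⟨_, ⟨v, hv, rfl⟩, hdist⟩ := Metric.mem_closure_iff.1 hmem _ hδ
  have hb := six_mul_sub_le_dirichletForm hu hv
  have hsmall : sphereForm (u - v) (u - v) ≤ ε / (24 * Real.pi) * (4 * Real.pi) := by
    rw [← sphereMeasure_univ, sphereForm_apply]
    refine (le_abs_self _).trans ?_
    rw [← Real.norm_eq_abs]
    refine norm_integral_le_of_norm_le_const (Filter.Eventually.of_forall fun θ => ?_)
    have h1 : |((u - v : puncturedC1) : E3 → ℝ) θ| ≤ √(ε / (24 * Real.pi)) :=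
      (ContinuousMap.dist_apply_le_dist θ).trans hdist.le
    rw [Real.norm_eq_abs, abs_mul]
    calc _ ≤ √(ε / (24 * Real.pi)) * √(ε / (24 * Real.pi)) := by gcongr
      _ = _ := Real.mul_self_sqrt (by positivity)
  have : ε / (24 * Real.pi) * (4 * Real.pi) = ε / 6 := by field_simp; norm_num
  linarith

/-! ### The cross product and orthonormal frames -/

/-- The cross product on `ℝ³` as a continuous bilinear map. -/
def crossL : E3 →L[ℝ] E3 →L[ℝ] E3 :=
  LinearMap.toContinuousLinearMap
    ((LinearMap.toContinuousLinearMap : (E3 →ₗ[ℝ] E3) ≃ₗ[ℝ] (E3 →L[ℝ] E3)).toLinearMap ∘ₗ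
      LinearMap.mk₂ ℝ (fun u v : E3 => WithLp.toLp 2 (WithLp.ofLp u ⨯₃ WithLp.ofLp v))
        (fun _ _ _ => by simp) (fun _ _ _ => by simp) (fun _ _ _ => by simp)
        (fun _ _ _ => by simp))

theorem crossL_apply (u v : E3) :
    crossL u v = WithLp.toLp 2 (WithLp.ofLp u ⨯₃ WithLp.ofLp v) := rfl

theorem crossL_zero_coord (u v : E3) : crossL u v 0 = u 1 * v 2 - u 2 * v 1 := by
  simp [crossL_apply, cross_apply]

theorem crossL_one_coord (u v : E3) : crossL u v 1 = u 2 * v 0 - u 0 * v 2 := by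
  simp [crossL_apply, cross_apply]

theorem crossL_two_coord (u v : E3) : crossL u v 2 = u 0 * v 1 - u 1 * v 0 := by
  simp [crossL_apply, cross_apply]

theorem inner_eq_coord (u v : E3) : inner ℝ u v = u 0 * v 0 + u 1 * v 1 + u 2 * v 2 := by
  simp [PiLp.inner_apply, Fin.sum_univ_three, mul_comm]

theorem ext_coord {u v : E3} (h0 : u 0 = v 0) (h1 : u 1 = v 1) (h2 : u 2 = v 2) : u = v := by
  ext i; fin_cases i <;> assumption

theorem crossL_self (u : E3) : crossL u u = 0 := by
  simp [crossL_apply]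

theorem crossL_anticomm (u v : E3) : crossL u v = -crossL v u := by
  rw [crossL_apply, crossL_apply, ← cross_anticomm, WithLp.toLp_neg]

theorem inner_crossL_rotate (u v w : E3) :
    inner ℝ (crossL u v) w = inner ℝ (crossL v w) u := by
  simp only [inner_eq_coord, crossL_zero_coord, crossL_one_coord, crossL_two_coord]; ring

theorem inner_crossL_left (u v : E3) : inner ℝ (crossL u v) u = 0 := by
  simp only [inner_eq_coord, crossL_zero_coord, crossL_one_coord, crossL_two_coord]; ring

theorem inner_crossL_right (u v : E3) : inner ℝ (crossL u v) v = 0 := by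
  simp only [inner_eq_coord, crossL_zero_coord, crossL_one_coord, crossL_two_coord]; ring

theorem inner_crossL_crossL (u v w z : E3) : inner ℝ (crossL u v) (crossL w z) =
    inner ℝ u w * inner ℝ v z - inner ℝ u z * inner ℝ v w := by
  simp only [inner_eq_coord, crossL_zero_coord, crossL_one_coord, crossL_two_coord]; ring

theorem crossL_crossL (u v w : E3) :
    crossL u (crossL v w) = (inner ℝ u w : ℝ) • v - (inner ℝ u v : ℝ) • w := by
  apply ext_coord <;>
  simp only [inner_eq_coord, crossL_zero_coord, crossL_one_coord, crossL_two_coord, PiLp.sub_apply,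
    PiLp.smul_apply, smul_eq_mul] <;> ring

/-- The cross product of two vectors orthogonal to a unit vector is a multiple of it. -/
theorem crossL_eq_smul_of_orthogonal {n u v : E3} (hn : inner ℝ n n = (1 : ℝ))
    (hu : inner ℝ n u = (0 : ℝ)) (hv : inner ℝ n v = (0 : ℝ)) :
    crossL u v = (inner ℝ n (crossL u v) : ℝ) • n := by
  have h1 : crossL n (crossL u v) = 0 := by rw [crossL_crossL, hu, hv]; simp
  have h2 := crossL_crossL n n (crossL u v)
  rw [h1, hn, one_smul, map_zero] at h2
  exact (sub_eq_zero.1 h2.symm).symm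

/-- Two vectors whose cross product is a nonzero multiple of the unit vector `n` span the plane
orthogonal to `n`. -/
theorem exists_eq_add_smul_of_orthogonal {n u v w : E3} {c : ℝ} (hc : c ≠ 0)
    (hn : inner ℝ n n = (1 : ℝ)) (huv : crossL u v = c • n) (hw : inner ℝ n w = (0 : ℝ)) :
    ∃ a b : ℝ, w = a • u + b • v := by
  -- Cramer's rule for w in terms of u, v and u × v.
  have key : (inner ℝ (crossL u v) (crossL u v) : ℝ) • w =
      (inner ℝ (crossL v (crossL u v)) w : ℝ) • u + (inner ℝ (crossL (crossL u v) u) w : ℝ) • v +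
        (inner ℝ (crossL u v) w : ℝ) • crossL u v := by
    apply ext_coord <;>
    simp only [inner_eq_coord, crossL_zero_coord, crossL_one_coord, crossL_two_coord,
      PiLp.add_apply, PiLp.smul_apply, smul_eq_mul] <;> ring
  have h1 : inner ℝ (crossL u v) (crossL u v) = c * c := by
    rw [huv, real_inner_smul_left, real_inner_smul_right, hn]; ring
  have h2 : inner ℝ (crossL u v) w = (0 : ℝ) := by rw [huv, real_inner_smul_left, hw, mul_zero]
  rw [h1, h2, zero_smul, add_zero] at key
  have hcc : c * c ≠ 0 := mul_ne_zero hc hc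
  refine ⟨(c * c)⁻¹ * inner ℝ (crossL v (crossL u v)) w,
    (c * c)⁻¹ * inner ℝ (crossL (crossL u v) u) w, ?_⟩
  rw [mul_smul, mul_smul, ← smul_add, ← key, smul_smul, inv_mul_cancel₀ hcc, one_smul]

/-- An orthonormal frame `e₁, e₂` of the plane orthogonal to `θ`, with its orientation `s`. -/
structure IsFrame (θ e₁ e₂ : E3) (s : ℝ) : Prop where
  sq : s * s = 1
  inner_self : inner ℝ θ θ = (1 : ℝ)
  inner_one : inner ℝ e₁ e₁ = (1 : ℝ)
  inner_two : inner ℝ e₂ e₂ = (1 : ℝ)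
  inner_one_two : inner ℝ e₁ e₂ = (0 : ℝ)
  inner_one_self : inner ℝ e₁ θ = (0 : ℝ)
  inner_two_self : inner ℝ e₂ θ = (0 : ℝ)
  cross_one_two : crossL e₁ e₂ = s • θ

theorem isFrame_of_orthonormal {θ e₁ e₂ : E3} (h0 : inner ℝ θ θ = (1 : ℝ))
    (h1 : inner ℝ e₁ e₁ = (1 : ℝ)) (h2 : inner ℝ e₂ e₂ = (1 : ℝ)) (h12 : inner ℝ e₁ e₂ = (0 : ℝ))
    (h10 : inner ℝ e₁ θ = (0 : ℝ)) (h20 : inner ℝ e₂ θ = (0 : ℝ)) :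
    ∃ s, IsFrame θ e₁ e₂ s := by
  have hc := crossL_eq_smul_of_orthogonal h0 (by rwa [real_inner_comm] : inner ℝ θ e₁ = (0 : ℝ))
    (by rwa [real_inner_comm] : inner ℝ θ e₂ = (0 : ℝ))
  refine ⟨inner ℝ θ (crossL e₁ e₂), ⟨?_, h0, h1, h2, h12, h10, h20, hc⟩⟩
  have h := inner_crossL_crossL e₁ e₂ e₁ e₂
  rw [h1, h2, real_inner_comm e₁ e₂, h12] at h
  rw [hc, real_inner_smul_left, real_inner_smul_right, h0] at h
  simpa using h

theorem exists_isFrame (θ : S2) : ∃ s, IsFrame (θ : E3) (frame θ 0) (frame θ 1) s := by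
  have : Fact (Module.finrank ℝ E3 = 2 + 1) := ⟨finrank_euclideanSpace_fin⟩
  let b := OrthonormalBasis.fromOrthogonalSpanSingleton (𝕜 := ℝ) 2
    (v := (θ : E3)) (ne_zero_of_mem_unit_sphere θ)
  have hb : ∀ i, frame θ i = (b i : E3) := fun i => rfl
  have hin : ∀ i j, inner ℝ (frame θ i) (frame θ j) = if i = j then (1 : ℝ) else 0 := by
    intro i j
    rw [hb, hb, ← Submodule.coe_inner]
    exact orthonormal_iff_ite.1 b.orthonormal i j
  have hθ : ∀ i, inner ℝ (frame θ i) (θ : E3) = (0 : ℝ) := by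
    intro i
    rw [hb, real_inner_comm]
    exact Submodule.mem_orthogonal_singleton_iff_inner_right.1 (b i).2
  refine isFrame_of_orthonormal (by simp) ?_ ?_ ?_ (hθ 0) (hθ 1)
  · simpa using hin 0 0
  · simpa using hin 1 1
  · simpa using hin 0 1

namespace IsFrame

variable {θ e₁ e₂ : E3} {s : ℝ}

theorem self_eq (h : IsFrame θ e₁ e₂ s) : θ = s • crossL e₁ e₂ := by
  rw [h.cross_one_two, smul_smul, h.sq, one_smul]

theorem cross_two_self (h : IsFrame θ e₁ e₂ s) : crossL e₂ θ = s • e₁ := by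
  nth_rw 1 [h.self_eq]
  rw [map_smul, crossL_crossL, h.inner_two, real_inner_comm, h.inner_one_two]
  simp

theorem cross_self_one (h : IsFrame θ e₁ e₂ s) : crossL θ e₁ = s • e₂ := by
  rw [crossL_anticomm]
  nth_rw 1 [h.self_eq]
  rw [map_smul, crossL_crossL, h.inner_one, h.inner_one_two]
  simp

theorem eq_sum (h : IsFrame θ e₁ e₂ s) (v : E3) :
    v = (inner ℝ v e₁ : ℝ) • e₁ + (inner ℝ v e₂ : ℝ) • e₂ + (inner ℝ v θ : ℝ) • θ := by
  obtain ⟨a, b, hab⟩ := exists_eq_add_smul_of_orthogonal (n := θ) (u := e₁) (v := e₂)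
    (w := v - (inner ℝ v θ : ℝ) • θ) (c := s) (fun h0 => by simpa [h0] using h.sq) h.inner_self
    h.cross_one_two (by
      rw [inner_sub_right, real_inner_smul_right, h.inner_self, real_inner_comm, mul_one, sub_self])
  have hv : v = a • e₁ + b • e₂ + (inner ℝ v θ : ℝ) • θ := by rw [← hab]; abel
  have h1 : inner ℝ v e₁ = a := by
    rw [hv, inner_add_left, inner_add_left, real_inner_smul_left, real_inner_smul_left,
      real_inner_smul_left, h.inner_one, real_inner_comm e₁ e₂, h.inner_one_two,
      real_inner_comm e₁ θ, h.inner_one_self]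
    ring
  have h2 : inner ℝ v e₂ = b := by
    rw [hv, inner_add_left, inner_add_left, real_inner_smul_left, real_inner_smul_left,
      real_inner_smul_left, h.inner_two, h.inner_one_two,
      real_inner_comm e₂ θ, h.inner_two_self]
    ring
  rw [h1, h2]
  exact hv

/-- As θ = s e₁ × e₂, this is Cauchy–Binet. It links the bracket, which is defined without a frame,
to derivatives along a frame, which need not depend continuously on θ. -/
theorem covectorBracket_eq (h : IsFrame θ e₁ e₂ s) (B C : E3 →L[ℝ] ℝ) :
    covectorBracket θ B C = s * (B e₁ * C e₂ - B e₂ * C e₁) := by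
  have hexp : ∀ (L : E3 →L[ℝ] ℝ) (v : E3), L v =
      v 0 * L (stdVec 0) + v 1 * L (stdVec 1) + v 2 * L (stdVec 2) := by
    intro L v
    have : v = v 0 • stdVec 0 + v 1 • stdVec 1 + v 2 • stdVec 2 := by
      apply ext_coord <;> simp [stdVec]
    conv_lhs => rw [this]
    simp
  have h0 := congrArg (fun x : E3 => x 0) h.self_eq
  have h1 := congrArg (fun x : E3 => x 1) h.self_eq
  have h2 := congrArg (fun x : E3 => x 2) h.self_eq
  simp only [PiLp.smul_apply, smul_eq_mul, crossL_zero_coord, crossL_one_coord,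
    crossL_two_coord] at h0 h1 h2
  rw [covectorBracket, h0, h1, h2, hexp B e₁, hexp B e₂, hexp C e₁, hexp C e₂]
  ring

/-- The three values are the coordinates of θ × g, where g represents B, and |θ × g|² = |g|² − ⟨g,
θ⟩² is the squared tangential part of g. -/
theorem sum_sq_rotField (h : IsFrame θ e₁ e₂ s) (B : E3 →L[ℝ] ℝ) :
    B (rotField 1 2 θ) * B (rotField 1 2 θ) + B (rotField 2 0 θ) * B (rotField 2 0 θ) +
      B (rotField 0 1 θ) * B (rotField 0 1 θ) = B e₁ ^ 2 + B e₂ ^ 2 := by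
  obtain ⟨g, rfl⟩ := (InnerProductSpace.toDual ℝ E3).surjective B
  simp only [InnerProductSpace.toDual_apply_apply, inner_rotField]
  have hg : inner ℝ g g = (inner ℝ g e₁ : ℝ) ^ 2 + (inner ℝ g e₂ : ℝ) ^ 2
      + (inner ℝ g θ : ℝ) ^ 2 := by
    conv_lhs => rw [h.eq_sum g]
    simp only [inner_add_left, inner_add_right, real_inner_smul_left, real_inner_smul_right,
      h.inner_one, h.inner_two, h.inner_self, h.inner_one_two, h.inner_one_self, h.inner_two_self,
      real_inner_comm e₁ e₂, real_inner_comm e₁ θ, real_inner_comm e₂ θ]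
    ring
  have hlag := inner_crossL_crossL θ g θ g
  rw [h.inner_self, real_inner_comm g θ, hg] at hlag
  simp only [inner_eq_coord (crossL θ g), crossL_zero_coord, crossL_one_coord,
    crossL_two_coord] at hlag
  linarith

end IsFrame

/-- The sum of the brackets of the components of two vector fields. -/
def vectorBracket (A B : E3 → E3) (x : E3) : ℝ :=
  bracket (fun y => A y 0) (fun y => B y 0) x + bracket (fun y => A y 1) (fun y => B y 1) x +
    bracket (fun y => A y 2) (fun y => B y 2) x

theorem contDiffOn_coord {A : E3 → E3} (hA : ContDiffOn ℝ 1 A {0}ᶜ) (i : Fin 3) :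
    ContDiffOn ℝ 1 (fun y => A y i) {0}ᶜ :=
  (EuclideanSpace.proj i : E3 →L[ℝ] ℝ).contDiff.comp_contDiffOn hA

theorem continuous_vectorBracket {A B : E3 → E3} (hA : ContDiffOn ℝ 1 A {0}ᶜ)
    (hB : ContDiffOn ℝ 1 B {0}ᶜ) : Continuous fun θ : S2 => vectorBracket A B θ := by
  have h : ∀ i, Continuous fun θ : S2 => bracket (fun y => A y i) (fun y => B y i) (θ : E3) :=
    fun i => continuous_restrict_sphere
      (continuousOn_bracket (contDiffOn_coord hA i) (contDiffOn_coord hB i))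
  exact ((h 0).add (h 1)).add (h 2)

theorem integral_vectorBracket {A B : E3 → E3} (hA : ContDiffOn ℝ 1 A {0}ᶜ)
    (hB : ContDiffOn ℝ 1 B {0}ᶜ) : ∫ θ : S2, vectorBracket A B θ ∂sphereMeasure = 0 := by
  have h : ∀ i, Integrable (fun θ : S2 => bracket (fun y => A y i) (fun y => B y i) (θ : E3))
      sphereMeasure := fun i => integrable_sphere (continuous_restrict_sphere
      (continuousOn_bracket (contDiffOn_coord hA i) (contDiffOn_coord hB i)))
  have h0 : ∀ i, ∫ θ : S2, bracket (fun y => A y i) (fun y => B y i) (θ : E3) ∂sphereMeasure = 0 :=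
    fun i => integral_bracket (contDiffOn_coord hA i) (contDiffOn_coord hB i)
  have h01 : Integrable (fun θ : S2 => bracket (fun y => A y 0) (fun y => B y 0) (θ : E3) +
      bracket (fun y => A y 1) (fun y => B y 1) (θ : E3)) sphereMeasure := (h 0).add (h 1)
  unfold vectorBracket
  rw [integral_add h01 (h 2), integral_add (h 0) (h 1), h0, h0, h0]
  simp

theorem IsFrame.vectorBracket_eq {θ e₁ e₂ : E3} {s : ℝ} (h : IsFrame θ e₁ e₂ s) {A B : E3 → E3}
    {A' B' : E3 →L[ℝ] E3} (hA : HasFDerivAt A A' θ) (hB : HasFDerivAt B B' θ) :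
    vectorBracket A B θ = s * (inner ℝ (A' e₁) (B' e₂) - inner ℝ (A' e₂) (B' e₁)) := by
  have hc : ∀ {C : E3 → E3} {C' : E3 →L[ℝ] E3}, HasFDerivAt C C' θ → ∀ i,
      fderiv ℝ (fun y => C y i) θ = (EuclideanSpace.proj i : E3 →L[ℝ] ℝ).comp C' :=
    fun hC i => ((EuclideanSpace.proj i : E3 →L[ℝ] ℝ).hasFDerivAt.comp θ hC).fderiv
  simp only [vectorBracket, bracket, h.covectorBracket_eq, hc hA, hc hB,
    ContinuousLinearMap.comp_apply, PiLp.proj_apply, inner_eq_coord]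
  ring

/-! ### Two pointwise identities -/

namespace IsFrame

variable {θ e₁ e₂ : E3} {s : ℝ}

theorem inner_eq_sum (h : IsFrame θ e₁ e₂ s) (v w : E3) :
    inner ℝ v w = (inner ℝ v e₁ * inner ℝ w e₁ + inner ℝ v e₂ * inner ℝ w e₂ +
      inner ℝ v θ * inner ℝ w θ : ℝ) := by
  conv_lhs => rw [h.eq_sum v]
  simp only [inner_add_left, real_inner_smul_left, real_inner_comm w e₁, real_inner_comm w e₂,
    real_inner_comm w θ]

theorem inner_crossL_one (h : IsFrame θ e₁ e₂ s) (v w : E3) : inner ℝ (crossL e₁ v) w =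
    s * (inner ℝ v e₂ * inner ℝ w θ - inner ℝ v θ * inner ℝ w e₂) := by
  have h1 : e₁ = s • crossL e₂ θ := by rw [h.cross_two_self, smul_smul, h.sq, one_smul]
  rw [inner_crossL_rotate]
  nth_rw 1 [h1]
  rw [real_inner_smul_right, inner_crossL_crossL]

theorem inner_crossL_two (h : IsFrame θ e₁ e₂ s) (v w : E3) : inner ℝ (crossL e₂ v) w =
    s * (inner ℝ v θ * inner ℝ w e₁ - inner ℝ v e₁ * inner ℝ w θ) := by
  have h1 : e₂ = s • crossL θ e₁ := by rw [h.cross_self_one, smul_smul, h.sq, one_smul]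
  rw [inner_crossL_rotate]
  nth_rw 1 [h1]
  rw [real_inner_smul_right, inner_crossL_crossL]

theorem inner_crossL_self (h : IsFrame θ e₁ e₂ s) (v w : E3) : inner ℝ (crossL θ v) w =
    s * (inner ℝ v e₁ * inner ℝ w e₂ - inner ℝ v e₂ * inner ℝ w e₁) := by
  rw [inner_crossL_rotate]
  nth_rw 1 [h.self_eq]
  rw [real_inner_smul_right, inner_crossL_crossL]

/-- The pointwise form of the homotopy between the area forms pulled back by a unit vector field
`n` and by the position vector `θ` of the sphere. -/
theorem degree_identity (h : IsFrame θ e₁ e₂ s) {n v₁ v₂ : E3} (hn : inner ℝ n n = (1 : ℝ))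
    (h1 : inner ℝ n v₁ = (0 : ℝ)) (h2 : inner ℝ n v₂ = (0 : ℝ)) (hc : 1 + inner ℝ θ n ≠ (0 : ℝ)) :
    s * (inner ℝ ((1 + inner ℝ θ n : ℝ)⁻¹ • (crossL e₁ n + crossL θ v₁) -
          ((inner ℝ e₁ n + inner ℝ θ v₁ : ℝ) / (1 + inner ℝ θ n) ^ 2) • crossL θ n) (e₂ + v₂) -
        inner ℝ ((1 + inner ℝ θ n : ℝ)⁻¹ • (crossL e₂ n + crossL θ v₂) -
          ((inner ℝ e₂ n + inner ℝ θ v₂ : ℝ) / (1 + inner ℝ θ n) ^ 2) • crossL θ n) (e₁ + v₁)) =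
      s * inner ℝ n (crossL v₁ v₂) - 1 := by
  set K : ℝ := inner ℝ n (crossL v₁ v₂) with hK
  -- Both v₁ and v₂ are orthogonal to n, hence v₁ × v₂ = K n. Reading this in the frame gives three
  -- quadratic relations, and the claim becomes polynomial in the frame coordinates x, y, z of n and
  -- of v₁, v₂.
  have hcr := crossL_eq_smul_of_orthogonal hn h1 h2
  have k1 : inner ℝ (crossL v₁ v₂) e₁ = K * inner ℝ n e₁ := by
    rw [hcr, real_inner_smul_left]
  have k2 : inner ℝ (crossL v₁ v₂) e₂ = K * inner ℝ n e₂ := by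
    rw [hcr, real_inner_smul_left]
  have k3 : inner ℝ (crossL v₁ v₂) θ = K * inner ℝ n θ := by
    rw [hcr, real_inner_smul_left]
  rw [← inner_crossL_rotate, h.inner_crossL_one] at k1
  rw [← inner_crossL_rotate, h.inner_crossL_two] at k2
  rw [← inner_crossL_rotate, h.inner_crossL_self] at k3
  rw [h.inner_eq_sum] at hn h1 h2
  simp only [inner_sub_left, real_inner_smul_left, inner_add_left, inner_add_right,
    h.inner_crossL_one, h.inner_crossL_two, h.inner_crossL_self, h.inner_one, h.inner_two,
    h.inner_one_two, h.inner_one_self, h.inner_two_self, real_inner_comm e₁ e₂,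
    real_inner_comm n θ, real_inner_comm v₁ θ, real_inner_comm v₂ θ,
    real_inner_comm n e₁, real_inner_comm n e₂] at *
  clear_value K
  clear hK hcr
  generalize (inner ℝ n e₁ : ℝ) = x at *
  generalize (inner ℝ n e₂ : ℝ) = y at *
  generalize (inner ℝ n θ : ℝ) = z at *
  generalize (inner ℝ v₁ e₁ : ℝ) = p₁ at *
  generalize (inner ℝ v₁ e₂ : ℝ) = q₁ at *
  generalize (inner ℝ v₁ θ : ℝ) = r₁ at *
  generalize (inner ℝ v₂ e₁ : ℝ) = p₂ at *
  generalize (inner ℝ v₂ e₂ : ℝ) = q₂ at *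
  generalize (inner ℝ v₂ θ : ℝ) = r₂ at *
  have hs := h.sq
  have m1 : q₁ * r₂ - r₁ * q₂ = s * K * x := by
    linear_combination s * k1 - (q₁ * r₂ - r₁ * q₂) * hs
  have m2 : r₁ * p₂ - p₁ * r₂ = s * K * y := by
    linear_combination s * k2 - (r₁ * p₂ - p₁ * r₂) * hs
  have m3 : p₁ * q₂ - q₁ * p₂ = s * K * z := by
    linear_combination s * k3 - (p₁ * q₂ - q₁ * p₂) * hs
  -- The terms coming from the derivative of the factor 1/(1 + z) are divisible by 1 + z because n
  -- is a unit vector.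
  have hb : (x + r₁) * (x + x * q₂ - y * p₂) - (y + r₂) * (x * q₁ - y - y * p₁) =
      (1 + z) * ((1 - z) * (1 + p₁ + q₂ - s * K) + x * r₁ + y * r₂) := by
    linear_combination (1 + q₂ + p₁ - s * K) * hn - y * h2 - x * h1 - x * m1 - y * m2
  field_simp
  linear_combination (s ^ 2 * (1 + z) * 2) * m3 - s ^ 2 * hb + (s * K - 1) * (1 + z) ^ 2 * hs

end IsFrame

/-- The pointwise form of the divergence theorem on a surface for the field `n = Y / |Y|`, where
`Y` is the position vector. -/
theorem meanCurvature_identity {n ν X₁ X₂ ν₁ ν₂ : E3} {s J ρ α₁ β₁ α₂ β₂ : ℝ} (hs : s * s = 1)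
    (hν : inner ℝ ν ν = (1 : ℝ)) (hn : inner ℝ n n = (1 : ℝ)) (hJ : J ≠ 0)
    (hX : crossL X₁ X₂ = (s * J) • ν) (h1 : ν₁ = α₁ • X₁ + β₁ • X₂) (h2 : ν₂ = α₂ • X₁ + β₂ • X₂) :
    s * (inner ℝ (crossL (ρ⁻¹ • (X₁ - (inner ℝ n X₁ : ℝ) • n)) ν + crossL n ν₁) X₂ -
        inner ℝ (crossL (ρ⁻¹ • (X₂ - (inner ℝ n X₂ : ℝ) • n)) ν + crossL n ν₂) X₁) =
      (α₁ + β₂) * inner ℝ n ν * J - (1 + (inner ℝ n ν : ℝ) ^ 2) * J / ρ := by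
  have hsJ : s * J ≠ 0 := mul_ne_zero (fun h => by simp [h] at hs) hJ
  -- With n = ⟨n, ν⟩ν + aX₁ + bX₂ all triple products reduce to sJ. The relation `hnn` below, |n|² =
  -- 1, then turns 2 − |tangential part of n|² into 1 + ⟨n, ν⟩².
  obtain ⟨a, b, hab⟩ := exists_eq_add_smul_of_orthogonal hsJ hν hX
    (w := n - (inner ℝ n ν : ℝ) • ν) (by
      rw [inner_sub_right, real_inner_smul_right, hν, real_inner_comm, mul_one, sub_self])
  have hn' : n = (inner ℝ n ν : ℝ) • ν + a • X₁ + b • X₂ := by rw [add_assoc, ← hab]; abel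
  have t1 : inner ℝ (crossL X₁ ν) X₂ = -(s * J) := by
    rw [inner_crossL_rotate, inner_crossL_rotate, crossL_anticomm, hX, inner_neg_left,
      real_inner_smul_left, hν, mul_one]
  have t2 : inner ℝ (crossL X₂ ν) X₁ = s * J := by
    rw [inner_crossL_rotate, inner_crossL_rotate, hX, real_inner_smul_left, hν, mul_one]
  have t3 : inner ℝ (crossL n X₁) X₂ = s * J * inner ℝ n ν := by
    rw [inner_crossL_rotate, hX, real_inner_smul_left, real_inner_comm]
  have t4 : inner ℝ (crossL n X₂) X₁ = -(s * J * inner ℝ n ν) := by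
    rw [inner_crossL_rotate, crossL_anticomm, hX, inner_neg_left, real_inner_smul_left,
      real_inner_comm]
  have u1 : inner ℝ (crossL n ν) X₂ = -(a * (s * J)) := by
    rw [hn']
    simp only [map_add, map_smul, add_apply, smul_apply, crossL_self, inner_add_left,
      real_inner_smul_left, inner_zero_left, t1, inner_crossL_left]
    ring
  have u2 : inner ℝ (crossL n ν) X₁ = b * (s * J) := by
    rw [hn']
    simp only [map_add, map_smul, add_apply, smul_apply, crossL_self, inner_add_left,
      real_inner_smul_left, inner_zero_left, t2, inner_crossL_left]
    ring
  have hnn : 1 = (inner ℝ n ν : ℝ) ^ 2 + a * inner ℝ n X₁ + b * inner ℝ n X₂ := by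
    rw [← hn]
    nth_rw 2 [hn']
    simp only [inner_add_right, real_inner_smul_right]
    ring
  rw [h1, h2]
  simp only [map_add, map_sub, map_smul, sub_apply, smul_apply, inner_add_left,
    inner_sub_left, real_inner_smul_left, inner_crossL_right, t1, t2, t3, t4, u1, u2]
  linear_combination (-ρ⁻¹ * J * s ^ 2) * hnn +
    ((α₁ + β₂) * inner ℝ n ν * J - (1 + (inner ℝ n ν : ℝ) ^ 2) * J / ρ) * hs

/-! ### Extensions along rays and normalized vector fields -/

/-- The extension is f composed with the smooth retraction x ↦ x/|x| of punctured space onto the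
sphere. From here on the manifold structure is replaced by calculus on punctured space. -/
theorem contDiffOn_rayExt {f : S2 → ℝ} (hf : ContMDiff (𝓡 2) 𝓘(ℝ, ℝ) 2 f) :
    ContDiffOn ℝ 2 (rayExt f) {0}ᶜ := by
  have : Fact (Module.finrank ℝ E3 = 2 + 1) := ⟨finrank_euclideanSpace_fin⟩
  let U : TopologicalSpace.Opens E3 := ⟨{0}ᶜ, isOpen_punctured⟩
  have h1 : ContMDiff 𝓘(ℝ, E3) 𝓘(ℝ, E3) 2 (fun x : U => ‖(x : E3)‖⁻¹ • (x : E3)) := by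
    intro x
    have hx : (x : E3) ≠ 0 := x.2
    have h2 : ContDiffAt ℝ 2 (fun y : E3 => ‖y‖⁻¹ • y) (x : E3) :=
      ((contDiffAt_norm ℝ hx).inv (norm_ne_zero_iff.2 hx)).smul contDiffAt_id
    exact h2.contMDiffAt.comp x contMDiff_subtype_val.contMDiffAt
  have h3 := hf.comp (ContMDiff.codRestrict_sphere h1 fun x : U => by
    have hx : (x : E3) ≠ 0 := x.2
    rw [mem_sphere_zero_iff_norm, norm_smul, norm_inv, norm_norm,
      inv_mul_cancel₀ (norm_ne_zero_iff.mpr hx)])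
  intro x hx
  have h4 : ContMDiffAt 𝓘(ℝ, E3) 𝓘(ℝ, ℝ) 2 (fun y : U => rayExt f (y : E3)) ⟨x, hx⟩ := by
    refine (h3 ⟨x, hx⟩).congr_of_eventuallyEq (Filter.Eventually.of_forall fun y => ?_)
    have hy : (y : E3) ≠ 0 := y.2
    simp only [rayExt, hy, dite_false]
    rfl
  exact (contMDiffAt_subtype_iff.1 h4).contDiffAt.contDiffWithinAt

theorem rayExt_coe {V : Type*} [Zero V] (u : S2 → V) (θ : S2) : rayExt u (θ : E3) = u θ := by
  rw [rayExt, dif_neg (ne_zero_of_mem_unit_sphere θ)]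
  congr 1
  apply Subtype.ext
  simp

theorem rayExt_smul {V : Type*} [Zero V] (u : S2 → V) {t : ℝ} (ht : 0 < t) (x : E3) :
    rayExt u (t • x) = rayExt u x := by
  by_cases hx : x = 0
  · simp [hx]
  · have htx : t • x ≠ 0 := smul_ne_zero ht.ne' hx
    rw [rayExt, rayExt, dif_neg hx, dif_neg htx]
    congr 1
    apply Subtype.ext
    simp only [norm_smul, Real.norm_eq_abs, abs_of_pos ht, mul_inv, smul_smul]
    congr 1
    field_simp

theorem rayExt_radialGraph (f : S2 → ℝ) {x : E3} (hx : x ≠ 0) :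
    rayExt (radialGraph f) x = (1 + rayExt f x) • (‖x‖⁻¹ • x) := by
  simp only [rayExt, hx, dite_false, radialGraph]

/-- Euler's relation for a function homogeneous of degree zero. -/
theorem fderiv_rayExt_self (f : S2 → ℝ) {x : E3} (hd : DifferentiableAt ℝ (rayExt f) x) :
    fderiv ℝ (rayExt f) x x = 0 := by
  have h1 : HasDerivAt (fun t : ℝ => rayExt f (t • x)) (fderiv ℝ (rayExt f) x x) 1 := by
    have h2 : HasDerivAt (fun t : ℝ => t • x) x 1 := by
      simpa using (hasDerivAt_id (1 : ℝ)).smul_const x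
    have h3 : HasFDerivAt (rayExt f) (fderiv ℝ (rayExt f) x) ((1 : ℝ) • x) := by
      rw [one_smul]; exact hd.hasFDerivAt
    exact h3.comp_hasDerivAt 1 h2
  have h2 : HasDerivAt (fun t : ℝ => rayExt f (t • x)) 0 1 := by
    refine (hasDerivAt_const 1 (rayExt f x)).congr_of_eventuallyEq ?_
    filter_upwards [lt_mem_nhds (zero_lt_one (α := ℝ))] with t ht
    exact rayExt_smul f ht x
  exact h1.unique h2

/-- The normalization of a vector field. -/
def normalize (Y : E3 → E3) (x : E3) : E3 := ‖Y x‖⁻¹ • Y x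

theorem norm_normalize {Y : E3 → E3} {x : E3} (hY : Y x ≠ 0) : ‖normalize Y x‖ = 1 := by
  rw [normalize, norm_smul, norm_inv, norm_norm, inv_mul_cancel₀ (norm_ne_zero_iff.2 hY)]

theorem inner_normalize_self {Y : E3 → E3} {x : E3} (hY : Y x ≠ 0) :
    inner ℝ (normalize Y x) (normalize Y x) = (1 : ℝ) := by
  rw [real_inner_self_eq_norm_sq, norm_normalize hY, one_pow]

theorem contDiffOn_normalize {Y : E3 → E3} {n : ℕ∞} {s : Set E3} (hY : ContDiffOn ℝ n Y s)
    (h0 : ∀ x ∈ s, Y x ≠ 0) : ContDiffOn ℝ n (normalize Y) s :=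
  ((hY.norm ℝ h0).inv fun x hx => norm_ne_zero_iff.2 (h0 x hx)).smul hY

theorem hasFDerivAt_norm {x : E3} (hx : x ≠ 0) :
    HasFDerivAt (fun y : E3 => ‖y‖) (‖x‖⁻¹ • innerSL ℝ x) x := by
  have hd : DifferentiableAt ℝ (fun y : E3 => ‖y‖) x :=
    (contDiffAt_norm ℝ hx (n := 1)).differentiableAt (by simp)
  have h1 := (hd.hasFDerivAt.pow 2).unique (hasStrictFDerivAt_norm_sq x).hasFDerivAt
  have hn := norm_ne_zero_iff.2 hx
  refine hd.hasFDerivAt.congr_fderiv (ContinuousLinearMap.ext fun v => ?_)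
  have h2 := congrArg (fun L : E3 →L[ℝ] ℝ => L v) h1
  simp at h2
  simp only [smul_apply, smul_eq_mul, innerSL_apply_apply]
  field_simp
  linarith

/-- The derivative of a normalized vector field. -/
theorem hasFDerivAt_normalize {Y : E3 → E3} {Y' : E3 →L[ℝ] E3} {x : E3} (hY : HasFDerivAt Y Y' x)
    (h0 : Y x ≠ 0) : ∃ L : E3 →L[ℝ] E3, HasFDerivAt (normalize Y) L x ∧
      ∀ v, L v = ‖Y x‖⁻¹ • (Y' v - (inner ℝ (normalize Y x) (Y' v) : ℝ) • normalize Y x) := by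
  have hn := norm_ne_zero_iff.2 h0
  have h1 := ((hasDerivAt_inv hn).comp_hasFDerivAt x ((hasFDerivAt_norm h0).comp x hY)).smul hY
  refine ⟨_, h1, fun v => ?_⟩
  simp only [add_apply, smul_apply, ContinuousLinearMap.smulRight_apply,
    ContinuousLinearMap.comp_apply, innerSL_apply_apply, smul_eq_mul, normalize,
    real_inner_smul_left, smul_sub, smul_smul, Function.comp_apply]
  rw [sub_eq_add_neg, ← neg_smul]
  congr 2
  field_simp

theorem hasFDerivAt_crossL {A B : E3 → E3} {A' B' : E3 →L[ℝ] E3} {x : E3}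
    (hA : HasFDerivAt A A' x) (hB : HasFDerivAt B B' x) :
    ∃ L : E3 →L[ℝ] E3, HasFDerivAt (fun y => crossL (A y) (B y)) L x ∧
      ∀ v, L v = crossL (A' v) (B x) + crossL (A x) (B' v) := by
  refine ⟨_, crossL.hasFDerivAt_of_bilinear hA hB, fun v => ?_⟩
  simp [add_comm]

theorem contDiffOn_crossL {A B : E3 → E3} (hA : ContDiffOn ℝ 1 A {0}ᶜ)
    (hB : ContDiffOn ℝ 1 B {0}ᶜ) : ContDiffOn ℝ 1 (fun y => crossL (A y) (B y)) {0}ᶜ :=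
  (crossL.contDiff.comp_contDiffOn hA).clm_apply hB

/-- The derivative of a unit vector field is orthogonal to it. -/
theorem inner_fderiv_of_unit {n : E3 → E3} {n' : E3 →L[ℝ] E3} {θ : S2}
    (hn : HasFDerivAt n n' (θ : E3)) (hunit : ∀ x, x ≠ 0 → inner ℝ (n x) (n x) = (1 : ℝ)) (v : E3) :
    inner ℝ (n θ) (n' v) = (0 : ℝ) := by
  have h1 := hn.inner ℝ hn
  have h2 : HasFDerivAt (fun y => inner ℝ (n y) (n y)) (0 : E3 →L[ℝ] ℝ) (θ : E3) := by
    refine (hasFDerivAt_const (1 : ℝ) (θ : E3)).congr_of_eventuallyEq ?_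
    filter_upwards [isOpen_punctured.mem_nhds (ne_zero_of_mem_unit_sphere θ)] with y hy
    exact hunit y hy
  have h3 := congrArg (fun L : E3 →L[ℝ] ℝ => L v) (h1.unique h2)
  simp only [ContinuousLinearMap.comp_apply, ContinuousLinearMap.prod_apply,
    fderivInnerCLM_apply, zero_apply] at h3
  rw [real_inner_comm (n θ) (n' v)] at h3
  linarith

/-- The degree of a unit vector field on the sphere that is nowhere opposite to the position
vector: the Jacobian determinant integrates to the area of the sphere. -/
theorem exists_continuous_degree {n : E3 → E3} (hn : ContDiffOn ℝ 1 n {0}ᶜ)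
    (hunit : ∀ x, x ≠ 0 → inner ℝ (n x) (n x) = (1 : ℝ))
    (hpos : ∀ x, x ≠ 0 → 0 < 1 + (inner ℝ (normalize id x) (n x) : ℝ)) :
    ∃ D : S2 → ℝ, Continuous D ∧ ∫ θ, D θ ∂sphereMeasure = 4 * Real.pi ∧
      ∀ (θ : S2) (e₁ e₂ : E3) (s : ℝ), IsFrame (θ : E3) e₁ e₂ s →
        D θ = s * inner ℝ (n θ) (crossL (fderiv ℝ n θ e₁) (fderiv ℝ n θ e₂)) := by
  have hp : ContDiffOn ℝ 1 (normalize id) ({0}ᶜ : Set E3) :=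
    contDiffOn_normalize (n := 1) contDiffOn_id fun x hx => hx
  -- By `degree_identity` the form ⟨A, dB⟩ is a primitive of the difference between the area forms
  -- pulled back by n and by the position field. It is singular only where n is opposite to the
  -- position, which `hpos` excludes.
  let A : E3 → E3 := fun x => (1 + (inner ℝ (normalize id x) (n x) : ℝ))⁻¹ •
    crossL (normalize id x) (n x)
  let B : E3 → E3 := fun x => normalize id x + n x
  have hA : ContDiffOn ℝ 1 A {0}ᶜ :=
    ((contDiffOn_const.add (hp.inner ℝ hn)).inv fun x hx => (hpos x hx).ne').smul
      (contDiffOn_crossL hp hn)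
  have hB : ContDiffOn ℝ 1 B {0}ᶜ := hp.add hn
  -- Defining D by the bracket makes its continuity evident; the determinant refers to a frame.
  refine ⟨fun θ => vectorBracket A B θ + 1, (continuous_vectorBracket hA hB).add continuous_const,
    ?_, fun θ e₁ e₂ s h => ?_⟩
  · rw [integral_add (integrable_sphere (continuous_vectorBracket hA hB)) (integrable_const 1),
      integral_vectorBracket hA hB, integral_const, sphereMeasure_univ]
    simp
  · have hθ : (θ : E3) ≠ 0 := ne_zero_of_mem_unit_sphere θ
    obtain ⟨P, hP, hPv⟩ := hasFDerivAt_normalize (Y := id) (hasFDerivAt_id (θ : E3)) hθ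
    have hθn : normalize id (θ : E3) = θ := by simp [normalize]
    have hP1 : P e₁ = e₁ := by
      rw [hPv, hθn]; simp [real_inner_comm, h.inner_one_self]
    have hP2 : P e₂ = e₂ := by
      rw [hPv, hθn]; simp [real_inner_comm, h.inner_two_self]
    have hnθ := (differentiableAt_of_contDiffOn hn hθ).hasFDerivAt
    have horth := inner_fderiv_of_unit hnθ hunit
    obtain ⟨L, hL, hLv⟩ := hasFDerivAt_crossL hP hnθ
    have hc := hpos θ hθ
    rw [hθn] at hc
    obtain ⟨M, hM, hMv⟩ : ∃ M : E3 →L[ℝ] E3, HasFDerivAt A M θ ∧ ∀ v, M v =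
        (1 + inner ℝ (θ : E3) (n θ) : ℝ)⁻¹ • (crossL (P v) (n θ) + crossL θ (fderiv ℝ n θ v)) -
        ((inner ℝ (P v) (n θ) + inner ℝ (θ : E3) (fderiv ℝ n θ v) : ℝ) /
          (1 + inner ℝ (θ : E3) (n θ)) ^ 2) • crossL (θ : E3) (n θ) := by
      have hinv := (hasDerivAt_inv (hpos θ hθ).ne').comp_hasFDerivAt (θ : E3)
        ((hP.inner ℝ hnθ).const_add 1)
      refine ⟨_, hinv.smul hL, fun v => ?_⟩
      simp only [add_apply, smul_apply, ContinuousLinearMap.smulRight_apply,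
        ContinuousLinearMap.comp_apply, ContinuousLinearMap.prod_apply, fderivInnerCLM_apply, hLv,
        hθn, Function.comp_apply, smul_eq_mul]
      rw [sub_eq_add_neg _ (_ • crossL (θ : E3) (n θ)), ← neg_smul]
      congr 2
      ring
    have hval := h.degree_identity (hunit θ hθ) (horth e₁) (horth e₂) (v₁ := fderiv ℝ n θ e₁)
      (v₂ := fderiv ℝ n θ e₂) hc.ne'
    have hvb := h.vectorBracket_eq hM (hP.add hnθ)
    simp only [hMv, hP1, hP2, add_apply] at hvb
    rw [hval] at hvb
    have hvb' : vectorBracket A B θ =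
      s * inner ℝ (n θ) (crossL (fderiv ℝ n θ e₁) (fderiv ℝ n θ e₂)) - 1 := hvb
    change vectorBracket A B θ + 1 = _
    rw [hvb']
    ring

/-! ### The geometry of a radial graph -/

/-- A normal vector field of the radial graph of `f`. -/
def polarNormal (f : S2 → ℝ) (x : E3) : E3 :=
  -- The factor ‖x‖ offsets the homogeneity of degree −1 of the gradient.
  (1 + rayExt f x) • normalize id x - ‖x‖ • gradient (rayExt f) x

/-- The outer unit normal of the radial graph of `f`, extended along rays. -/
def outerNormal (f : S2 → ℝ) : E3 → E3 := normalize (polarNormal f)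

theorem inner_gradient_left (F : E3 → ℝ) (x v : E3) :
    inner ℝ (gradient F x) v = fderiv ℝ F x v := by
  rw [gradient, InnerProductSpace.toDual_symm_apply]

section

variable {f : S2 → ℝ}

theorem one_add_rayExt_pos (hpos : ∀ θ, 0 < 1 + f θ) {x : E3} (hx : x ≠ 0) :
    0 < 1 + rayExt f x := by
  rw [rayExt, dif_neg hx]; exact hpos _

theorem inner_normalize_gradient (hF : ContDiffOn ℝ 2 (rayExt f) {0}ᶜ) {x : E3} (hx : x ≠ 0) :
    inner ℝ (normalize id x) (gradient (rayExt f) x) = (0 : ℝ) := by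
  rw [real_inner_comm, inner_gradient_left, normalize, map_smul, id_eq,
    fderiv_rayExt_self f (differentiableAt_of_contDiffOn (hF.of_le (by norm_num)) hx), smul_zero]

theorem inner_polarNormal_normalize (hF : ContDiffOn ℝ 2 (rayExt f) {0}ᶜ) {x : E3} (hx : x ≠ 0) :
    inner ℝ (polarNormal f x) (normalize id x) = 1 + rayExt f x := by
  rw [polarNormal, inner_sub_left, real_inner_smul_left, real_inner_smul_left,
    inner_normalize_self (Y := id) hx, real_inner_comm, inner_normalize_gradient hF hx]
  ring

theorem polarNormal_ne_zero (hF : ContDiffOn ℝ 2 (rayExt f) {0}ᶜ) (hpos : ∀ θ, 0 < 1 + f θ)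
    {x : E3} (hx : x ≠ 0) : polarNormal f x ≠ 0 := fun h => by
  have h1 := inner_polarNormal_normalize hF hx
  rw [h, inner_zero_left] at h1
  exact (one_add_rayExt_pos hpos hx).ne h1

theorem contDiffOn_normalize_id : ContDiffOn ℝ 2 (normalize id) ({0}ᶜ : Set E3) :=
  contDiffOn_normalize (n := 2) contDiffOn_id fun _ hx => hx

theorem contDiffOn_gradient (hF : ContDiffOn ℝ 2 (rayExt f) {0}ᶜ) :
    ContDiffOn ℝ 1 (gradient (rayExt f)) {0}ᶜ :=
  (InnerProductSpace.toDual ℝ E3).symm.contDiff.comp_contDiffOn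
    (hF.fderiv_of_isOpen (m := 1) isOpen_punctured (by norm_num))

theorem contDiffOn_polarNormal (hF : ContDiffOn ℝ 2 (rayExt f) {0}ᶜ) :
    ContDiffOn ℝ 1 (polarNormal f) {0}ᶜ := by
  have h1 : ContDiffOn ℝ 1 (fun x : E3 => ‖x‖) {0}ᶜ := contDiffOn_id.norm ℝ fun _ hx => hx
  have h2 : ContDiffOn ℝ 1 (rayExt f) {0}ᶜ := hF.of_le (by norm_num)
  have h3 : ContDiffOn ℝ 1 (normalize id) ({0}ᶜ : Set E3) :=
    contDiffOn_normalize_id.of_le (by norm_num)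
  exact ((contDiffOn_const.add h2).smul h3).sub (h1.smul (contDiffOn_gradient hF))

theorem contDiffOn_outerNormal (hF : ContDiffOn ℝ 2 (rayExt f) {0}ᶜ) (hpos : ∀ θ, 0 < 1 + f θ) :
    ContDiffOn ℝ 1 (outerNormal f) {0}ᶜ :=
  contDiffOn_normalize (n := 1) (contDiffOn_polarNormal hF) fun _ hx =>
    polarNormal_ne_zero hF hpos hx

theorem contDiffOn_radial (hF : ContDiffOn ℝ 2 (rayExt f) {0}ᶜ) :
    ContDiffOn ℝ 2 (rayExt (radialGraph f)) {0}ᶜ :=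
  ((contDiffOn_const.add hF).smul contDiffOn_normalize_id).congr fun _ hx =>
    rayExt_radialGraph f hx

theorem fderiv_radial (hF : ContDiffOn ℝ 2 (rayExt f) {0}ᶜ) {x : E3} (hx : x ≠ 0) (v : E3) :
    fderiv ℝ (rayExt (radialGraph f)) x v = (fderiv ℝ (rayExt f) x v) • normalize id x +
      (1 + rayExt f x) • (‖x‖⁻¹ • (v - (inner ℝ (normalize id x) v : ℝ) • normalize id x)) := by
  obtain ⟨L, hL, hLv⟩ := hasFDerivAt_normalize (Y := id) (hasFDerivAt_id x) hx
  have hFx := (differentiableAt_of_contDiffOn (hF.of_le (by norm_num)) hx).hasFDerivAt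
  have h1 := (hFx.const_add 1).smul hL
  have h2 : rayExt (radialGraph f) =ᶠ[nhds x] fun y => (1 + rayExt f y) • normalize id y := by
    filter_upwards [isOpen_punctured.mem_nhds hx] with y hy using rayExt_radialGraph f hy
  rw [(h1.congr_of_eventuallyEq h2).fderiv]
  simp [hLv, add_comm]

/-- Orthogonality holds at every x ≠ 0 and not only on the sphere, so it can be differentiated to
give the Weingarten equation. -/
theorem inner_outerNormal_fderiv (hF : ContDiffOn ℝ 2 (rayExt f) {0}ᶜ) {x : E3} (hx : x ≠ 0)
    (v : E3) : inner ℝ (outerNormal f x) (fderiv ℝ (rayExt (radialGraph f)) x v) = (0 : ℝ) := by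
  have hn : ‖x‖ ≠ 0 := norm_ne_zero_iff.2 hx
  have h1 := inner_polarNormal_normalize hF hx
  have h2 : inner ℝ (polarNormal f x) v = (1 + rayExt f x) * inner ℝ (normalize id x) v
      - ‖x‖ * fderiv ℝ (rayExt f) x v := by
    rw [polarNormal, inner_sub_left, real_inner_smul_left, real_inner_smul_left,
      inner_gradient_left]
  rw [outerNormal, normalize, real_inner_smul_left, fderiv_radial hF hx, inner_add_right,
    real_inner_smul_right, real_inner_smul_right, real_inner_smul_right, inner_sub_right,
    real_inner_smul_right, h1, h2]
  field_simp
  ring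

theorem normalize_id_coe (θ : S2) : normalize id (θ : E3) = θ := by simp [normalize]

theorem polarNormal_coe (θ : S2) :
    polarNormal f θ = (1 + f θ) • (θ : E3) - sphereGradient f θ := by
  simp [polarNormal, normalize_id_coe, rayExt_coe, sphereGradient]

theorem inner_self_sphereGradient (hF : ContDiffOn ℝ 2 (rayExt f) {0}ᶜ) (θ : S2) :
    inner ℝ (θ : E3) (sphereGradient f θ) = (0 : ℝ) := by
  have := inner_normalize_gradient hF (ne_zero_of_mem_unit_sphere θ)
  rwa [normalize_id_coe] at this

theorem tangentVec_eq (hF : ContDiffOn ℝ 2 (rayExt f) {0}ᶜ) (θ : S2) {i : Fin 2}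
    (hi : inner ℝ (frame θ i) (θ : E3) = (0 : ℝ)) : tangentVec (radialGraph f) θ i =
      (inner ℝ (sphereGradient f θ) (frame θ i) : ℝ) • (θ : E3) + (1 + f θ) • frame θ i := by
  rw [real_inner_comm] at hi
  rw [tangentVec, fderiv_radial hF (ne_zero_of_mem_unit_sphere θ), normalize_id_coe, hi,
    rayExt_coe, sphereGradient, inner_gradient_left]
  simp

theorem crossL_tangentVec (hF : ContDiffOn ℝ 2 (rayExt f) {0}ᶜ) (θ : S2) {s : ℝ}
    (h : IsFrame (θ : E3) (frame θ 0) (frame θ 1) s) :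
    crossL (tangentVec (radialGraph f) θ 0) (tangentVec (radialGraph f) θ 1) =
      (s * (1 + f θ)) • polarNormal f θ := by
  have hG := h.eq_sum (sphereGradient f θ)
  have hG0 : inner ℝ (sphereGradient f θ) (θ : E3) = (0 : ℝ) := by
    rw [real_inner_comm, inner_self_sphereGradient hF]
  rw [hG0, zero_smul, add_zero] at hG
  rw [tangentVec_eq hF θ h.inner_one_self, tangentVec_eq hF θ h.inner_two_self, polarNormal_coe]
  nth_rw 3 [hG]
  simp only [map_add, map_smul, add_apply, smul_apply, crossL_self, h.cross_one_two,
    h.cross_self_one, crossL_anticomm (θ : E3) (frame θ 1), h.cross_two_self,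
    crossL_anticomm (frame θ 0) (θ : E3)]
  module

theorem crossNormal_eq (X : S2 → E3) (θ : S2) :
    crossNormal X θ = crossL (tangentVec X θ 0) (tangentVec X θ 1) := rfl

theorem det_firstForm (X : S2 → E3) (θ : S2) :
    (firstForm X θ).det = ‖crossNormal X θ‖ ^ 2 := by
  rw [crossNormal_eq, ← real_inner_self_eq_norm_sq, inner_crossL_crossL, Matrix.det_fin_two]
  simp [firstForm]

theorem areaDensity_eq_norm (X : S2 → E3) (θ : S2) : areaDensity X θ = ‖crossNormal X θ‖ := by
  rw [areaDensity, det_firstForm, Real.sqrt_sq (norm_nonneg _)]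

theorem areaDensity_radialGraph (hF : ContDiffOn ℝ 2 (rayExt f) {0}ᶜ) (hpos : ∀ θ, 0 < 1 + f θ)
    (θ : S2) : areaDensity (radialGraph f) θ = (1 + f θ) * ‖polarNormal f θ‖ := by
  obtain ⟨s, h⟩ := exists_isFrame θ
  have hs : |s| = 1 := by
    rw [← sq_eq_sq₀ (abs_nonneg s) zero_le_one, sq_abs, one_pow, sq, h.sq]
  rw [areaDensity_eq_norm, crossNormal_eq, crossL_tangentVec hF θ h, norm_smul, norm_mul,
    Real.norm_eq_abs, Real.norm_eq_abs, hs, abs_of_pos (hpos θ), one_mul]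

theorem areaDensity_pos (hF : ContDiffOn ℝ 2 (rayExt f) {0}ᶜ) (hpos : ∀ θ, 0 < 1 + f θ)
    (θ : S2) : 0 < areaDensity (radialGraph f) θ := by
  rw [areaDensity_radialGraph hF hpos]
  exact mul_pos (hpos θ) (norm_pos_iff.2
    (polarNormal_ne_zero hF hpos (ne_zero_of_mem_unit_sphere θ)))

/-- The sign in `unitNormal` cancels the unknown orientation s of the frame, since `polarNormal` has
the positive radial component 1 + f. -/
theorem unitNormal_radialGraph (hF : ContDiffOn ℝ 2 (rayExt f) {0}ᶜ) (hpos : ∀ θ, 0 < 1 + f θ)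
    (θ : S2) : unitNormal (radialGraph f) θ = outerNormal f θ := by
  obtain ⟨s, h⟩ := exists_isFrame θ
  have hr := hpos θ
  have hin := inner_polarNormal_normalize hF (ne_zero_of_mem_unit_sphere θ)
  rw [normalize_id_coe, rayExt_coe] at hin
  have hs : s = 1 ∨ s = -1 := by
    have : (s - 1) * (s + 1) = 0 := by linear_combination h.sq
    rcases mul_eq_zero.1 this with h1 | h1
    · left; linarith
    · right; linarith
  have hw : 0 < ‖polarNormal f θ‖ :=
    norm_pos_iff.2 (polarNormal_ne_zero hF hpos (ne_zero_of_mem_unit_sphere θ))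
  rw [unitNormal, ← areaDensity_eq_norm, areaDensity_radialGraph hF hpos, crossNormal_eq,
    crossL_tangentVec hF θ h, radialGraph, real_inner_smul_left, real_inner_smul_right, hin,
    outerNormal, normalize, smul_smul]
  congr 1
  rcases hs with rfl | rfl
  · rw [Real.sign_of_pos (by positivity)]
    field_simp
  · rw [Real.sign_of_neg (by nlinarith [mul_pos hr (mul_pos hr hr)])]
    field_simp

theorem crossL_tangentVec_eq_smul (hF : ContDiffOn ℝ 2 (rayExt f) {0}ᶜ)
    (hpos : ∀ θ, 0 < 1 + f θ) (θ : S2) {s : ℝ}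
    (h : IsFrame (θ : E3) (frame θ 0) (frame θ 1) s) :
    crossL (tangentVec (radialGraph f) θ 0) (tangentVec (radialGraph f) θ 1) =
      (s * areaDensity (radialGraph f) θ) • outerNormal f θ := by
  have hw := norm_ne_zero_iff.2 (polarNormal_ne_zero hF hpos (ne_zero_of_mem_unit_sphere θ))
  rw [crossL_tangentVec hF θ h, areaDensity_radialGraph hF hpos, outerNormal, normalize, smul_smul]
  congr 1
  field_simp

/-- The Weingarten equation. -/
theorem secondForm_radialGraph (hF : ContDiffOn ℝ 2 (rayExt f) {0}ᶜ) (hpos : ∀ θ, 0 < 1 + f θ)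
    (θ : S2) (i j : Fin 2) : secondForm (radialGraph f) θ i j =
      inner ℝ (fderiv ℝ (outerNormal f) θ (frame θ i)) (tangentVec (radialGraph f) θ j) := by
  have hθ : (θ : E3) ≠ 0 := ne_zero_of_mem_unit_sphere θ
  have h1 := (differentiableAt_of_contDiffOn (contDiffOn_outerNormal hF hpos) hθ).hasFDerivAt
  have h2 : ContDiffOn ℝ 1 (fun y => fderiv ℝ (rayExt (radialGraph f)) y (frame θ j)) {0}ᶜ :=
    ((contDiffOn_radial hF).fderiv_of_isOpen (m := 1) isOpen_punctured
      (by norm_num)).clm_apply contDiffOn_const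
  have h3 := (differentiableAt_of_contDiffOn h2 hθ).hasFDerivAt
  have h4 := h1.inner ℝ h3
  -- The function ν · ∂ⱼX vanishes identically; its derivative along the i-th frame vector moves the
  -- derivative from ∂ⱼX to ν.
  have h5 : HasFDerivAt (fun y => inner ℝ (outerNormal f y)
      (fderiv ℝ (rayExt (radialGraph f)) y (frame θ j))) (0 : E3 →L[ℝ] ℝ) (θ : E3) := by
    refine (hasFDerivAt_const (0 : ℝ) (θ : E3)).congr_of_eventuallyEq ?_
    filter_upwards [isOpen_punctured.mem_nhds hθ] with y hy
    exact inner_outerNormal_fderiv hF hy _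
  have h6 := congrArg (fun L : E3 →L[ℝ] ℝ => L (frame θ i)) (h4.unique h5)
  simp only [ContinuousLinearMap.comp_apply, ContinuousLinearMap.prod_apply,
    fderivInnerCLM_apply, zero_apply] at h6
  simp only [secondForm, Matrix.of_apply, unitNormal_radialGraph hF hpos, secondDeriv, tangentVec]
  linarith

theorem inner_outerNormal_self (hF : ContDiffOn ℝ 2 (rayExt f) {0}ᶜ) (hpos : ∀ θ, 0 < 1 + f θ)
    {x : E3} (hx : x ≠ 0) : inner ℝ (outerNormal f x) (outerNormal f x) = (1 : ℝ) :=
  inner_normalize_self (polarNormal_ne_zero hF hpos hx)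

end

/-! ### Algebra of the shape operator -/

theorem trace_mul_self_fin_two (A : Matrix (Fin 2) (Fin 2) ℝ) :
    ((A - (A.trace / 2) • (1 : Matrix (Fin 2) (Fin 2) ℝ)) *
      (A - (A.trace / 2) • (1 : Matrix (Fin 2) (Fin 2) ℝ))).trace =
      A.trace ^ 2 / 2 - 2 * A.det := by
  simp [Matrix.trace_fin_two, Matrix.det_fin_two, Matrix.mul_apply, Fin.sum_univ_two,
    Matrix.one_apply]
  ring

/-- The mean curvature and the trace-free second fundamental form in terms of the matrix of the
shape operator. -/
theorem curvature_of_secondForm_eq {X : S2 → E3} {θ : S2} (hdet : (firstForm X θ).det ≠ 0)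
    {A : Matrix (Fin 2) (Fin 2) ℝ} (hA : secondForm X θ = A * firstForm X θ) :
    meanCurvature X θ = A.trace ∧ normSqTraceFree X θ = A.trace ^ 2 / 2 - 2 * A.det := by
  have hu : IsUnit (firstForm X θ).det := isUnit_iff_ne_zero.2 hdet
  have hH : meanCurvature X θ = A.trace := by
    rw [meanCurvature, hA, Matrix.trace_mul_comm, Matrix.mul_assoc, Matrix.mul_nonsing_inv _ hu,
      Matrix.mul_one]
  refine ⟨hH, ?_⟩
  have h0 : traceFreeForm X θ =
      (A - (A.trace / 2) • (1 : Matrix (Fin 2) (Fin 2) ℝ)) * firstForm X θ := by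
    rw [traceFreeForm, hH, hA, Matrix.sub_mul, Matrix.smul_mul, Matrix.one_mul]
  rw [normSqTraceFree, h0, ← trace_mul_self_fin_two]
  set B := A - (A.trace / 2) • (1 : Matrix (Fin 2) (Fin 2) ℝ)
  set G := firstForm X θ
  have : G⁻¹ * (B * G) * G⁻¹ * (B * G) = G⁻¹ * ((B * B) * G) := by
    calc G⁻¹ * (B * G) * G⁻¹ * (B * G) = G⁻¹ * (B * (G * G⁻¹) * (B * G)) := by
          simp only [Matrix.mul_assoc]
      _ = _ := by rw [Matrix.mul_nonsing_inv _ hu, Matrix.mul_one, Matrix.mul_assoc]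
  rw [this, Matrix.trace_mul_comm, Matrix.mul_assoc, Matrix.mul_nonsing_inv _ hu, Matrix.mul_one]

/-- The shape operator of a radial graph. -/
theorem exists_shapeOperator {f : S2 → ℝ} (hF : ContDiffOn ℝ 2 (rayExt f) {0}ᶜ)
    (hpos : ∀ θ, 0 < 1 + f θ) (θ : S2) : ∃ a₁ b₁ a₂ b₂ : ℝ,
      fderiv ℝ (outerNormal f) θ (frame θ 0) =
        a₁ • tangentVec (radialGraph f) θ 0 + b₁ • tangentVec (radialGraph f) θ 1 ∧
      fderiv ℝ (outerNormal f) θ (frame θ 1) =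
        a₂ • tangentVec (radialGraph f) θ 0 + b₂ • tangentVec (radialGraph f) θ 1 ∧
      meanCurvature (radialGraph f) θ = a₁ + b₂ ∧
      normSqTraceFree (radialGraph f) θ = (a₁ + b₂) ^ 2 / 2 - 2 * (a₁ * b₂ - b₁ * a₂) := by
  have hθ : (θ : E3) ≠ 0 := ne_zero_of_mem_unit_sphere θ
  obtain ⟨s, h⟩ := exists_isFrame θ
  have hJ := areaDensity_pos hF hpos θ
  have hsJ : s * areaDensity (radialGraph f) θ ≠ 0 :=
    mul_ne_zero (fun h0 => by simpa [h0] using h.sq) hJ.ne'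
  have hν := inner_outerNormal_self hF hpos hθ
  have hnθ :=
    (differentiableAt_of_contDiffOn (contDiffOn_outerNormal hF hpos) hθ).hasFDerivAt
  have horth := inner_fderiv_of_unit hnθ fun y hy => inner_outerNormal_self hF hpos hy
  have hX := crossL_tangentVec_eq_smul hF hpos θ h
  obtain ⟨a₁, b₁, h1⟩ := exists_eq_add_smul_of_orthogonal hsJ hν hX (horth (frame θ 0))
  obtain ⟨a₂, b₂, h2⟩ := exists_eq_add_smul_of_orthogonal hsJ hν hX (horth (frame θ 1))
  have hA : secondForm (radialGraph f) θ =
      !![a₁, b₁; a₂, b₂] * firstForm (radialGraph f) θ := by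
    ext i j
    rw [secondForm_radialGraph hF hpos]
    fin_cases i <;>
    simp [h1, h2, Matrix.mul_apply, Fin.sum_univ_two, firstForm, inner_add_left,
      real_inner_smul_left]
  have hdet : (firstForm (radialGraph f) θ).det ≠ 0 := by
    rw [det_firstForm, ← areaDensity_eq_norm]; positivity
  have := curvature_of_secondForm_eq hdet hA
  refine ⟨a₁, b₁, a₂, b₂, h1, h2, ?_, ?_⟩
  · rw [this.1]; simp [Matrix.trace_fin_two]
  · rw [this.2]; simp [Matrix.trace_fin_two, Matrix.det_fin_two]

/-! ### Integral identities on a radial graph -/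

/-- The direction of a point of the radial graph seen from `p`, extended along rays. -/
def direction (f : S2 → ℝ) (p : E3) : E3 → E3 :=
  normalize fun x => rayExt (radialGraph f) x - p

/-- The cosine of the angle between the outer normal and the direction seen from `p`. -/
def angleCos (f : S2 → ℝ) (p : E3) (θ : S2) : ℝ := inner ℝ (direction f p θ) (outerNormal f θ)

section

variable {f : S2 → ℝ} {p : E3}

theorem contDiffOn_direction (hF : ContDiffOn ℝ 2 (rayExt f) {0}ᶜ)
    (hp : ∀ x, x ≠ 0 → rayExt (radialGraph f) x - p ≠ 0) :
    ContDiffOn ℝ 1 (direction f p) {0}ᶜ :=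
  contDiffOn_normalize (n := 1)
    (((contDiffOn_radial hF).of_le (by norm_num)).sub contDiffOn_const) fun x hx => hp x hx

theorem hasFDerivAt_direction (hF : ContDiffOn ℝ 2 (rayExt f) {0}ᶜ)
    (hp : ∀ x, x ≠ 0 → rayExt (radialGraph f) x - p ≠ 0) (θ : S2) :
    ∃ L : E3 →L[ℝ] E3, HasFDerivAt (direction f p) L θ ∧
      ∀ i, L (frame θ i) = ‖radialGraph f θ - p‖⁻¹ • (tangentVec (radialGraph f) θ i -
        (inner ℝ (direction f p θ) (tangentVec (radialGraph f) θ i) : ℝ) • direction f p θ) := by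
  have hθ : (θ : E3) ≠ 0 := ne_zero_of_mem_unit_sphere θ
  obtain ⟨L, hL, hLv⟩ := hasFDerivAt_normalize ((differentiableAt_of_contDiffOn
    ((contDiffOn_radial hF).of_le (by norm_num)) hθ).hasFDerivAt.sub_const p) (hp θ hθ)
  refine ⟨L, hL, fun i => ?_⟩
  rw [hLv, rayExt_coe]
  rfl

theorem continuous_areaDensity (hF : ContDiffOn ℝ 2 (rayExt f) {0}ᶜ) (hpos : ∀ θ, 0 < 1 + f θ) :
    Continuous (areaDensity (radialGraph f)) := by
  have h1 : areaDensity (radialGraph f) =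
      fun θ : S2 => (1 + rayExt f θ) * ‖polarNormal f θ‖ := by
    funext θ; rw [areaDensity_radialGraph hF hpos, rayExt_coe]
  rw [h1]
  exact (continuous_const.add (continuous_restrict_sphere hF.continuousOn)).mul
    (continuous_restrict_sphere (contDiffOn_polarNormal hF).continuousOn).norm

theorem continuous_dist_radialGraph (hF : ContDiffOn ℝ 2 (rayExt f) {0}ᶜ) (p : E3) :
    Continuous fun θ : S2 => ‖radialGraph f θ - p‖ := by
  have h := continuous_restrict_sphere (contDiffOn_radial hF).continuousOn
  simp only [rayExt_coe] at h
  exact (h.sub continuous_const).norm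

theorem continuous_angleCos (hF : ContDiffOn ℝ 2 (rayExt f) {0}ᶜ) (hpos : ∀ θ, 0 < 1 + f θ)
    (hp : ∀ x, x ≠ 0 → rayExt (radialGraph f) x - p ≠ 0) : Continuous (angleCos f p) :=
  (continuous_restrict_sphere (contDiffOn_direction hF hp).continuousOn).inner
    (continuous_restrict_sphere (contDiffOn_outerNormal hF hpos).continuousOn)

/-- The form ⟨n × ν, dX⟩ is dual to the tangential part of n. Its exterior derivative is minus the
divergence of that part, namely Hσ − (1 + σ²)/ρ times the area element. -/
theorem vectorBracket_direction (hF : ContDiffOn ℝ 2 (rayExt f) {0}ᶜ) (hpos : ∀ θ, 0 < 1 + f θ)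
    (hp : ∀ x, x ≠ 0 → rayExt (radialGraph f) x - p ≠ 0) (θ : S2) :
    vectorBracket (fun x => crossL (direction f p x) (outerNormal f x))
        (rayExt (radialGraph f)) θ =
      meanCurvature (radialGraph f) θ * angleCos f p θ * areaDensity (radialGraph f) θ -
        (1 + angleCos f p θ ^ 2) * areaDensity (radialGraph f) θ / ‖radialGraph f θ - p‖ := by
  have hθ : (θ : E3) ≠ 0 := ne_zero_of_mem_unit_sphere θ
  obtain ⟨s, h⟩ := exists_isFrame θ
  obtain ⟨L, hL, hLv⟩ := hasFDerivAt_direction hF hp θ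
  have hν := (differentiableAt_of_contDiffOn (contDiffOn_outerNormal hF hpos) hθ).hasFDerivAt
  have hX := (differentiableAt_of_contDiffOn
    ((contDiffOn_radial hF).of_le (by norm_num)) hθ).hasFDerivAt
  obtain ⟨M, hM, hMv⟩ := hasFDerivAt_crossL hL hν
  obtain ⟨a₁, b₁, a₂, b₂, h1, h2, hH, _⟩ := exists_shapeOperator hF hpos θ
  rw [h.vectorBracket_eq hM hX, hMv, hMv, hLv, hLv, hH]
  exact meanCurvature_identity h.sq (inner_outerNormal_self hF hpos hθ)
    (inner_normalize_self (hp θ hθ)) (areaDensity_pos hF hpos θ).ne'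
    (crossL_tangentVec_eq_smul hF hpos θ h) h1 h2

theorem radial_ne_zero (hpos : ∀ θ, 0 < 1 + f θ) (x : E3) (hx : x ≠ 0) :
    rayExt (radialGraph f) x - 0 ≠ 0 := by
  rw [sub_zero, rayExt_radialGraph f hx]
  exact smul_ne_zero (one_add_rayExt_pos hpos hx).ne'
    (smul_ne_zero (inv_ne_zero (norm_ne_zero_iff.2 hx)) hx)

theorem inner_normalize_outerNormal_pos (hF : ContDiffOn ℝ 2 (rayExt f) {0}ᶜ)
    (hpos : ∀ θ, 0 < 1 + f θ) {x : E3} (hx : x ≠ 0) :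
    0 < (inner ℝ (normalize id x) (outerNormal f x) : ℝ) := by
  change 0 < (inner ℝ (normalize id x) (‖polarNormal f x‖⁻¹ • polarNormal f x) : ℝ)
  rw [real_inner_smul_right, real_inner_comm, inner_polarNormal_normalize hF hx]
  exact mul_pos (inv_pos.2 (norm_pos_iff.2 (polarNormal_ne_zero hF hpos hx)))
    (one_add_rayExt_pos hpos hx)

theorem angleCos_zero_pos (hF : ContDiffOn ℝ 2 (rayExt f) {0}ᶜ) (hpos : ∀ θ, 0 < 1 + f θ)
    (θ : S2) : 0 < angleCos f 0 θ := by
  have h1 := inner_normalize_outerNormal_pos hF hpos (ne_zero_of_mem_unit_sphere θ)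
  rw [normalize_id_coe] at h1
  rw [angleCos, direction, normalize, rayExt_coe, sub_zero, radialGraph, real_inner_smul_left,
    real_inner_smul_left]
  exact mul_pos (inv_pos.2 (norm_pos_iff.2 (smul_ne_zero (hpos θ).ne'
    (ne_zero_of_mem_unit_sphere θ)))) (mul_pos (hpos θ) h1)

theorem continuous_vectorBracket_direction (hF : ContDiffOn ℝ 2 (rayExt f) {0}ᶜ)
    (hpos : ∀ θ, 0 < 1 + f θ) (hp : ∀ x, x ≠ 0 → rayExt (radialGraph f) x - p ≠ 0) :
    Continuous fun θ : S2 => vectorBracket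
      (fun x => crossL (direction f p x) (outerNormal f x)) (rayExt (radialGraph f)) θ :=
  continuous_vectorBracket
    (contDiffOn_crossL (contDiffOn_direction hF hp) (contDiffOn_outerNormal hF hpos))
    ((contDiffOn_radial hF).of_le (by norm_num))

/-- Since H is defined through a frame with no continuity in θ, it is recovered by solving
`vectorBracket_direction` at p = 0 for H; every other term there is continuous, and the factor σJ is
positive. -/
theorem continuous_meanCurvature (hF : ContDiffOn ℝ 2 (rayExt f) {0}ᶜ)
    (hpos : ∀ θ, 0 < 1 + f θ) : Continuous (meanCurvature (radialGraph f)) := by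
  have hp := radial_ne_zero hpos
  have hd : ∀ θ : S2, ‖radialGraph f θ - 0‖ ≠ 0 := fun θ => by
    have := hp θ (ne_zero_of_mem_unit_sphere θ)
    rw [rayExt_coe] at this
    exact norm_ne_zero_iff.2 this
  have hσ := angleCos_zero_pos hF hpos
  have hJ := areaDensity_pos hF hpos
  have hcJ := continuous_areaDensity hF hpos
  have hcσ := continuous_angleCos hF hpos hp
  have heq : meanCurvature (radialGraph f) = fun θ : S2 =>
      (vectorBracket (fun x => crossL (direction f 0 x) (outerNormal f x))
        (rayExt (radialGraph f)) θ +
        (1 + angleCos f 0 θ ^ 2) * areaDensity (radialGraph f) θ / ‖radialGraph f θ - 0‖) /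
        (angleCos f 0 θ * areaDensity (radialGraph f) θ) := by
    funext θ
    rw [vectorBracket_direction hF hpos hp, sub_add_cancel, mul_assoc,
      mul_div_cancel_right₀ _ (mul_pos (hσ θ) (hJ θ)).ne']
  rw [heq]
  exact ((continuous_vectorBracket_direction hF hpos hp).add
    (((continuous_const.add (hcσ.pow 2)).mul hcJ).div (continuous_dist_radialGraph hF 0) hd)).div
    (hcσ.mul hcJ) fun θ => (mul_pos (hσ θ) (hJ θ)).ne'

theorem dist_radialGraph_ne_zero (hp : ∀ x, x ≠ 0 → rayExt (radialGraph f) x - p ≠ 0) (θ : S2) :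
    ‖radialGraph f θ - p‖ ≠ 0 := by
  have := hp θ (ne_zero_of_mem_unit_sphere θ)
  rw [rayExt_coe] at this
  exact norm_ne_zero_iff.2 this

/-- The divergence theorem on a radial graph for the field of directions seen from `p`. -/
theorem integral_meanCurvature_mul_angleCos (hF : ContDiffOn ℝ 2 (rayExt f) {0}ᶜ)
    (hpos : ∀ θ, 0 < 1 + f θ) (hp : ∀ x, x ≠ 0 → rayExt (radialGraph f) x - p ≠ 0) :
    ∫ θ, meanCurvature (radialGraph f) θ * angleCos f p θ * areaDensity (radialGraph f) θ
        ∂sphereMeasure =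
      ∫ θ, (1 + angleCos f p θ ^ 2) * areaDensity (radialGraph f) θ / ‖radialGraph f θ - p‖
        ∂sphereMeasure := by
  have hcJ := continuous_areaDensity hF hpos
  have hcσ := continuous_angleCos hF hpos hp
  have h := integral_vectorBracket
    (contDiffOn_crossL (contDiffOn_direction hF hp) (contDiffOn_outerNormal hF hpos))
    ((contDiffOn_radial hF).of_le (by norm_num))
  have h1 : Integrable (fun θ : S2 => meanCurvature (radialGraph f) θ * angleCos f p θ *
      areaDensity (radialGraph f) θ) sphereMeasure :=
    integrable_sphere (((continuous_meanCurvature hF hpos).mul hcσ).mul hcJ)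
  have h2 : Integrable (fun θ : S2 => (1 + angleCos f p θ ^ 2) * areaDensity (radialGraph f) θ /
      ‖radialGraph f θ - p‖) sphereMeasure :=
    integrable_sphere (((continuous_const.add (hcσ.pow 2)).mul hcJ).div
      (continuous_dist_radialGraph hF p) (dist_radialGraph_ne_zero hp))
  simp_rw [vectorBracket_direction hF hpos hp] at h
  rw [integral_sub h1 h2] at h
  exact sub_eq_zero.1 h

/-- The total solid angle of a radial graph seen from `p`. -/
theorem integral_solidAngle (hF : ContDiffOn ℝ 2 (rayExt f) {0}ᶜ) (hpos : ∀ θ, 0 < 1 + f θ)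
    (hp : ∀ x, x ≠ 0 → rayExt (radialGraph f) x - p ≠ 0)
    (hdir : ∀ x, x ≠ 0 → 0 < 1 + (inner ℝ (normalize id x) (direction f p x) : ℝ)) :
    ∫ θ, angleCos f p θ * areaDensity (radialGraph f) θ / ‖radialGraph f θ - p‖ ^ 2
      ∂sphereMeasure = 4 * Real.pi := by
  obtain ⟨D, _, hD, hDθ⟩ := exists_continuous_degree (contDiffOn_direction hF hp)
    (fun x hx => inner_normalize_self (hp x hx)) hdir
  rw [← hD]
  congr 1
  funext θ
  obtain ⟨s, h⟩ := exists_isFrame θ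
  obtain ⟨L, hL, hLv⟩ := hasFDerivAt_direction hF hp θ
  have hρ := dist_radialGraph_ne_zero hp θ
  rw [hDθ θ _ _ s h, hL.fderiv, hLv, hLv, angleCos]
  simp only [map_smul, map_sub, smul_apply, sub_apply, crossL_self, inner_smul_right,
    inner_sub_right, crossL_tangentVec_eq_smul hF hpos θ h, smul_zero, inner_zero_right]
  -- Multiples of n in the derivative of n drop out of the triple product with n, leaving ρ⁻² ⟨n, X₁
  -- × X₂⟩.
  have h1 : ∀ v, inner ℝ (direction f p θ) (crossL (direction f p θ) v) = (0 : ℝ) := fun v => by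
    rw [real_inner_comm, inner_crossL_left]
  have h2 : ∀ v, inner ℝ (direction f p θ) (crossL v (direction f p θ)) = (0 : ℝ) := fun v => by
    rw [real_inner_comm, inner_crossL_right]
  simp only [h1, h2]
  field_simp
  linear_combination (-(areaDensity (radialGraph f) θ *
    inner ℝ (direction f p θ) (outerNormal f θ))) * h.sq

/-- The Gauss–Bonnet theorem for a radial graph. -/
theorem exists_gaussCurvature (hF : ContDiffOn ℝ 2 (rayExt f) {0}ᶜ) (hpos : ∀ θ, 0 < 1 + f θ) :
    ∃ K : S2 → ℝ, Continuous K ∧ ∫ θ, K θ ∂sphereMeasure = 4 * Real.pi ∧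
      ∀ θ, normSqTraceFree (radialGraph f) θ * areaDensity (radialGraph f) θ =
        meanCurvature (radialGraph f) θ ^ 2 / 2 * areaDensity (radialGraph f) θ - 2 * K θ := by
  obtain ⟨D, hDc, hD, hDθ⟩ := exists_continuous_degree (contDiffOn_outerNormal hF hpos)
    (fun x hx => inner_outerNormal_self hF hpos hx)
    (fun x hx => by linarith [inner_normalize_outerNormal_pos hF hpos hx])
  refine ⟨D, hDc, hD, fun θ => ?_⟩
  have hθ : (θ : E3) ≠ 0 := ne_zero_of_mem_unit_sphere θ
  obtain ⟨s, h⟩ := exists_isFrame θ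
  obtain ⟨a₁, b₁, a₂, b₂, h1, h2, hH, hN⟩ := exists_shapeOperator hF hpos θ
  -- The shape operator scales X₁ × X₂ by its determinant, so the Jacobian of the Gauss map is the
  -- Gauss curvature times the area element.
  have hcr : crossL (fderiv ℝ (outerNormal f) θ (frame θ 0))
      (fderiv ℝ (outerNormal f) θ (frame θ 1)) =
      ((a₁ * b₂ - b₁ * a₂) * (s * areaDensity (radialGraph f) θ)) • outerNormal f θ := by
    rw [mul_smul, ← crossL_tangentVec_eq_smul hF hpos θ h, h1, h2]
    simp only [map_add, map_smul, add_apply, smul_apply, crossL_self,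
      crossL_anticomm (tangentVec (radialGraph f) θ 1) (tangentVec (radialGraph f) θ 0)]
    module
  rw [hDθ θ _ _ s h, hcr, real_inner_smul_right, inner_outerNormal_self hF hpos hθ, hN, hH]
  linear_combination (2 * (a₁ * b₂ - b₁ * a₂) * areaDensity (radialGraph f) θ) * h.sq

end

/-! ### The centre of a surface close to the sphere -/

theorem integrable_sphere_vector {g : S2 → E3} (hg : Continuous g) :
    Integrable g sphereMeasure :=
  hg.integrable_of_hasCompactSupport (HasCompactSupport.of_compactSpace g)

/-- The moments of low order come from evaluating the Dirichlet form of a constant and a power in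
both orders: one order gives zero, the other the weak Laplacian of the power. -/
theorem integral_inner_sphere (a : E3) : ∫ θ : S2, inner ℝ a (θ : E3) ∂sphereMeasure = 0 := by
  have h1 := dirichletForm_linPow (linPow 0 0) a 1
  have h2 := dirichletForm_linPow (linPow a 1) 0 0
  rw [dirichletForm_comm] at h2
  simp only [sphereForm_apply, linPow_apply, pow_zero, pow_one, one_mul] at h1 h2
  norm_num at h1 h2
  linarith

theorem integral_inner_sq_sphere (a : E3) :
    ∫ θ : S2, (inner ℝ a (θ : E3) : ℝ) ^ 2 ∂sphereMeasure = 4 * Real.pi / 3 * ‖a‖ ^ 2 := by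
  have h1 := dirichletForm_linPow (linPow 0 0) a 2
  have h2 := dirichletForm_linPow (linPow a 2) 0 0
  rw [dirichletForm_comm] at h2
  simp only [sphereForm_apply, linPow_apply, pow_zero, one_mul] at h1 h2
  norm_num [sphereMeasure_univ] at h1 h2
  linarith

theorem integral_inner_mul_inner_sphere (a b : E3) :
    ∫ θ : S2, (inner ℝ a (θ : E3) : ℝ) * inner ℝ b (θ : E3) ∂sphereMeasure =
      4 * Real.pi / 3 * inner ℝ a b := by
  have hi : ∀ c : E3, Integrable (fun θ : S2 => (inner ℝ c (θ : E3) : ℝ) ^ 2) sphereMeasure :=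
    fun c => integrable_sphere ((continuous_const.inner continuous_subtype_val).pow 2)
  have h : ∀ θ : S2, (inner ℝ a (θ : E3) : ℝ) * inner ℝ b (θ : E3) =
      1 / 4 * ((inner ℝ (a + b) (θ : E3) : ℝ) ^ 2 - (inner ℝ (a - b) (θ : E3) : ℝ) ^ 2) :=
    fun θ => by rw [inner_add_left, inner_sub_left]; ring
  simp_rw [h]
  rw [integral_const_mul, integral_sub (hi _) (hi _), integral_inner_sq_sphere,
    integral_inner_sq_sphere, norm_add_sq_real, norm_sub_sq_real]
  ring

theorem integral_inner_smul_sphere (a : E3) :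
    ∫ θ : S2, (inner ℝ a (θ : E3) : ℝ) • (θ : E3) ∂sphereMeasure = (4 * Real.pi / 3) • a := by
  have hc : Continuous fun θ : S2 => (inner ℝ a (θ : E3) : ℝ) • (θ : E3) := by fun_prop
  refine ext_inner_left ℝ fun b => ?_
  rw [← integral_inner (integrable_sphere_vector hc)]
  simp_rw [real_inner_smul_right]
  rw [integral_inner_mul_inner_sphere, real_inner_comm]

theorem integral_coe_sphere : ∫ θ : S2, (θ : E3) ∂sphereMeasure = 0 := by
  refine ext_inner_left ℝ fun b => ?_
  rw [← integral_inner (integrable_sphere_vector continuous_subtype_val), integral_inner_sphere,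
    inner_zero_right]

theorem abs_norm_sub_one_le {x y : E3} {s : ℝ} (hx : ‖x‖ = 1) (h : ‖y - x‖ ≤ s) :
    |‖y‖ - 1| ≤ s := by
  rw [← hx]; exact (abs_norm_sub_norm_le y x).trans h

/-- Close to a unit vector `x`, the differential of `y ↦ ‖y‖⁻¹` is close to `-x`. -/
theorem abs_inv_norm_sub_inv_norm_sub_inner_le {x y z : E3} (hx : ‖x‖ = 1)
    (hy : ‖y - x‖ ≤ 1 / 100) (hz : ‖z - x‖ ≤ 1 / 100) :
    |‖y‖⁻¹ - ‖z‖⁻¹ - inner ℝ (z - y) x| ≤ 1 / 6 * ‖z - y‖ := by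
  have h1 := abs_le.1 (abs_norm_sub_one_le hx hy)
  have h2 := abs_le.1 (abs_norm_sub_one_le hx hz)
  set r := ‖y‖
  set q := ‖z‖
  have hr : 99 / 100 ≤ r := by linarith
  have hq : 99 / 100 ≤ q := by linarith
  have hr' : r ≤ 101 / 100 := by linarith
  have hq' : q ≤ 101 / 100 := by linarith
  have hrq : (99 / 100 : ℝ) * (99 / 100) ≤ r * q := by gcongr
  have hrq' : r * q ≤ 101 / 100 * (101 / 100) := by gcongr
  have hD : (198 / 100 : ℝ) * (99 / 100 * (99 / 100)) ≤ (r + q) * (r * q) := by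
    gcongr; linarith
  have hD' : (r + q) * (r * q) ≤ 202 / 100 * (101 / 100 * (101 / 100)) := by
    gcongr; linarith
  have hDp : 0 < (r + q) * (r * q) := by nlinarith
  set c := ((r + q) * (r * q))⁻¹ with hc
  have hc0 : 0 < c := inv_pos.2 hDp
  have hcD : c * ((r + q) * (r * q)) = 1 := inv_mul_cancel₀ hDp.ne'
  have hcl : c ≤ 52 / 100 := by nlinarith
  have hcg : 48 / 100 ≤ c := by nlinarith
  have hin : inner ℝ (z - y) (y + z) = q ^ 2 - r ^ 2 := by
    rw [inner_sub_left, inner_add_right, inner_add_right, real_inner_self_eq_norm_sq,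
      real_inner_self_eq_norm_sq, real_inner_comm z y]
    ring
  -- Here r⁻¹ − q⁻¹ = (q² − r²) c = ⟨z − y, c(y + z)⟩ with c close to 1/2, so c(y + z) is close to
  -- x.
  have hkey : r⁻¹ - q⁻¹ - inner ℝ (z - y) x =
      inner ℝ (z - y) (c • ((y - x) + (z - x)) + (2 * c - 1) • x) := by
    have : c • ((y - x) + (z - x)) + (2 * c - 1) • x = c • (y + z) - x := by module
    rw [this, inner_sub_right, real_inner_smul_right, hin, hc]
    have : r ≠ 0 := by positivity
    have : q ≠ 0 := by positivity
    field_simp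
    ring
  rw [hkey, mul_comm (1 / 6 : ℝ)]
  refine (abs_real_inner_le_norm _ _).trans ?_
  gcongr
  have h3 : ‖c • ((y - x) + (z - x)) + (2 * c - 1) • x‖ ≤
      c * (1 / 100 + 1 / 100) + |2 * c - 1| * 1 := by
    refine (norm_add_le _ _).trans ?_
    rw [norm_smul, norm_smul, hx, Real.norm_eq_abs, Real.norm_eq_abs, abs_of_pos hc0]
    gcongr
    exact (norm_add_le _ _).trans (add_le_add hy hz)
  have h4 : |2 * c - 1| ≤ 4 / 100 := abs_le.2 ⟨by linarith, by linarith⟩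
  linarith

theorem norm_integral_sphere_le {g : S2 → E3} {C : ℝ} (hg : ∀ θ, ‖g θ‖ ≤ C) :
    ‖∫ θ, g θ ∂sphereMeasure‖ ≤ C * (4 * Real.pi) := by
  rw [← sphereMeasure_univ]
  exact norm_integral_le_of_norm_le_const (Filter.Eventually.of_forall hg)

theorem norm_coe_sphere (θ : S2) : ‖(θ : E3)‖ = 1 := by simp

/-- A surface close to the unit sphere has a centre, a point for which the reciprocal distance is
orthogonal to the linear functions. -/
theorem exists_center {X : S2 → E3} (hX : Continuous X) {δ : ℝ} (hδ : 0 ≤ δ)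
    (hδ' : 13 * δ ≤ 1 / 100) (hXδ : ∀ θ : S2, ‖X θ - θ‖ ≤ δ) :
    ∃ p : E3, ‖p‖ ≤ 12 * δ ∧
      ∀ a : E3, ∫ θ : S2, ‖X θ - p‖⁻¹ * inner ℝ a (θ : E3) ∂sphereMeasure = 0 := by
  have hπ := Real.pi_pos
  set c : ℝ := 3 / (4 * Real.pi) with hc
  have hcp : 0 < c := by positivity
  have hclose : ∀ p : E3, ‖p‖ ≤ 12 * δ → ∀ θ : S2, ‖X θ - p - θ‖ ≤ 1 / 100 := fun p hp θ => by
    have : X θ - p - θ = (X θ - θ) - p := by abel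
    rw [this]
    exact (norm_sub_le _ _).trans (by linarith [hXδ θ])
  have hne : ∀ p : E3, ‖p‖ ≤ 12 * δ → ∀ θ : S2, ‖X θ - p‖ ≠ 0 := fun p hp θ => by
    have := abs_le.1 (abs_norm_sub_one_le (norm_coe_sphere θ) (hclose p hp θ))
    linarith
  have hcont : ∀ p : E3, ‖p‖ ≤ 12 * δ → Continuous fun θ : S2 => ‖X θ - p‖⁻¹ := fun p hp =>
    (hX.sub continuous_const).norm.inv₀ (hne p hp)
  have hint : ∀ p : E3, ‖p‖ ≤ 12 * δ →
      Integrable (fun θ : S2 => ‖X θ - p‖⁻¹ • (θ : E3)) sphereMeasure := fun p hp =>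
    integrable_sphere_vector ((hcont p hp).smul continuous_subtype_val)
  have hint' : ∀ a : E3, Integrable (fun θ : S2 => (inner ℝ a (θ : E3) : ℝ) • (θ : E3))
      sphereMeasure := fun a =>
    integrable_sphere_vector (by fun_prop)
  -- A simplified Newton map. For the round sphere the integral has derivative 4π/3 times the
  -- identity at p = 0, and c = 3/(4π) is the inverse of that factor.
  set T : E3 → E3 := fun p => p - c • ∫ θ : S2, ‖X θ - p‖⁻¹ • (θ : E3) ∂sphereMeasure with hT
  have hlip : ∀ p q : E3, ‖p‖ ≤ 12 * δ → ‖q‖ ≤ 12 * δ → ‖T p - T q‖ ≤ 1 / 2 * ‖p - q‖ := by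
    intro p q hp hq
    have h1 : T p - T q = (-c) • ∫ θ : S2, ((‖X θ - p‖⁻¹ - ‖X θ - q‖⁻¹ -
        inner ℝ (p - q) (θ : E3)) • (θ : E3)) ∂sphereMeasure := by
      simp_rw [sub_smul]
      rw [integral_sub, integral_sub (hint p hp) (hint q hq), integral_inner_smul_sphere]
      · have h2 : p - q = c • (4 * Real.pi / 3) • (p - q) := by
          rw [smul_smul, hc, div_mul_div_comm, mul_comm (3 : ℝ), div_self (by positivity), one_smul]
        rw [smul_sub, neg_smul c ((4 * Real.pi / 3) • (p - q)), ← h2]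
        simp only [hT]
        module
      · exact (hint p hp).sub (hint q hq)
      · exact hint' _
    rw [h1, norm_smul, norm_neg, Real.norm_eq_abs, abs_of_pos hcp]
    -- The error factor 1/6, multiplied by the mass 4π and by c, is the contraction constant 1/2.
    have h3 : ∀ θ : S2, ‖(‖X θ - p‖⁻¹ - ‖X θ - q‖⁻¹ - inner ℝ (p - q) (θ : E3)) • (θ : E3)‖ ≤
        1 / 6 * ‖p - q‖ := fun θ => by
      have := abs_inv_norm_sub_inv_norm_sub_inner_le (norm_coe_sphere θ) (hclose p hp θ)
        (hclose q hq θ)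
      rw [sub_sub_sub_cancel_left] at this
      rwa [norm_smul, norm_coe_sphere, mul_one, Real.norm_eq_abs]
    calc c * _ ≤ c * (1 / 6 * ‖p - q‖ * (4 * Real.pi)) := by
          gcongr; exact norm_integral_sphere_le h3
      _ = 1 / 2 * ‖p - q‖ := by rw [hc]; field_simp; ring
  have hT0 : ‖T 0‖ ≤ 6 * δ := by
    have h1 : T 0 = (-c) • ∫ θ : S2, (‖X θ‖⁻¹ - 1) • (θ : E3) ∂sphereMeasure := by
      have h0 := hint 0 (by simpa using by positivity)
      simp only [sub_zero] at h0
      simp_rw [sub_smul, one_smul]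
      rw [integral_sub h0 (integrable_sphere_vector continuous_subtype_val), integral_coe_sphere]
      simp [hT]
    rw [h1, norm_smul, norm_neg, Real.norm_eq_abs, abs_of_pos hcp]
    have h3 : ∀ θ : S2, ‖(‖X θ‖⁻¹ - 1) • (θ : E3)‖ ≤ 2 * δ := fun θ => by
      have h4 := abs_norm_sub_one_le (norm_coe_sphere θ) (hXδ θ)
      have h5 : 1 / 2 ≤ ‖X θ‖ := by linarith [(abs_le.1 h4).1]
      have h6 : ‖X θ‖⁻¹ - 1 = -(‖X θ‖ - 1) / ‖X θ‖ := by
        have : ‖X θ‖ ≠ 0 := by positivity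
        field_simp; ring
      rw [norm_smul, norm_coe_sphere, mul_one, Real.norm_eq_abs, h6, abs_div, abs_neg, abs_norm,
        div_le_iff₀ (by linarith)]
      nlinarith
    calc c * _ ≤ c * (2 * δ * (4 * Real.pi)) := by
          gcongr; exact norm_integral_sphere_le h3
      _ = 6 * δ := by rw [hc]; field_simp; ring
  -- With contraction constant 1/2 and |T 0| ≤ 6δ, the radius 12δ is the smallest for which this
  -- estimate keeps the ball invariant.
  have hmaps : Set.MapsTo T (closedBall 0 (12 * δ)) (closedBall 0 (12 * δ)) := fun p hp => by
    rw [mem_closedBall_zero_iff] at hp ⊢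
    have h1 := hlip p 0 hp (by simpa using by positivity)
    rw [sub_zero] at h1
    calc ‖T p‖ = ‖(T p - T 0) + T 0‖ := by rw [sub_add_cancel]
      _ ≤ ‖T p - T 0‖ + ‖T 0‖ := norm_add_le _ _
      _ ≤ 12 * δ := by linarith
  have hcontr : ContractingWith (1 / 2) (hmaps.restrict T _ _) := by
    refine ⟨by rw [← NNReal.coe_lt_coe]; norm_num, LipschitzWith.of_dist_le_mul fun p q => ?_⟩
    rw [Subtype.dist_eq, Subtype.dist_eq, dist_eq_norm, dist_eq_norm]
    simpa using hlip p q (mem_closedBall_zero_iff.1 p.2) (mem_closedBall_zero_iff.1 q.2)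
  obtain ⟨p, hp, hfix, -⟩ := hcontr.exists_fixedPoint' isClosed_closedBall.isComplete hmaps
    (mem_closedBall_self (by positivity)) (edist_ne_top _ _)
  rw [mem_closedBall_zero_iff] at hp
  refine ⟨p, hp, fun a => ?_⟩
  have h1 : ∫ θ : S2, ‖X θ - p‖⁻¹ • (θ : E3) ∂sphereMeasure = 0 := by
    have h2 : T p = p := hfix
    have h3 : c • ∫ θ : S2, ‖X θ - p‖⁻¹ • (θ : E3) ∂sphereMeasure = 0 := sub_eq_self.1 h2
    exact (smul_eq_zero.1 h3).resolve_left hcp.ne'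
  have h2 := integral_inner (𝕜 := ℝ) (hint p hp) a
  rw [h1, inner_zero_right] at h2
  simpa only [real_inner_smul_right] using h2

/-! ### Radial graphs close to the sphere -/

theorem abs_le_and_norm_sphereGradient_le {f : S2 → ℝ} (hF : ContDiffOn ℝ 2 (rayExt f) {0}ᶜ)
    {δ : ℝ} (h : c1Norm f < δ) (θ : S2) : |f θ| ≤ δ ∧ ‖sphereGradient f θ‖ ≤ δ := by
  have h1 : Continuous fun θ : S2 => |f θ| := by
    have := continuous_restrict_sphere hF.continuousOn
    simp only [rayExt_coe] at this
    exact this.abs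
  have h2 : Continuous fun θ : S2 => ‖sphereGradient f θ‖ :=
    (continuous_restrict_sphere (contDiffOn_gradient hF).continuousOn).norm
  have h3 := le_ciSup (isCompact_range h1).bddAbove θ
  have h4 := le_ciSup (isCompact_range h2).bddAbove θ
  have h5 : 0 ≤ |f θ| := abs_nonneg _
  have h6 : 0 ≤ ‖sphereGradient f θ‖ := norm_nonneg _
  rw [c1Norm] at h
  constructor <;> linarith

theorem norm_inv_norm_smul_sub_le {x y : E3} (hx : ‖x‖ = 1) (hy : y ≠ 0) :
    ‖‖y‖⁻¹ • y - x‖ ≤ 2 * ‖y - x‖ := by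
  have hn : ‖y‖ ≠ 0 := norm_ne_zero_iff.2 hy
  have h1 : ‖y‖⁻¹ • y - x = (‖y‖⁻¹ - 1) • y + (y - x) := by module
  have h2 : ‖(‖y‖⁻¹ - 1) • y‖ ≤ ‖y - x‖ := by
    have : ‖(‖y‖⁻¹ - 1) • y‖ = |‖y‖ - 1| := by
      rw [norm_smul, Real.norm_eq_abs, ← abs_norm y, ← abs_mul, abs_norm, sub_mul,
        inv_mul_cancel₀ hn, one_mul, abs_sub_comm]
    rw [this]
    exact abs_norm_sub_one_le hx le_rfl
  rw [h1]
  exact (norm_add_le _ _).trans (by linarith)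

theorem exists_coe_eq {x : E3} (hx : x ≠ 0) : ∃ θ : S2, normalize id x = θ ∧
    ∀ u : S2 → E3, rayExt u x = u θ := by
  refine ⟨⟨‖x‖⁻¹ • x, ?_⟩, rfl, fun u => ?_⟩
  · rw [mem_sphere_zero_iff_norm]; exact norm_normalize (Y := id) hx
  · rw [rayExt, dif_neg hx]

theorem inner_eq_one_sub {x y : E3} (hx : ‖x‖ = 1) (hy : ‖y‖ = 1) :
    inner ℝ x y = 1 - ‖x - y‖ ^ 2 / 2 := by
  rw [norm_sub_sq_real, hx, hy]; ring

section

variable {f : S2 → ℝ} {p : E3} {δ : ℝ}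

theorem norm_radialGraph_sub_le (hf : ∀ θ, |f θ| ≤ δ) (θ : S2) : ‖radialGraph f θ - θ‖ ≤ δ := by
  have : radialGraph f θ - θ = f θ • (θ : E3) := by rw [radialGraph]; module
  rw [this, norm_smul, norm_coe_sphere, mul_one]
  exact hf θ

theorem norm_radialGraph_sub_sub_le (hf : ∀ θ, |f θ| ≤ δ) (hp : ‖p‖ ≤ 12 * δ) (θ : S2) :
    ‖radialGraph f θ - p - θ‖ ≤ 13 * δ := by
  rw [sub_right_comm]
  exact (norm_sub_le _ _).trans (by linarith [norm_radialGraph_sub_le hf θ])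

theorem norm_polarNormal_sub_le (hf : ∀ θ, |f θ| ≤ δ) (hg : ∀ θ, ‖sphereGradient f θ‖ ≤ δ)
    (θ : S2) : ‖polarNormal f θ - θ‖ ≤ 2 * δ := by
  have : polarNormal f θ - θ = f θ • (θ : E3) - sphereGradient f θ := by
    rw [polarNormal_coe]; module
  rw [this]
  refine (norm_sub_le _ _).trans ?_
  rw [norm_smul, norm_coe_sphere, mul_one, Real.norm_eq_abs]
  linarith [hf θ, hg θ]

theorem abs_dist_radialGraph_sub_one_le (hf : ∀ θ, |f θ| ≤ δ) (hp : ‖p‖ ≤ 12 * δ) (θ : S2) :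
    |‖radialGraph f θ - p‖ - 1| ≤ 13 * δ :=
  abs_norm_sub_one_le (norm_coe_sphere θ) (norm_radialGraph_sub_sub_le hf hp θ)

theorem radialGraph_sub_ne_zero (hf : ∀ θ, |f θ| ≤ δ) (hp : ‖p‖ ≤ 12 * δ) (hδ : δ ≤ 1 / 2000)
    (θ : S2) : radialGraph f θ - p ≠ 0 := by
  have := abs_le.1 (abs_dist_radialGraph_sub_one_le hf hp θ)
  rw [← norm_pos_iff]; linarith

theorem rayExt_radialGraph_sub_ne_zero (hf : ∀ θ, |f θ| ≤ δ) (hp : ‖p‖ ≤ 12 * δ)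
    (hδ : δ ≤ 1 / 2000) (x : E3) (hx : x ≠ 0) : rayExt (radialGraph f) x - p ≠ 0 := by
  obtain ⟨θ, -, h⟩ := exists_coe_eq hx
  rw [h]; exact radialGraph_sub_ne_zero hf hp hδ θ

theorem norm_direction_sub_le (hf : ∀ θ, |f θ| ≤ δ) (hp : ‖p‖ ≤ 12 * δ) (hδ : δ ≤ 1 / 2000)
    (θ : S2) : ‖direction f p θ - θ‖ ≤ 26 * δ := by
  rw [direction, normalize, rayExt_coe]
  exact (norm_inv_norm_smul_sub_le (norm_coe_sphere θ) (radialGraph_sub_ne_zero hf hp hδ θ)).trans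
    (by linarith [norm_radialGraph_sub_sub_le hf hp θ])

theorem norm_direction (hf : ∀ θ, |f θ| ≤ δ) (hp : ‖p‖ ≤ 12 * δ) (hδ : δ ≤ 1 / 2000)
    (θ : S2) : ‖direction f p θ‖ = 1 :=
  norm_normalize (rayExt_radialGraph_sub_ne_zero hf hp hδ θ (ne_zero_of_mem_unit_sphere θ))

theorem one_add_inner_direction_pos (hf : ∀ θ, |f θ| ≤ δ) (hp : ‖p‖ ≤ 12 * δ)
    (hδ : δ ≤ 1 / 2000) (x : E3) (hx : x ≠ 0) :
    0 < 1 + (inner ℝ (normalize id x) (direction f p x) : ℝ) := by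
  obtain ⟨θ, h1, h2⟩ := exists_coe_eq hx
  have h3 : direction f p x = direction f p θ := by
    simp only [direction, normalize, h2, rayExt_coe]
  rw [h1, h3, real_inner_comm, inner_eq_one_sub (norm_direction hf hp hδ θ) (norm_coe_sphere θ)]
  have := norm_direction_sub_le hf hp hδ θ
  nlinarith [norm_nonneg (direction f p θ - θ)]

/-- The outer normal is almost the direction seen from a point close to the origin. -/
theorem angleCos_mem (hF : ContDiffOn ℝ 2 (rayExt f) {0}ᶜ) (hpos : ∀ θ, 0 < 1 + f θ)
    (hf : ∀ θ, |f θ| ≤ δ) (hg : ∀ θ, ‖sphereGradient f θ‖ ≤ δ) (hp : ‖p‖ ≤ 12 * δ)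
    (hδ : δ ≤ 1 / 2000) (θ : S2) :
    0 ≤ 1 - angleCos f p θ ∧ 1 - angleCos f p θ ≤ 450 * δ ^ 2 := by
  have hw := polarNormal_ne_zero hF hpos (ne_zero_of_mem_unit_sphere θ)
  have h1 : ‖outerNormal f θ‖ = 1 := norm_normalize hw
  have h2 : ‖outerNormal f θ - θ‖ ≤ 4 * δ :=
    (norm_inv_norm_smul_sub_le (norm_coe_sphere θ) hw).trans
      (by linarith [norm_polarNormal_sub_le hf hg θ])
  -- For unit vectors 1 − ⟨n, ν⟩ = |n − ν|²/2, so the first-order bound 30δ yields the quadratic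
  -- bound 450δ².
  have h3 : ‖direction f p θ - outerNormal f θ‖ ≤ 30 * δ := by
    have : direction f p θ - outerNormal f θ =
        (direction f p θ - θ) - (outerNormal f θ - θ) := by abel
    rw [this]
    exact (norm_sub_le _ _).trans (by linarith [norm_direction_sub_le hf hp hδ θ])
  have h4 := norm_nonneg (direction f p θ - outerNormal f θ)
  rw [angleCos, inner_eq_one_sub (norm_direction hf hp hδ θ) h1]
  constructor <;> nlinarith

theorem areaDensity_mem (hF : ContDiffOn ℝ 2 (rayExt f) {0}ᶜ) (hpos : ∀ θ, 0 < 1 + f θ)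
    (hf : ∀ θ, |f θ| ≤ δ) (hg : ∀ θ, ‖sphereGradient f θ‖ ≤ δ) (hδ : δ ≤ 1 / 2000) (θ : S2) :
    99 / 100 ≤ areaDensity (radialGraph f) θ ∧ areaDensity (radialGraph f) θ ≤ 101 / 100 := by
  have h1 := abs_le.1 (abs_norm_sub_one_le (norm_coe_sphere θ) (norm_polarNormal_sub_le hf hg θ))
  have h2 := abs_le.1 (hf θ)
  rw [areaDensity_radialGraph hF hpos]
  constructor <;> nlinarith

/-- The deviation from `1` of a multiple of the reciprocal distance to `p`. -/
def reciprocalDeviation (f : S2 → ℝ) (p : E3) (R : ℝ) (x : E3) : ℝ :=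
  1 - R * ‖rayExt (radialGraph f) x - p‖⁻¹

theorem contDiffOn_reciprocalDeviation (hF : ContDiffOn ℝ 2 (rayExt f) {0}ᶜ)
    (hp : ∀ x, x ≠ 0 → rayExt (radialGraph f) x - p ≠ 0) (R : ℝ) :
    ContDiffOn ℝ 1 (reciprocalDeviation f p R) {0}ᶜ := by
  have h1 : ContDiffOn ℝ 1 (fun x => rayExt (radialGraph f) x - p) {0}ᶜ :=
    ((contDiffOn_radial hF).of_le (by norm_num)).sub contDiffOn_const
  exact contDiffOn_const.sub (contDiffOn_const.mul
    ((h1.norm ℝ fun x hx => hp x hx).inv fun x hx => norm_ne_zero_iff.2 (hp x hx)))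

theorem fderiv_reciprocalDeviation (hF : ContDiffOn ℝ 2 (rayExt f) {0}ᶜ)
    (hp : ∀ x, x ≠ 0 → rayExt (radialGraph f) x - p ≠ 0) (R : ℝ) (θ : S2) (i : Fin 2) :
    fderiv ℝ (reciprocalDeviation f p R) θ (frame θ i) =
      R / ‖radialGraph f θ - p‖ ^ 2 *
        inner ℝ (direction f p θ) (tangentVec (radialGraph f) θ i) := by
  have hθ : (θ : E3) ≠ 0 := ne_zero_of_mem_unit_sphere θ
  have hX := (differentiableAt_of_contDiffOn
    ((contDiffOn_radial hF).of_le (by norm_num)) hθ).hasFDerivAt.sub_const p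
  have hn := norm_ne_zero_iff.2 (hp θ hθ)
  have h := (((hasDerivAt_inv hn).comp_hasFDerivAt (θ : E3)
    ((hasFDerivAt_norm (hp θ hθ)).comp (θ : E3) hX)).const_mul R).const_sub 1
  have h1 : HasFDerivAt (reciprocalDeviation f p R) _ (θ : E3) := h
  rw [h1.fderiv, direction, normalize, real_inner_smul_left, tangentVec]
  simp only [rayExt_coe] at hn ⊢
  simp
  field_simp
  rw [inner_sub_left]

/-- The squared length of the gradient of the deviation is controlled by the angle between the
direction and the normal. -/
theorem sum_sq_rotDeriv_reciprocalDeviation_le (hF : ContDiffOn ℝ 2 (rayExt f) {0}ᶜ)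
    (hpos : ∀ θ, 0 < 1 + f θ) (hp : ∀ x, x ≠ 0 → rayExt (radialGraph f) x - p ≠ 0)
    (R : ℝ) (θ : S2) :
    rotDeriv 1 2 (reciprocalDeviation f p R) θ * rotDeriv 1 2 (reciprocalDeviation f p R) θ +
      rotDeriv 2 0 (reciprocalDeviation f p R) θ * rotDeriv 2 0 (reciprocalDeviation f p R) θ +
      rotDeriv 0 1 (reciprocalDeviation f p R) θ * rotDeriv 0 1 (reciprocalDeviation f p R) θ ≤
      (R / ‖radialGraph f θ - p‖ ^ 2) ^ 2 * ((1 - angleCos f p θ ^ 2) *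
        (2 * (1 + f θ) ^ 2 + ‖sphereGradient f θ‖ ^ 2)) := by
  have hθ : (θ : E3) ≠ 0 := ne_zero_of_mem_unit_sphere θ
  obtain ⟨s, h⟩ := exists_isFrame θ
  simp only [rotDeriv]
  rw [h.sum_sq_rotField, fderiv_reciprocalDeviation hF hp, fderiv_reciprocalDeviation hF hp,
    mul_pow, mul_pow, ← mul_add]
  gcongr
  -- The part of n tangent to the surface; only it pairs with the tangent vectors, and its squared
  -- length is 1 − σ².
  set v := direction f p θ - angleCos f p θ • outerNormal f θ with hv
  have hvn : ‖v‖ ^ 2 = 1 - angleCos f p θ ^ 2 := by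
    have h1 := inner_normalize_self (hp θ hθ)
    change inner ℝ (direction f p θ) (direction f p θ) = (1 : ℝ) at h1
    have h2 := inner_outerNormal_self hF hpos hθ
    have h3 : inner ℝ (direction f p θ) (outerNormal f θ) = angleCos f p θ := rfl
    rw [← real_inner_self_eq_norm_sq, hv, inner_sub_left, inner_sub_right, inner_sub_right,
      real_inner_smul_left, real_inner_smul_right, real_inner_smul_right, real_inner_smul_left,
      h1, h2, h3, real_inner_comm, h3]
    ring
  have hin : ∀ i, inner ℝ (direction f p θ) (tangentVec (radialGraph f) θ i) =
      (inner ℝ v (tangentVec (radialGraph f) θ i) : ℝ) := fun i => by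
    rw [hv, inner_sub_left, real_inner_smul_left, tangentVec, inner_outerNormal_fderiv hF hθ,
      mul_zero, sub_zero]
  -- Cauchy–Schwarz is applied to each tangent vector separately. This loses a factor of about 2,
  -- which the constant 6 in the Poincaré inequality can afford.
  have hsq : ∀ w : E3, (inner ℝ v w : ℝ) ^ 2 ≤ ‖v‖ ^ 2 * inner ℝ w w := fun w => by
    rw [real_inner_self_eq_norm_sq, ← mul_pow, ← sq_abs]
    gcongr
    exact abs_real_inner_le_norm v w
  have hG : ‖sphereGradient f θ‖ ^ 2 = inner ℝ (sphereGradient f θ) (frame θ 0) ^ 2 +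
      (inner ℝ (sphereGradient f θ) (frame θ 1) : ℝ) ^ 2 := by
    have h1 := h.inner_eq_sum (sphereGradient f θ) (sphereGradient f θ)
    rw [real_inner_self_eq_norm_sq, real_inner_comm (θ : E3),
      inner_self_sphereGradient hF] at h1
    rw [h1]; ring
  have hT0 : inner ℝ (tangentVec (radialGraph f) θ 0) (tangentVec (radialGraph f) θ 0) =
      inner ℝ (sphereGradient f θ) (frame θ 0) ^ 2 + (1 + f θ) ^ 2 := by
    have h10 := h.inner_one_self
    rw [tangentVec_eq hF θ h10]
    simp only [inner_add_left, inner_add_right, real_inner_smul_left, real_inner_smul_right,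
      h.inner_self, h.inner_one, h10, real_inner_comm (frame θ 0) (θ : E3)]
    ring
  have hT1 : inner ℝ (tangentVec (radialGraph f) θ 1) (tangentVec (radialGraph f) θ 1) =
      inner ℝ (sphereGradient f θ) (frame θ 1) ^ 2 + (1 + f θ) ^ 2 := by
    have h10 := h.inner_two_self
    rw [tangentVec_eq hF θ h10]
    simp only [inner_add_left, inner_add_right, real_inner_smul_left, real_inner_smul_right,
      h.inner_self, h.inner_two, h10, real_inner_comm (frame θ 1) (θ : E3)]
    ring
  rw [hin, hin, ← hvn, hG]
  have h0 := hsq (tangentVec (radialGraph f) θ 0)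
  have h1 := hsq (tangentVec (radialGraph f) θ 1)
  rw [hT0] at h0
  rw [hT1] at h1
  linarith

end

/-! ### The Minkowski inequality -/

/-- Integration over the sphere as a linear functional. -/
def sphereIntegral : C(S2, ℝ) →ₗ[ℝ] ℝ where
  toFun g := ∫ θ, g θ ∂sphereMeasure
  map_add' g k := integral_add (integrable_sphere g.continuous) (integrable_sphere k.continuous)
  map_smul' c g := integral_const_mul c g

theorem sphereIntegral_apply (g : C(S2, ℝ)) : sphereIntegral g = ∫ θ, g θ ∂sphereMeasure := rfl

theorem sphereIntegral_nonneg {g : C(S2, ℝ)} (hg : ∀ θ, 0 ≤ g θ) : 0 ≤ sphereIntegral g :=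
  integral_nonneg hg

/-- The pointwise core of the argument. G stands for |∇m|²; the terms with 101/100 and 17/100 encode
the Poincaré inequality, as 6 · 17/100 exceeds 101/100. -/
theorem minkowski_integrand_nonneg {H J ρ σ R η G : ℝ} (hρ : 0 < ρ) (hR : 0 < R) (hη : 0 < η)
    (hJ : 99 / 100 ≤ J) (hJ' : J ≤ 101 / 100) (hσ : 0 ≤ 1 - σ) (hση : R ^ 2 * (1 - σ) ≤ η)
    (hG : G ≤ 21 / 5 * (1 - σ)) :
    0 ≤ R * (H * J) - R * (H * σ * J) + R * ((1 + σ ^ 2) * J / ρ) - J - R ^ 2 * (σ * J / ρ ^ 2) +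
      η * (H ^ 2 * J) - η * (4 / R) * (H * J) + η * (4 / R ^ 2) * J +
      101 / 100 * ((1 - R * ρ⁻¹) * (1 - R * ρ⁻¹)) - 17 / 100 * G := by
  obtain ⟨τ, rfl⟩ : ∃ τ, σ = 1 - τ := ⟨1 - σ, by ring⟩
  obtain ⟨h, rfl⟩ : ∃ h, H = h + 2 / R := ⟨H - 2 / R, by ring⟩
  obtain ⟨x, hx⟩ : ∃ x, x = R * ρ⁻¹ := ⟨_, rfl⟩
  rw [sub_sub_cancel] at hσ hση hG
  have hx0 : 0 < x := hx ▸ mul_pos hR (inv_pos.2 hρ)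
  -- A quadratic in h with discriminant R²τ² − ητ, which is nonpositive since R²τ ≤ η.
  have hq : 0 ≤ η * h ^ 2 + R * h * τ + τ / 4 := by
    have h1 : 0 ≤ 4 * η * (η * h ^ 2 + R * h * τ + τ / 4) := by
      nlinarith [sq_nonneg (2 * η * h + R * τ), mul_nonneg hσ (sub_nonneg.2 hση)]
    exact nonneg_of_mul_nonneg_right h1 (by positivity)
  have key : R * ((h + 2 / R) * J) - R * ((h + 2 / R) * (1 - τ) * J) +
      R * ((1 + (1 - τ) ^ 2) * J / ρ) - J - R ^ 2 * ((1 - τ) * J / ρ ^ 2) +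
      η * ((h + 2 / R) ^ 2 * J) - η * (4 / R) * ((h + 2 / R) * J) + η * (4 / R ^ 2) * J =
      J * (η * h ^ 2 + R * h * τ + τ / 4) + J * (τ * ((1 - x) ^ 2 + τ * x)) +
        J * (3 / 4 * τ) - J * (1 - x) ^ 2 := by
    rw [hx]; field_simp; ring
  rw [key, ← hx]
  have hJ0 : 0 ≤ J := by linarith
  have h1 : 0 ≤ J * (η * h ^ 2 + R * h * τ + τ / 4) := mul_nonneg hJ0 hq
  have h2 : 0 ≤ J * (τ * ((1 - x) ^ 2 + τ * x)) := by positivity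
  have h3 : 0 ≤ (101 / 100 - J) * (1 - x) ^ 2 := mul_nonneg (by linarith) (sq_nonneg _)
  have h4 : 0 ≤ (J - 99 / 100) * τ := mul_nonneg (by linarith) hσ
  -- What remains is 99/100 · 3/4 = 0.7425 against 17/100 · 21/5 = 0.714, as coefficients of τ.
  nlinarith

section

variable {f : S2 → ℝ} {p : E3} {δ R : ℝ}

/-- The squared length of the spherical gradient. -/
def gradSq (φ : E3 → ℝ) (x : E3) : ℝ :=
  rotDeriv 1 2 φ x * rotDeriv 1 2 φ x + rotDeriv 2 0 φ x * rotDeriv 2 0 φ x +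
    rotDeriv 0 1 φ x * rotDeriv 0 1 φ x

theorem continuous_gradSq {φ : E3 → ℝ} (hφ : ContDiffOn ℝ 1 φ {0}ᶜ) :
    Continuous fun θ : S2 => gradSq φ θ := by
  have h := fun j k => continuous_restrict_sphere (continuousOn_rotDeriv hφ j k)
  exact (((h 1 2).mul (h 1 2)).add ((h 2 0).mul (h 2 0))).add ((h 0 1).mul (h 0 1))

theorem dirichletForm_self (φ : puncturedC1) :
    dirichletForm φ φ = ∫ θ : S2, gradSq φ θ ∂sphereMeasure := by
  have h := fun j k => continuous_restrict_sphere (continuousOn_rotDeriv φ.2 j k)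
  have hi := fun j k => integrable_sphere ((h j k).mul (h j k))
  exact ((integral_add ((hi 1 2).add (hi 2 0)) (hi 0 1)).trans
    (congrArg (· + _) (integral_add (hi 1 2) (hi 2 0)))).symm

/-- In the limit δ → 0 the bound is 4τ: a factor 2 from 1 − σ² ≤ 2τ and a factor 2 from the two
tangent directions. The constant 21/5 leaves room for the errors of order δ. -/
theorem gradSq_reciprocalDeviation_le (hF : ContDiffOn ℝ 2 (rayExt f) {0}ᶜ)
    (hpos : ∀ θ, 0 < 1 + f θ) (hf : ∀ θ, |f θ| ≤ δ) (hg : ∀ θ, ‖sphereGradient f θ‖ ≤ δ)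
    (hp : ‖p‖ ≤ 12 * δ) (hδ : δ ≤ 1 / 2000) (hR : |R - 1| ≤ 13 * δ) (θ : S2) :
    gradSq (reciprocalDeviation f p R) θ ≤ 21 / 5 * (1 - angleCos f p θ) := by
  refine (sum_sq_rotDeriv_reciprocalDeviation_le hF hpos
    (rayExt_radialGraph_sub_ne_zero hf hp hδ) R θ).trans ?_
  have hρ := abs_le.1 (abs_dist_radialGraph_sub_one_le hf hp θ)
  obtain ⟨hτ, hτ'⟩ := angleCos_mem hF hpos hf hg hp hδ θ
  set ρ := ‖radialGraph f θ - p‖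
  set σ := angleCos f p θ
  have hR' := abs_le.1 hR
  have hfθ := abs_le.1 (hf θ)
  have h1 : 0 ≤ R / ρ ^ 2 := div_nonneg (by linarith) (sq_nonneg _)
  have h2 : R / ρ ^ 2 ≤ 1021 / 1000 := by
    rw [div_le_iff₀ (by nlinarith)]; nlinarith
  have h3 : 2 * (1 + f θ) ^ 2 + ‖sphereGradient f θ‖ ^ 2 ≤ 2003 / 1000 := by
    have := hg θ
    have := norm_nonneg (sphereGradient f θ)
    nlinarith
  have h4 : 1 - σ ^ 2 ≤ 2 * (1 - σ) := by nlinarith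
  have h6 : 0 ≤ 1 - σ ^ 2 := by
    have : 0 ≤ 1 + σ := by nlinarith [norm_nonneg p]
    nlinarith
  have h5 : (R / ρ ^ 2) ^ 2 ≤ (1021 / 1000) ^ 2 := by gcongr
  calc (R / ρ ^ 2) ^ 2 * ((1 - σ ^ 2) * (2 * (1 + f θ) ^ 2 + ‖sphereGradient f θ‖ ^ 2))
      ≤ (1021 / 1000) ^ 2 * ((2 * (1 - σ)) * (2003 / 1000)) := by
        gcongr
    _ ≤ 21 / 5 * (1 - σ) := by nlinarith

/-- The condition on p makes the deviation orthogonal to linear functions and the condition on R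
makes its mean zero, so the Poincaré inequality applies with constant 6. -/
theorem sphereForm_le_of_center (hF : ContDiffOn ℝ 2 (rayExt f) {0}ᶜ)
    (hp : ∀ x, x ≠ 0 → rayExt (radialGraph f) x - p ≠ 0)
    (hc : ∀ a : E3, ∫ θ : S2, ‖radialGraph f θ - p‖⁻¹ * inner ℝ a (θ : E3) ∂sphereMeasure = 0)
    (hR : R * ∫ θ : S2, ‖radialGraph f θ - p‖⁻¹ ∂sphereMeasure = 4 * Real.pi) :
    6 * ∫ θ : S2, (1 - R * ‖radialGraph f θ - p‖⁻¹) * (1 - R * ‖radialGraph f θ - p‖⁻¹)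
      ∂sphereMeasure ≤ ∫ θ : S2, gradSq (reciprocalDeviation f p R) θ ∂sphereMeasure := by
  let m : puncturedC1 := ⟨reciprocalDeviation f p R, contDiffOn_reciprocalDeviation hF hp R⟩
  have hm : ∀ θ : S2, (m : E3 → ℝ) θ = 1 - R * ‖radialGraph f θ - p‖⁻¹ := fun θ => by
    change reciprocalDeviation f p R θ = _
    rw [reciprocalDeviation, rayExt_coe]
  have hcont : Continuous fun θ : S2 => ‖radialGraph f θ - p‖⁻¹ :=
    (continuous_dist_radialGraph hF p).inv₀ (dist_radialGraph_ne_zero hp)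
  have hb : IsBalanced m := by
    constructor
    · simp only [sphereForm_apply, linPow_apply, pow_zero, mul_one, hm]
      rw [integral_sub (integrable_const _) ((integrable_sphere hcont).const_mul R),
        integral_const_mul, hR, integral_const, sphereMeasure_univ]
      simp
    · intro a
      have hi : Continuous fun θ : S2 => (inner ℝ a (θ : E3) : ℝ) := by fun_prop
      have hi' : Integrable (fun θ : S2 => ‖radialGraph f θ - p‖⁻¹ * inner ℝ a (θ : E3))
        sphereMeasure := integrable_sphere (hcont.mul hi)
      simp only [sphereForm_apply, linPow_apply, pow_one, hm, sub_mul, one_mul, mul_assoc]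
      rw [integral_sub (integrable_sphere hi) (hi'.const_mul R),
        integral_const_mul, hc, integral_inner_sphere]
      simp
  have h := six_mul_sphereForm_le hb
  rw [dirichletForm_self, sphereForm_apply] at h
  simpa only [hm] using h

theorem exists_radius (hF : ContDiffOn ℝ 2 (rayExt f) {0}ᶜ) (hf : ∀ θ, |f θ| ≤ δ)
    (hp : ‖p‖ ≤ 12 * δ) (hδ : δ ≤ 1 / 2000) : ∃ R : ℝ, |R - 1| ≤ 13 * δ ∧
      R * ∫ θ : S2, ‖radialGraph f θ - p‖⁻¹ ∂sphereMeasure = 4 * Real.pi := by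
  have hπ := Real.pi_pos
  have hp' := rayExt_radialGraph_sub_ne_zero hf hp hδ
  have hint := integrable_sphere
    ((continuous_dist_radialGraph hF p).inv₀ (dist_radialGraph_ne_zero hp'))
  have hρ := fun θ => abs_le.1 (abs_dist_radialGraph_sub_one_le hf hp θ)
  have hc : ∀ c : ℝ, ∫ _ : S2, c ∂sphereMeasure = c * (4 * Real.pi) := fun c => by
    rw [integral_const, sphereMeasure_univ, smul_eq_mul, mul_comm]
  set I := ∫ θ : S2, ‖radialGraph f θ - p‖⁻¹ ∂sphereMeasure with hI
  have h1 : (1 + 13 * δ)⁻¹ * (4 * Real.pi) ≤ I := by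
    rw [← hc]
    refine integral_mono (integrable_const _) hint fun θ => ?_
    exact inv_anti₀ (by linarith [hρ θ]) (by linarith [hρ θ])
  have h2 : I ≤ (1 - 13 * δ)⁻¹ * (4 * Real.pi) := by
    rw [← hc]
    refine integral_mono hint (integrable_const _) fun θ => ?_
    exact inv_anti₀ (by linarith [hρ θ]) (by linarith [hρ θ])
  have hδ0 : 0 ≤ δ := by linarith [norm_nonneg p]
  have hI0 : 0 < I := lt_of_lt_of_le (by positivity) h1
  refine ⟨4 * Real.pi / I, ?_, by field_simp⟩
  rw [inv_mul_le_iff₀ (by linarith)] at h1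
  have h3 : 0 < 1 - 13 * δ := by linarith
  rw [← mul_inv_le_iff₀' (by positivity), inv_inv] at h2
  rw [abs_le]
  constructor
  · rw [neg_le_sub_iff_le_add, ← sub_le_iff_le_add, le_div_iff₀ hI0]; linarith
  · rw [sub_le_iff_le_add, div_le_iff₀ hI0]; linarith

end

/-- Here F is the deficit ∫ H − A/R − 4πR, E is ∫ |h̊|², and 2E − 4F/R is ∫ (H − 2/R)². If F < 0,
the term with F/R weakens the coefficient of F only slightly, so F is bounded below by −4ηE. -/
theorem add_mul_nonneg_of_deficit {F E R η ε : ℝ} (hR : 99 / 100 ≤ R)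
    (hη : 0 < η) (hη' : η ≤ 1 / 16) (hε : 4 * η ≤ ε)
    (h : 0 ≤ R * F + η * (2 * E - 4 * F / R)) (hE : 0 ≤ 2 * E - 4 * F / R) :
    0 ≤ F + ε * E := by
  have hR0 : 0 < R := by linarith
  obtain ⟨y, rfl⟩ : ∃ y, F = R * y := ⟨F / R, by field_simp⟩
  have h0 : 4 * (R * y) / R = 4 * y := by field_simp
  rw [h0] at h hE
  rcases le_or_gt 0 y with hy | hy
  · have : 0 ≤ E := by linarith
    have : 0 ≤ ε := by linarith
    positivity
  · have h1 : R / 2 ≤ R * R - 4 * η := by nlinarith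
    have h2 : (R * R - 4 * η) * y ≤ R / 2 * y := mul_le_mul_of_nonpos_right h1 hy.le
    have h3 : 0 ≤ R / 2 * y + 2 * η * E := by linarith
    have h4 : 0 ≤ E := by
      by_contra hneg
      have := mul_pos hη (neg_pos.2 (not_le.1 hneg))
      have := mul_pos_of_neg_of_neg hy (neg_neg_of_pos hR0)
      nlinarith
    nlinarith [mul_le_mul_of_nonneg_right hε h4]

/-- The arithmetic–geometric mean inequality for A/R and 4πR. -/
theorem sqrt_le_add {A R : ℝ} (hA : 0 ≤ A) (hR : 0 < R) :
    √(16 * Real.pi * A) ≤ A / R + 4 * Real.pi * R := by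
  have hπ := Real.pi_pos
  rw [Real.sqrt_le_left (by positivity)]
  have h1 : (A / R + 4 * Real.pi * R) ^ 2 =
      (A / R - 4 * Real.pi * R) ^ 2 + 16 * Real.pi * A := by field_simp; ring
  rw [h1]
  exact le_add_of_nonneg_left (sq_nonneg _)

/-- The Minkowski inequality for a radial graph close to the sphere, with explicit constants. -/
theorem sqrt_area_le {f : S2 → ℝ} {δ η ε : ℝ} (hF : ContDiffOn ℝ 2 (rayExt f) {0}ᶜ)
    (hf : ∀ θ, |f θ| ≤ δ) (hg : ∀ θ, ‖sphereGradient f θ‖ ≤ δ) (hδ0 : 0 < δ) (hδ : δ ≤ 1 / 2000)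
    (hδη : δ ≤ η) (hη : η ≤ 1 / 16) (hε : 4 * η ≤ ε) :
    √(16 * Real.pi * area (radialGraph f)) ≤
      surfaceIntegral (radialGraph f) (meanCurvature (radialGraph f)) +
        ε * surfaceIntegral (radialGraph f) (normSqTraceFree (radialGraph f)) := by
  have hpos : ∀ θ, 0 < 1 + f θ := fun θ => by linarith [(abs_le.1 (hf θ)).1]
  have hη0 : 0 < η := by linarith
  have hcX : Continuous (radialGraph f) := by
    have := continuous_restrict_sphere (contDiffOn_radial hF).continuousOn
    simpa only [rayExt_coe] using this
  obtain ⟨p, hp, hcen⟩ := exists_center hcX hδ0.le (by linarith) (norm_radialGraph_sub_le hf)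
  have hp' := rayExt_radialGraph_sub_ne_zero hf hp hδ
  have hdir := one_add_inner_direction_pos hf hp hδ
  obtain ⟨R, hR1, hR⟩ := exists_radius hF hf hp hδ
  have hR' := abs_le.1 hR1
  have hR0 : 0 < R := by linarith
  have hcH := continuous_meanCurvature hF hpos
  have hcJ := continuous_areaDensity hF hpos
  have hcσ := continuous_angleCos hF hpos hp'
  have hcρ := continuous_dist_radialGraph hF p
  have hρ0 := dist_radialGraph_ne_zero hp'
  obtain ⟨K, hcK, hK, hKN⟩ := exists_gaussCurvature hF hpos
  have hcm : Continuous fun θ : S2 => 1 - R * ‖radialGraph f θ - p‖⁻¹ :=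
    continuous_const.sub (continuous_const.mul (hcρ.inv₀ hρ0))
  let gH : C(S2, ℝ) := ⟨_, hcH.mul hcJ⟩
  let gJ : C(S2, ℝ) := ⟨_, hcJ⟩
  let gQ : C(S2, ℝ) := ⟨_, (hcH.pow 2).mul hcJ⟩
  let gb : C(S2, ℝ) := ⟨_, (hcH.mul hcσ).mul hcJ⟩
  let gc : C(S2, ℝ) := ⟨_, (((continuous_const (y := (1 : ℝ))).add (hcσ.pow 2)).mul hcJ).div hcρ hρ0⟩
  let gd : C(S2, ℝ) := ⟨_, (hcσ.mul hcJ).div (hcρ.pow 2) fun θ => pow_ne_zero 2 (hρ0 θ)⟩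
  let gm : C(S2, ℝ) := ⟨_, hcm.mul hcm⟩
  let gG : C(S2, ℝ) := ⟨_, continuous_gradSq (contDiffOn_reciprocalDeviation hF hp' R)⟩
  let gK : C(S2, ℝ) := ⟨K, hcK⟩
  -- After integration `gb` and `gc` cancel by the divergence theorem, `gd` contributes the solid
  -- angle 4π, and the terms with `gm` and `gG` have a nonpositive sum. What is left says that R
  -- times the deficit plus η ∫ (H − 2/R)² is nonnegative.
  have hmain : 0 ≤ sphereIntegral (R • gH - R • gb + R • gc - gJ - R ^ 2 • gd + η • gQ -
      (η * (4 / R)) • gH + (η * (4 / R ^ 2)) • gJ + (101 / 100 : ℝ) • gm -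
      (17 / 100 : ℝ) • gG) := by
    refine sphereIntegral_nonneg fun θ => ?_
    obtain ⟨hJ, hJ'⟩ := areaDensity_mem hF hpos hf hg hδ θ
    obtain ⟨hσ, hσ'⟩ := angleCos_mem hF hpos hf hg hp hδ θ
    have hR2 : R ^ 2 ≤ 2 := by nlinarith
    refine minkowski_integrand_nonneg ((norm_nonneg _).lt_of_ne' (hρ0 θ)) hR0 hη0 hJ hJ' hσ ?_
      (gradSq_reciprocalDeviation_le hF hpos hf hg hp hδ hR1 θ)
    -- The bound 900δ² ≤ η uses both δ ≤ 1/2000 and δ ≤ η.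
    calc R ^ 2 * (1 - angleCos f p θ) ≤ 2 * (450 * δ ^ 2) := by gcongr
      _ ≤ η := by nlinarith
  have hsq : 0 ≤ sphereIntegral (gQ - (4 / R) • gH + (4 / R ^ 2) • gJ) := by
    refine sphereIntegral_nonneg fun θ => ?_
    have h1 : (gQ - (4 / R) • gH + (4 / R ^ 2) • gJ) θ =
        (meanCurvature (radialGraph f) θ - 2 / R) ^ 2 * areaDensity (radialGraph f) θ := by
      change meanCurvature (radialGraph f) θ ^ 2 * areaDensity (radialGraph f) θ -
        4 / R * (meanCurvature (radialGraph f) θ * areaDensity (radialGraph f) θ) +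
        4 / R ^ 2 * areaDensity (radialGraph f) θ = _
      field_simp
      ring
    rw [h1]
    exact mul_nonneg (sq_nonneg _) (areaDensity_pos hF hpos θ).le
  have hbc : sphereIntegral gb = sphereIntegral gc :=
    integral_meanCurvature_mul_angleCos hF hpos hp'
  have hd : sphereIntegral gd = 4 * Real.pi := integral_solidAngle hF hpos hp' hdir
  have hmG : 6 * sphereIntegral gm ≤ sphereIntegral gG := sphereForm_le_of_center hF hp' hcen hR
  have hm0 : 0 ≤ sphereIntegral gm := sphereIntegral_nonneg fun θ => mul_self_nonneg _
  have hgK : sphereIntegral gK = 4 * Real.pi := hK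
  have hA : area (radialGraph f) = sphereIntegral gJ := by
    simp only [area, surfaceIntegral, one_mul]; rfl
  have hA0 : 0 ≤ sphereIntegral gJ := sphereIntegral_nonneg fun θ => (areaDensity_pos hF hpos θ).le
  have hI : surfaceIntegral (radialGraph f) (meanCurvature (radialGraph f)) =
      sphereIntegral gH := rfl
  have hE : surfaceIntegral (radialGraph f) (normSqTraceFree (radialGraph f)) =
      1 / 2 * sphereIntegral gQ - 8 * Real.pi := by
    have h1 : surfaceIntegral (radialGraph f) (normSqTraceFree (radialGraph f)) =
        sphereIntegral ((1 / 2 : ℝ) • gQ - (2 : ℝ) • gK) := by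
      rw [surfaceIntegral, sphereIntegral_apply]
      congr 1
      funext θ
      rw [hKN]
      change _ = 1 / 2 * (meanCurvature (radialGraph f) θ ^ 2 * areaDensity (radialGraph f) θ) -
        2 * K θ
      ring
    rw [h1, map_sub, map_smul, map_smul, hgK, smul_eq_mul, smul_eq_mul]
    ring
  simp only [map_add, map_sub, map_smul, smul_eq_mul] at hmain hsq
  rw [hbc, hd] at hmain
  -- Gauss–Bonnet in the form ∫ (H − 2/R)² = 2 ∫ |h̊|² − (4/R) · deficit: the constants 16π cancel.
  have hdef : 2 * (1 / 2 * sphereIntegral gQ - 8 * Real.pi) -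
      4 * (sphereIntegral gH - sphereIntegral gJ / R - 4 * Real.pi * R) / R =
      sphereIntegral gQ - 4 / R * sphereIntegral gH + 4 / R ^ 2 * sphereIntegral gJ := by
    field_simp
    ring
  have hRF : R * (sphereIntegral gH - sphereIntegral gJ / R - 4 * Real.pi * R) =
      R * sphereIntegral gH - sphereIntegral gJ - R ^ 2 * (4 * Real.pi) := by
    field_simp
  have hfin := add_mul_nonneg_of_deficit (by linarith) hη0 hη hε
    (by rw [hRF, hdef]; linarith) (hdef ▸ hsq)
  rw [hA, hI, hE]
  linarith [sqrt_le_add hA0 hR0]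

end RadialMinkowski

end

theorem mainTheorem2 :
    ∀ ε : ℝ, 0 < ε → ∃ δ : ℝ, 0 < δ ∧
      ∀ f : RadialMinkowski.S2 → ℝ, ContMDiff (𝓡 2) 𝓘(ℝ, ℝ) 2 f →
        RadialMinkowski.c1Norm f < δ →
          √(16 * Real.pi * RadialMinkowski.area (RadialMinkowski.radialGraph f)) ≤
            RadialMinkowski.surfaceIntegral (RadialMinkowski.radialGraph f)
                (RadialMinkowski.meanCurvature (RadialMinkowski.radialGraph f)) +
              ε * RadialMinkowski.surfaceIntegral (RadialMinkowski.radialGraph f)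
                (RadialMinkowski.normSqTraceFree (RadialMinkowski.radialGraph f)) := by
  intro ε hε
  -- This minimum is η: the bound ε/4 gives 4η ≤ ε, and 1/16 keeps R² − 4η above R/2. Then δ is at
  -- most η and 1/2000.
  have hη : 0 < min (1 / 16) (ε / 4) := lt_min (by norm_num) (by positivity)
  have hδ : 0 < min (1 / 2000) (min (1 / 16) (ε / 4)) := lt_min (by norm_num) hη
  refine ⟨_, hδ, fun f hf hc => ?_⟩
  have hF := RadialMinkowski.contDiffOn_rayExt hf
  have hb := RadialMinkowski.abs_le_and_norm_sphereGradient_le hF hc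
  exact RadialMinkowski.sqrt_area_le hF (fun θ => (hb θ).1) (fun θ => (hb θ).2) hδ
    (min_le_left _ _) (min_le_right _ _) (min_le_left _ _)
    (by linarith [min_le_right (1 / 16) (ε / 4)])
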